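/- Let $S$ be a connected oriented surface, with or without boundary. A \emph{strand} on $S$ is an oriented loop or an oriented path joining two boundary points. A \emph{web} $\mathcal W$ on $S$ is a connected union of strands in generic position such that along every strand the orientations of the crossing strands alternate and the components of $S-\mathcal W$ (the domains) are discs. A domain is a $\bullet$-domain if all its sides run clockwise around it, a $\circ$-domain if all its sides run counterclockwise, and a face if the directions of its sides alternate. The associated bipartite graph $\Gamma$ has a $\bullet$- or $\circ$-vertex in each $\bullet$- or $\circ$-domain, an edge through each crossing point, and uncoloured external vertices on $\partial S$; $\Gamma$ is assumed to be connected and its coloured vertices to have valency at least $2$. Strands correspond to the \emph{zig-zag paths} of $\Gamma$, which turn maximally left at $\bullet$-vertices and maximally right at $\circ$-vertices. Let $p:\widetilde S\to S$ be the universal cover, $\widetilde{\mathcal W}=p^{-1}(\mathcal W)$ and $\widetilde\Gamma=p^{-1}(\Gamma)$. The web $\mathcal W$ is \emph{spectral} if every strand $\gamma$ of $\widetilde{\mathcal W}$ cuts $\widetilde S$ into two components, $\widetilde S_\gamma$ on the right of $\gamma$ and $\widetilde S'_\gamma$ on the left. Let $F_\gamma$ be the domain $\widetilde S_\gamma$,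 straightened so that it is bounded by the zig-zag path of $\gamma$ instead of $\gamma$. Attach, for every $\gamma$, a copy of $F_\gamma$ to $\widetilde\Gamma$ along this zig-zag path; this gives a space $\Sigma_{\widetilde{\mathcal W}}$ with an evident map to $\widetilde S$. Its quotient by $\pi_1(S)$ is the \emph{spectral surface} $\Sigma_{\mathcal W}$, with the \emph{spectral cover map} $\pi:\Sigma_{\mathcal W}\to S$. It contains $\Gamma$, and $\pi$ restricts to the inclusion $\Gamma\subset S$. \textbf{Theorem.} Let $\mathcal W$ be a spectral web on $S$ such that no zig-zag path of $\widetilde\Gamma$ passes twice through the same $\bullet$-vertex. Then $\pi$ can be ramified only at the $\bullet$-vertices of $\Gamma$: it is a covering map over the complement in $S$ of the $\bullet$-vertices, and a local homeomorphism at every point of $\Sigma_{\mathcal W}$ other than the $\bullet$-vertices of $\Gamma\subset\Sigma_{\mathcal W}$. At a $\bullet$-vertex of valency $n$ the ramification index of $\pi$ is $n-2$, in the convention in which $0$ means unramified: in suitable local coordinates centred at the vertex and at its image, $\pi$ is $z\mapsto z^{n-1}$. -/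

import Mathlib

open Set Filter Topology

noncomputable section

namespace SpectralWeb

/-! ### Oriented topological surfaces, with or without boundary -/

/-- A map `f` between open pieces of the plane preserves the orientation at `z`: the image of every
small positively oriented circle around `z` winds exactly once, positively, around `f z`. The
function `g` is a continuous choice of the argument along the image loop. -/
def PreservesOrientationAt (f : ℂ → ℂ) (z : ℂ) : Prop :=
  ∀ᶠ r : ℝ in 𝓝[>] 0, ∃ g : ℝ → ℝ, Continuous g ∧
    (∀ θ : ℝ, f (z + r * Complex.exp (θ * Complex.I)) ≠ f z ∧
      f (z + r * Complex.exp (θ * Complex.I)) - f z =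
        ‖f (z + r * Complex.exp (θ * Complex.I)) - f z‖ * Complex.exp (g θ * Complex.I)) ∧
    g (2 * Real.pi) = g 0 + 2 * Real.pi

/-- The closed half plane, the local model of a surface at a boundary point. -/
abbrev HalfPlane : Type := {z : ℂ // z.re ≤ 0}

/-- The structure of an oriented surface, possibly with boundary, on a topological space: an
oriented atlas of the interior, and a half plane chart around each remaining point. (Hausdorff,
second countable and connected are type class hypotheses.) -/
structure OrientedSurface (S : Type*) [TopologicalSpace S] where
  charts : Set (OpenPartialHomeomorph S ℂ)
  oriented : ∀ e ∈ charts, ∀ e' ∈ charts, ∀ x, x ∈ e.source → x ∈ e'.source →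
    PreservesOrientationAt (fun z => e' (e.symm z)) (e x)
  covered : ∀ x : S, (∃ e ∈ charts, x ∈ e.source) ∨
    ∃ b : OpenPartialHomeomorph S HalfPlane, x ∈ b.source ∧ (b x).1.re = 0

/-- The boundary of the surface. -/
def OrientedSurface.boundary {S : Type*} [TopologicalSpace S] (O : OrientedSurface S) : Set S :=
  {x | ∀ e ∈ O.charts, x ∉ e.source}

/-- A subset is a disc: homeomorphic to an open disc together with a (possibly empty) part of its
boundary circle. -/
def IsDisc {X : Type*} [TopologicalSpace X] (A : Set X) : Prop :=
  ∃ U : Set ℂ, Metric.ball 0 1 ⊆ U ∧ U ⊆ Metric.closedBall 0 1 ∧ Nonempty (A ≃ₜ U)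

/-! ### The closed unit disc with `n` spokes -/

/-- The angle of the `k`-th of `n` spokes. -/
def ang (n k : ℕ) : ℝ := 2 * Real.pi * k / n

/-- The end point of the `k`-th spoke; it depends only on `k` modulo `n`. -/
def tip (n k : ℕ) : ℂ := Complex.exp (ang n k * Complex.I)

/-- The `k`-th spoke, from the centre to the unit circle. -/
def spoke (n k : ℕ) : Set ℂ := {z | ∃ r ∈ Icc (0 : ℝ) 1, z = r * tip n k}

/-- The closed arc of the unit circle from spoke `k` to spoke `k + 1`. -/
def arc (n k : ℕ) : Set ℂ :=
  {z | ∃ θ ∈ Icc (ang n k) (ang n (k + 1)), z = Complex.exp (θ * Complex.I)}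

/-- The same arc without its two end points. -/
def openArc (n k : ℕ) : Set ℂ :=
  {z | ∃ θ ∈ Ioo (ang n k) (ang n (k + 1)), z = Complex.exp (θ * Complex.I)}

/-- The closed sector between spoke `k` and spoke `k + 1`. -/
def sector (n k : ℕ) : Set ℂ :=
  {z | ∃ r ∈ Icc (0 : ℝ) 1, ∃ θ ∈ Icc (ang n k) (ang n (k + 1)),
    z = r * Complex.exp (θ * Complex.I)}

/-- The same sector without its two spokes (hence without the centre). -/
def innerSector (n k : ℕ) : Set ℂ :=
  {z | ∃ r ∈ Ioc (0 : ℝ) 1, ∃ θ ∈ Ioo (ang n k) (ang n (k + 1)),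
    z = r * Complex.exp (θ * Complex.I)}

/-! ### Webs and their bipartite graphs -/

/-- The data of a web together with its bipartite graph on a space `X`: for every internal vertex
`v` its colour, its valency, and a parametrisation by the closed unit disc of the closed
`•`-domain or `◦`-domain of the web with centre `v`. The disc is divided by its spokes, which are
the edges of the graph at `v` (up to the crossing point of the web on the edge, or up to the
external vertex); the arcs of its boundary circle are the sides of the domain, that is, the pieces
of the strands around `v`. Only the values of `disk v` on the closed unit disc matter. -/
structure WebData (V X : Type*) where
  black : V → Prop
  val : V → ℕ
  disk : V → ℂ → X

variable {V X S : Type*}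

namespace WebData

/-- The closed domain of the web around the vertex `v`. -/
def closedDomainAt (D : WebData V X) (v : V) : Set X := D.disk v '' Metric.closedBall 0 1

/-- The open domain of the web around the vertex `v`. -/
def domainAt (D : WebData V X) (v : V) : Set X := D.disk v '' Metric.ball 0 1

/-- The bipartite graph, as a subset of `X`. -/
def graph (D : WebData V X) : Set X :=
  {x | ∃ v : V, x = D.disk v 0 ∨ ∃ k : Fin (D.val v), x ∈ D.disk v '' spoke (D.val v) k}

/-- `D` is a web, given with its bipartite graph, on the oriented surface `S`. In a web the
orientations of the strands crossing a given strand alternate; equivalently, every side of a strand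
between two crossings has a face on one side, and on the other side either a `•`-domain, which the
strands go around clockwise, or a `◦`-domain, which they go around counterclockwise. The web is
recorded by these coloured domains: it is the union of their boundary circles. The two strands that
end next to an external vertex are drawn up to that vertex. -/
structure IsWeb [TopologicalSpace S] (O : OrientedSurface S) (D : WebData V S) : Prop where
  /-- Internal vertices have valency at least two. -/
  two_le_val : ∀ v, 2 ≤ D.val v
  continuousOn : ∀ v, ContinuousOn (D.disk v) (Metric.closedBall 0 1)
  injOn : ∀ v, InjOn (D.disk v) (Metric.closedBall 0 1)
  isOpen_domainAt : ∀ v, IsOpen (D.domainAt v)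
  /-- The parametrisations are compatible with the orientation of the surface. -/
  oriented : ∀ v, ∀ z ∈ Metric.ball (0 : ℂ) 1, ∀ e ∈ O.charts, D.disk v z ∈ e.source →
    PreservesOrientationAt (fun w => e (D.disk v w)) z
  locallyFinite : LocallyFinite D.closedDomainAt
  /-- Two closed domains meet only at common corners, and only if their colours differ. -/
  meet : ∀ v w, v ≠ w → ∀ z ∈ Metric.closedBall (0 : ℂ) 1, ∀ z' ∈ Metric.closedBall (0 : ℂ) 1,
    D.disk v z = D.disk w z' →
      ¬(D.black v ↔ D.black w) ∧ (∃ k : Fin (D.val v), z = tip (D.val v) k) ∧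
        ∃ l : Fin (D.val w), z' = tip (D.val w) l
  /-- The domains meet the boundary of `S` only at corners. -/
  boundary : ∀ v, ∀ z ∈ Metric.closedBall (0 : ℂ) 1, D.disk v z ∈ O.boundary →
    ∃ k : Fin (D.val v), z = tip (D.val v) k
  /-- Generic position. Each corner is either a crossing point of the web, where a `•`-domain and a
  `◦`-domain touch each other from opposite sides, or an external vertex on the boundary of `S`,
  which belongs to no other domain. The two models are: two tangent discs in the plane, and one
  disc in the half plane, tangent to the boundary line. -/
  corner : ∀ (v : V) (k : Fin (D.val v)),
    (∃ (w : V) (l : Fin (D.val w)), ¬(D.black v ↔ D.black w) ∧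
      ∃ r > (0 : ℝ), ∃ χ : OpenPartialHomeomorph ℂ S, χ.source = Metric.ball 0 r ∧
        (∀ ζ ∈ χ.source, ‖1 + ζ‖ ≤ 1 → χ ζ = D.disk v (tip (D.val v) k * (1 + ζ))) ∧
        (∀ ζ ∈ χ.source, ‖1 - ζ‖ ≤ 1 → χ ζ = D.disk w (tip (D.val w) l * (1 - ζ)))) ∨
    (D.disk v (tip (D.val v) k) ∈ O.boundary ∧
      (∀ w, w ≠ v → D.disk v (tip (D.val v) k) ∉ D.closedDomainAt w) ∧
      ∃ r > (0 : ℝ), ∃ χ : OpenPartialHomeomorph HalfPlane S, χ.source = {ζ | ‖ζ.1‖ < r} ∧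
        ∀ ζ ∈ χ.source, ‖1 + ζ.1‖ ≤ 1 → χ ζ = D.disk v (tip (D.val v) k * (1 + ζ.1)))
  connected : IsConnected D.graph
  /-- The remaining domains, the faces, are discs. -/
  faces : ∀ x ∉ ⋃ v, D.closedDomainAt v,
    IsDisc (connectedComponentIn (⋃ v, D.closedDomainAt v)ᶜ x)

/-! ### Strands and zig-zag paths -/

/-- A corner: the angle at a vertex between the spokes `k` and `k + 1`. -/
def Corner (D : WebData V X) : Type _ := Σ v : V, Fin (D.val v)

/-- The strands go clockwise around the `•`-vertices, so from spoke `k + 1` to spoke `k`, and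
counterclockwise around the `◦`-vertices. The strand leaving the corner `c` continues through the
crossing point with the corner `c'`, at a vertex of the other colour. -/
def Follows (D : WebData V X) (c c' : D.Corner) : Prop :=
  (D.black c.1 ∧ ¬D.black c'.1 ∧
    D.disk c.1 (tip (D.val c.1) c.2) = D.disk c'.1 (tip (D.val c'.1) c'.2)) ∨
  (¬D.black c.1 ∧ D.black c'.1 ∧
    D.disk c.1 (tip (D.val c.1) (c.2 + 1)) = D.disk c'.1 (tip (D.val c'.1) (c'.2 + 1)))

/-- A strand, or zig-zag path: a maximal sequence of corners following each other. -/
def Strand (D : WebData V X) : Type _ := Quot D.Follows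

/-- The strand passing along a corner. -/
def strandOf (D : WebData V X) (c : D.Corner) : D.Strand := Quot.mk _ c

/-- The points of a strand. -/
def strandSet (D : WebData V X) (γ : D.Strand) : Set X :=
  {x | ∃ c : D.Corner, D.strandOf c = γ ∧ x ∈ D.disk c.1 '' arc (D.val c.1) c.2}

/-- The points of the zig-zag path on the graph that corresponds to a strand. -/
def zigzag (D : WebData V X) (γ : D.Strand) : Set X :=
  {x | ∃ c : D.Corner, D.strandOf c = γ ∧
    x ∈ D.disk c.1 '' (spoke (D.val c.1) c.2 ∪ spoke (D.val c.1) (c.2 + 1))}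

/-- The strand `γ` cuts `X` into the two components `A` and `B`, where `A` lies on the right of
`γ` and `B` on the left of `γ`. As `γ` has the `•`-domains on its right and the `◦`-domains on its
left, this says that along a side of a `•`-domain `A` is this domain, and that along a side of a
`◦`-domain `B` is this domain. -/
structure Cuts [TopologicalSpace X] (D : WebData V X) (γ : D.Strand) (A B : Set X) : Prop where
  isOpen_right : IsOpen A
  isOpen_left : IsOpen B
  isConnected_right : IsConnected A
  isConnected_left : IsConnected B
  disjoint : Disjoint A B
  union : A ∪ B = (D.strandSet γ)ᶜ
  right : ∀ c : D.Corner, D.strandOf c = γ → D.black c.1 →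
    ∀ y ∈ D.disk c.1 '' openArc (D.val c.1) c.2, ∀ᶠ x in 𝓝 y, x ∈ A ↔ x ∈ D.domainAt c.1
  left : ∀ c : D.Corner, D.strandOf c = γ → ¬D.black c.1 →
    ∀ y ∈ D.disk c.1 '' openArc (D.val c.1) c.2, ∀ᶠ x in 𝓝 y, x ∈ B ↔ x ∈ D.domainAt c.1

/-- The component of the complement of the strand `γ` on the right of `γ`. -/
def rightSide [TopologicalSpace X] (D : WebData V X) (γ : D.Strand) : Set X :=
  {x | ∃ A B, D.Cuts γ A B ∧ x ∈ A}

/-! ### The spectral surface -/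

/-- The domain on the right of `γ`, bounded by the zig-zag path on the graph instead of the
strand: the thin sectors between strand and zig-zag path are removed at the `•`-vertices and added
at the `◦`-vertices. -/
def zigzagDomain [TopologicalSpace X] (D : WebData V X) (γ : D.Strand) : Set X :=
  (D.rightSide γ \ {x | ∃ c : D.Corner, D.strandOf c = γ ∧ D.black c.1 ∧
      x ∈ D.disk c.1 '' sector (D.val c.1) c.2}) ∪
    {x | ∃ c : D.Corner, D.strandOf c = γ ∧ ¬D.black c.1 ∧
      x ∈ D.disk c.1 '' innerSector (D.val c.1) c.2}

/-- The domain together with its boundary, the zig-zag path: the piece `F_γ` that is attached to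
the graph. -/
def face [TopologicalSpace X] (D : WebData V X) (γ : D.Strand) : Set X :=
  D.zigzagDomain γ ∪ D.zigzag γ

/-- The disjoint union of the graph and of the pieces `F_γ` over all strands `γ`. -/
abbrev Pieces [TopologicalSpace X] (D : WebData V X) : Type _ :=
  D.graph ⊕ (Σ γ : D.Strand, D.face γ)

/-- The tautological map of the pieces to `X`. -/
def piecesMap [TopologicalSpace X] (D : WebData V X) : D.Pieces → X
  | .inl x => x.1
  | .inr y => y.2.1

/-- The points of the pieces at which they are glued: all of the graph, and in `F_γ` the
zig-zag path. -/
def OnGraph [TopologicalSpace X] (D : WebData V X) : D.Pieces → Prop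
  | .inl _ => True
  | .inr y => y.2.1 ∈ D.zigzag y.1

/-- Each `F_γ` is glued to the graph along its zig-zag path. -/
def gluing [TopologicalSpace X] (D : WebData V X) : Setoid D.Pieces where
  r a b := a = b ∨ (D.OnGraph a ∧ D.OnGraph b ∧ D.piecesMap a = D.piecesMap b)
  iseqv :=
    { refl := fun _ => Or.inl rfl
      symm := by
        rintro a b (h | ⟨h1, h2, h3⟩)
        · exact Or.inl h.symm
        · exact Or.inr ⟨h2, h1, h3.symm⟩
      trans := by
        rintro a b c (rfl | ⟨h1, h2, h3⟩) (rfl | ⟨h4, h5, h6⟩)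
        · exact Or.inl rfl
        · exact Or.inr ⟨h4, h5, h6⟩
        · exact Or.inr ⟨h1, h2, h3⟩
        · exact Or.inr ⟨h1, h5, h3.trans h6⟩ }

/-- The surface obtained from the graph by attaching all pieces `F_γ`, with the quotient topology. -/
def Glued [TopologicalSpace X] (D : WebData V X) : Type _ := Quotient D.gluing

instance [TopologicalSpace X] (D : WebData V X) : TopologicalSpace D.Glued :=
  inferInstanceAs (TopologicalSpace (Quotient D.gluing))

/-- The spectral cover map, for a web on the surface `X` itself. -/
def gluedMap [TopologicalSpace X] (D : WebData V X) : D.Glued → X :=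
  Quotient.lift D.piecesMap (by
    rintro a b (rfl | ⟨-, -, h⟩)
    · rfl
    · exact h)

end WebData

/-! ### Passing to the universal cover -/

section UniversalCover

variable {T : Type*} [TopologicalSpace T]

namespace WebData

/-- The vertices of the preimage of the bipartite graph under `p : T → S`. -/
abbrev LiftVertex (D : WebData V S) (p : T → S) : Type _ := Σ v : V, {x : T // p x = D.disk v 0}

/-- `f` lifts the disc around `v` to `T`, with centre `x`. -/
def IsDiskLift (D : WebData V S) (p : T → S) (v : V) (x : T) (f : ℂ → T) : Prop :=
  ContinuousOn f (Metric.closedBall 0 1) ∧ f 0 = x ∧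
    ∀ z ∈ Metric.closedBall (0 : ℂ) 1, p (f z) = D.disk v z

open Classical in
/-- The preimage of a web under a covering map `p`. The disc around a lift `x` of the vertex `v` is
the lift of the disc around `v` with centre `x`; it exists and is unique on the closed unit disc
because the disc is simply connected. -/
def lift (D : WebData V S) (p : T → S) : WebData (D.LiftVertex p) T where
  black v := D.black v.1
  val v := D.val v.1
  disk v := if h : ∃ f, D.IsDiskLift p v.1 v.2.1 f then h.choose else fun _ => v.2.1

theorem lift_disk_zero (D : WebData V S) (p : T → S) (v : D.LiftVertex p) :
    (D.lift p).disk v 0 = v.2.1 := by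
  by_cases h : ∃ f, D.IsDiskLift p v.1 v.2.1 f
  · simp only [lift, dif_pos h]
    exact h.choose_spec.2.1
  · simp only [lift, dif_neg h]

/-- A web is spectral if every strand of its preimage on the universal cover `p : T → S` cuts `T`
into two components, one on the right and one on the left of the strand. -/
def IsSpectral (D : WebData V S) (p : T → S) : Prop :=
  ∀ γ : (D.lift p).Strand, ∃ A B, (D.lift p).Cuts γ A B

/-- On the universal cover `p : T → S`, no zig-zag path passes twice through the same
`•`-vertex. -/
def SimpleAtBlack (D : WebData V S) (p : T → S) : Prop :=
  ∀ v : D.LiftVertex p, D.black v.1 → ∀ k l : Fin ((D.lift p).val v),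
    (D.lift p).strandOf ⟨v, k⟩ = (D.lift p).strandOf ⟨v, l⟩ → k = l

/-- The deck transformations of `p`; for the universal cover they form the group `π₁(S)`. -/
def IsDeck (p : T → S) (g : T ≃ₜ T) : Prop := ∀ x, p (g x) = p x

/-- The action of a deck transformation on the corners of the preimage of a web. -/
def deckCorner (D : WebData V S) (p : T → S) (g : T ≃ₜ T) (hg : IsDeck p g)
    (c : (D.lift p).Corner) : (D.lift p).Corner :=
  ⟨⟨c.1.1, ⟨g c.1.2.1, (hg _).trans c.1.2.2⟩⟩, c.2⟩

/-- The deck transformation `g` takes the strand `γ` to the strand `γ'`. -/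
def MovesStrand (D : WebData V S) (p : T → S) (g : T ≃ₜ T) (hg : IsDeck p g)
    (γ γ' : (D.lift p).Strand) : Prop :=
  ∃ c, (D.lift p).strandOf c = γ ∧ (D.lift p).strandOf (D.deckCorner p g hg c) = γ'

/-- The deck transformation `g` takes the point `a` of the pieces to the point `b`. -/
def MovesPiece (D : WebData V S) (p : T → S) (g : T ≃ₜ T) (hg : IsDeck p g) :
    (D.lift p).Pieces → (D.lift p).Pieces → Prop
  | .inl x, .inl y => g x.1 = y.1
  | .inr x, .inr y => D.MovesStrand p g hg x.1 y.1 ∧ g x.2.1 = y.2.1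
  | _, _ => False

/-- Two points of the glued surface over the universal cover are in the same orbit of the deck
transformations. -/
def SameOrbit (D : WebData V S) (p : T → S) (a b : (D.lift p).Glued) : Prop :=
  ∃ (g : T ≃ₜ T) (hg : IsDeck p g) (a' b' : (D.lift p).Pieces),
    Quotient.mk _ a' = a ∧ Quotient.mk _ b' = b ∧ D.MovesPiece p g hg a' b'

/-- The spectral surface of a web on `S`: the quotient by `π₁(S)` of the surface glued over the
universal cover. -/
def SpectralSurface (D : WebData V S) (p : T → S) : Type _ := Quot (D.SameOrbit p)

instance (D : WebData V S) (p : T → S) : TopologicalSpace (D.SpectralSurface p) :=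
  inferInstanceAs (TopologicalSpace (Quot (D.SameOrbit p)))

/-- The spectral cover map of a web on `S`. -/
def spectralMap (D : WebData V S) (p : T → S) : D.SpectralSurface p → S :=
  Quot.lift (fun a => p ((D.lift p).gluedMap a)) (by
    rintro a b ⟨g, hg, a', b', rfl, rfl, h⟩
    rcases a' with x | x <;> rcases b' with y | y
    · exact (hg x.1).symm.trans (congrArg p h)
    · exact h.elim
    · exact h.elim
    · exact (hg x.2.1).symm.trans (congrArg p h.2))

/-- The vertices of the graph, as points of the spectral surface. The vertex `v` of the graph on
`S` is the image of any of its lifts. -/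
def vertexPoint (D : WebData V S) (p : T → S) (v : D.LiftVertex p) : D.SpectralSurface p :=
  Quot.mk _ (Quotient.mk _ (Sum.inl ⟨v.2.1, v, Or.inl (D.lift_disk_zero p v).symm⟩))

end WebData

end UniversalCover

/-- `f` has at `x` the ramification index `m` in the convention where `m = 0` means unramified:
in suitable local coordinates centred at `x` and at `f x`, `f` is `z ↦ z ^ (m + 1)`. -/
def HasRamificationIndex {X Y : Type*} [TopologicalSpace X] [TopologicalSpace Y]
    (f : X → Y) (x : X) (m : ℕ) : Prop :=
  ∃ (a : OpenPartialHomeomorph X ℂ) (b : OpenPartialHomeomorph Y ℂ),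
    x ∈ a.source ∧ f x ∈ b.source ∧ a x = 0 ∧ b (f x) = 0 ∧
      ∀ y ∈ a.source, f y ∈ b.source ∧ b (f y) = a y ^ (m + 1)

end SpectralWeb

end

/-! Everything is local on the surface glued over the universal cover, which consists of the pieces
`D.face γ` attached to each other along the graph. The questions are which pieces lie over a small
open set and how they fit together there. The domain of `γ` is open, its union with the zig-zag path
is closed, and the two parts are disjoint (`isOpen_zigzagDomain`, `isClosed_face`,
`disjoint_zigzag`). So a connected set that avoids the zig-zag path lies inside the piece or outside
it.

Off the graph, the pieces through a point are therefore disjoint sheets. At a point of an edge, only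
the zig-zag paths of the two adjacent corners can pass, and on each side of the edge exactly one of
their pieces is present, so these pieces join to one sheet. At a `◦`-vertex a piece contains just
the sectors at its own corners, and the n sectors together make one full disc, again one sheet.

At a `•`-vertex of valency n the piece of a corner k is instead the whole disc minus the open sector
k. Since no zig-zag path returns to the vertex, the n corners give n different pieces, each of n - 1
sectors. Glued cyclically along spokes they make a disc of n(n - 1) sectors, winding n - 1 times
around the vertex. This is z ↦ z^(n-1): it spreads the sector m over all sectors but the sector n -
1 - m, which identifies it with one piece (`exists_ramified_chart`).

Generic position enters only through `Tame.twoSided`: near a point of an edge the graph has two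
connected sides. This property, like the others in `Tame`, passes to coverings (`Tame.lift_tame`).
Finally, deck transformations act freely on the glued surface, and transitively on the fibres of the
universal cover, so sheets and charts descend to the spectral surface (`hasSheets_spectralMap`,
`isLocalHomeomorph_toSpectral`). -/

set_option linter.unusedSectionVars false

noncomputable section
namespace SpectralWeb

/-! ### Geometry of the disc with `n` spokes -/

/-- The point at distance `r` from the centre, at the angle of `t` sectors. -/
def polar (n : ℕ) (r t : ℝ) : ℂ := r * Complex.exp ((2 * Real.pi * t / n : ℝ) * Complex.I)

theorem norm_polar (n : ℕ) (r t : ℝ) : ‖polar n r t‖ = |r| := by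
  rw [polar, norm_mul, Complex.norm_exp_ofReal_mul_I, mul_one, Complex.norm_real, Real.norm_eq_abs]

theorem polar_zero (n : ℕ) (t : ℝ) : polar n 0 t = 0 := by simp [polar]

theorem polar_pow (n j : ℕ) (r t : ℝ) : polar n r t ^ j = polar n (r ^ j) (j * t) := by
  rw [polar, mul_pow, ← Complex.exp_nat_mul, polar]
  push_cast
  congr 2
  ring

theorem polar_add_int (n : ℕ) (hn : 0 < n) (r t : ℝ) (m : ℤ) :
    polar n r (t + n * m) = polar n r t := by
  have hn' : (n : ℂ) ≠ 0 := by exact_mod_cast hn.ne'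
  rw [polar, polar]
  congr 1
  rw [Complex.exp_eq_exp_iff_exists_int]
  refine ⟨m, ?_⟩
  push_cast
  field_simp

theorem polar_eq {n : ℕ} (hn : 0 < n) {r r' t t' : ℝ} (hr : 0 < r) (hr' : 0 ≤ r')
    (h : polar n r t = polar n r' t') : r = r' ∧ ∃ m : ℤ, t = t' + n * m := by
  have h1 : r = r' := by
    have := congrArg norm h
    rwa [norm_polar, norm_polar, abs_of_pos hr, abs_of_nonneg hr'] at this
  refine ⟨h1, ?_⟩
  subst h1
  rw [polar, polar] at h
  have h2 := mul_left_cancel₀ (by exact_mod_cast hr.ne') h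
  rw [Complex.exp_eq_exp_iff_exists_int] at h2
  obtain ⟨m, hm⟩ := h2
  refine ⟨m, ?_⟩
  have h3 : ((2 * Real.pi * t / n : ℝ) : ℂ) = (2 * Real.pi * t' / n + m * (2 * Real.pi) : ℝ) := by
    apply mul_right_cancel₀ Complex.I_ne_zero
    rw [hm]
    push_cast
    ring
  have h4 : 2 * Real.pi * t / n = 2 * Real.pi * t' / n + m * (2 * Real.pi) := by exact_mod_cast h3
  have hn' : (n : ℝ) ≠ 0 := by exact_mod_cast hn.ne'
  have := Real.pi_pos
  field_simp at h4
  linarith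

/-- The start `a` of the window of angles is left free, so that the circle can later be cut open
along the sector omitted by the power map. -/
theorem exists_polar {n : ℕ} (hn : 0 < n) (z : ℂ) (a : ℝ) :
    ∃ t ∈ Ico a (a + n), z = polar n ‖z‖ t := by
  have hn' : (0 : ℝ) < n := by exact_mod_cast hn
  refine ⟨toIcoMod hn' a (n * z.arg / (2 * Real.pi)), toIcoMod_mem_Ico _ _ _, ?_⟩
  have h : n * z.arg / (2 * Real.pi) = toIcoMod hn' a (n * z.arg / (2 * Real.pi)) +
      n * (toIcoDiv hn' a (n * z.arg / (2 * Real.pi)) : ℤ) := by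
    conv_lhs => rw [← toIcoMod_add_toIcoDiv_zsmul hn' a (n * z.arg / (2 * Real.pi))]
    rw [zsmul_eq_mul]
    ring
  rw [← polar_add_int n hn, ← h, polar]
  conv_lhs => rw [← Complex.norm_mul_exp_arg_mul_I z]
  congr 4
  have := Real.pi_pos
  field_simp

theorem tip_eq_polar (n k : ℕ) : tip n k = polar n 1 k := by
  simp [tip, polar, ang]

theorem mul_tip_eq_polar (n k : ℕ) (r : ℝ) : r * tip n k = polar n r k := by
  simp [tip, polar, ang]

theorem norm_tip (n k : ℕ) : ‖tip n k‖ = 1 := by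
  rw [tip_eq_polar, norm_polar, abs_one]

theorem tip_ne_zero (n k : ℕ) : tip n k ≠ 0 := by
  rw [← norm_pos_iff, norm_tip]; exact one_pos

theorem mem_spoke {n k : ℕ} {z : ℂ} : z ∈ spoke n k ↔ ∃ r ∈ Icc (0 : ℝ) 1, z = polar n r k := by
  simp only [spoke, mul_tip_eq_polar, mem_ofPred_eq]

theorem ang_le_iff {n : ℕ} (hn : 0 < n) {k : ℕ} {t : ℝ} :
    ang n k ≤ 2 * Real.pi * t / n ↔ (k : ℝ) ≤ t := by
  have hn' : (0 : ℝ) < n := by exact_mod_cast hn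
  rw [ang, div_le_div_iff_of_pos_right hn', mul_le_mul_iff_right₀ Real.two_pi_pos]

theorem le_ang_iff {n : ℕ} (hn : 0 < n) {k : ℕ} {t : ℝ} :
    2 * Real.pi * t / n ≤ ang n k ↔ t ≤ (k : ℝ) := by
  have hn' : (0 : ℝ) < n := by exact_mod_cast hn
  rw [ang, div_le_div_iff_of_pos_right hn', mul_le_mul_iff_right₀ Real.two_pi_pos]

theorem exists_turn {n : ℕ} (hn : 0 < n) (θ : ℝ) : ∃ t : ℝ, θ = 2 * Real.pi * t / n := by
  have hn' : (0 : ℝ) < n := by exact_mod_cast hn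
  have := Real.pi_pos
  exact ⟨n * θ / (2 * Real.pi), by field_simp⟩

theorem mem_sector {n : ℕ} (hn : 0 < n) {k : ℕ} {z : ℂ} : z ∈ sector n k ↔
    ∃ r ∈ Icc (0 : ℝ) 1, ∃ t ∈ Icc (k : ℝ) (k + 1), z = polar n r t := by
  constructor
  · rintro ⟨r, hr, θ, ⟨h1, h2⟩, rfl⟩
    obtain ⟨t, rfl⟩ := exists_turn hn θ
    rw [ang_le_iff hn] at h1
    rw [le_ang_iff hn] at h2
    exact ⟨r, hr, t, ⟨h1, by exact_mod_cast h2⟩, rfl⟩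
  · rintro ⟨r, hr, t, ⟨h1, h2⟩, rfl⟩
    exact ⟨r, hr, _, ⟨(ang_le_iff hn).2 h1, (le_ang_iff hn).2 (by exact_mod_cast h2)⟩, rfl⟩

theorem mem_innerSector {n : ℕ} (hn : 0 < n) {k : ℕ} {z : ℂ} : z ∈ innerSector n k ↔
    ∃ r ∈ Ioc (0 : ℝ) 1, ∃ t ∈ Ioo (k : ℝ) (k + 1), z = polar n r t := by
  constructor
  · rintro ⟨r, hr, θ, ⟨h1, h2⟩, rfl⟩
    obtain ⟨t, rfl⟩ := exists_turn hn θ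
    rw [← not_le, le_ang_iff hn, not_le] at h1
    rw [← not_le, ang_le_iff hn, not_le] at h2
    exact ⟨r, hr, t, ⟨h1, by exact_mod_cast h2⟩, rfl⟩
  · rintro ⟨r, hr, t, ⟨h1, h2⟩, rfl⟩
    refine ⟨r, hr, _, ⟨?_, ?_⟩, rfl⟩
    · rwa [← not_le, le_ang_iff hn, not_le]
    · rw [← not_le, ang_le_iff hn, not_le]; exact_mod_cast h2

theorem mem_openArc {n : ℕ} (hn : 0 < n) {k : ℕ} {z : ℂ} : z ∈ openArc n k ↔
    ∃ t ∈ Ioo (k : ℝ) (k + 1), z = polar n 1 t := by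
  constructor
  · rintro ⟨θ, ⟨h1, h2⟩, rfl⟩
    obtain ⟨t, rfl⟩ := exists_turn hn θ
    rw [← not_le, le_ang_iff hn, not_le] at h1
    rw [← not_le, ang_le_iff hn, not_le] at h2
    exact ⟨t, ⟨h1, by exact_mod_cast h2⟩, by simp [polar]⟩
  · rintro ⟨t, ⟨h1, h2⟩, rfl⟩
    refine ⟨2 * Real.pi * t / n, ⟨?_, ?_⟩, by rw [polar, Complex.ofReal_one, one_mul]⟩
    · rwa [← not_le, le_ang_iff hn, not_le]
    · rw [← not_le, ang_le_iff hn, not_le]; exact_mod_cast h2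

theorem mem_arc {n : ℕ} (hn : 0 < n) {k : ℕ} {z : ℂ} : z ∈ arc n k ↔
    ∃ t ∈ Icc (k : ℝ) (k + 1), z = polar n 1 t := by
  constructor
  · rintro ⟨θ, ⟨h1, h2⟩, rfl⟩
    obtain ⟨t, rfl⟩ := exists_turn hn θ
    rw [ang_le_iff hn] at h1
    rw [le_ang_iff hn] at h2
    exact ⟨t, ⟨h1, by exact_mod_cast h2⟩, by simp [polar]⟩
  · rintro ⟨t, ⟨h1, h2⟩, rfl⟩
    exact ⟨_, ⟨(ang_le_iff hn).2 h1, (le_ang_iff hn).2 (by exact_mod_cast h2)⟩,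
      by rw [polar, Complex.ofReal_one, one_mul]⟩

theorem isCompact_spoke (n k : ℕ) : IsCompact (spoke n k) := by
  have : spoke n k = (fun r : ℝ => (r : ℂ) * tip n k) '' Icc 0 1 := by
    ext z; simp [spoke, eq_comm]
  rw [this]
  exact isCompact_Icc.image (by fun_prop)

theorem isCompact_sector (n k : ℕ) : IsCompact (sector n k) := by
  have : sector n k = (fun q : ℝ × ℝ => q.1 * Complex.exp (q.2 * Complex.I)) ''
      (Icc 0 1 ×ˢ Icc (ang n k) (ang n (k + 1))) := by
    ext z
    constructor
    · rintro ⟨r, hr, θ, hθ, rfl⟩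
      exact ⟨(r, θ), ⟨hr, hθ⟩, rfl⟩
    · rintro ⟨⟨r, θ⟩, ⟨hr, hθ⟩, rfl⟩
      exact ⟨r, hr, θ, hθ, rfl⟩
  rw [this]
  exact (isCompact_Icc.prod isCompact_Icc).image (by fun_prop)

theorem polar_mem_closedBall {n : ℕ} {r t : ℝ} (hr : r ∈ Icc (0 : ℝ) 1) :
    polar n r t ∈ Metric.closedBall (0 : ℂ) 1 := by
  rw [mem_closedBall_zero_iff, norm_polar, abs_of_nonneg hr.1]
  exact hr.2

theorem spoke_subset (n k : ℕ) : spoke n k ⊆ Metric.closedBall 0 1 := by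
  intro z hz
  obtain ⟨r, hr, rfl⟩ := mem_spoke.1 hz
  exact polar_mem_closedBall hr

theorem sector_subset (n k : ℕ) : sector n k ⊆ Metric.closedBall 0 1 := by
  rintro _ ⟨r, hr, θ, -, rfl⟩
  rw [mem_closedBall_zero_iff, norm_mul, Complex.norm_exp_ofReal_mul_I, mul_one, Complex.norm_real,
    Real.norm_eq_abs, abs_of_nonneg hr.1]
  exact hr.2

theorem innerSector_subset_sector (n k : ℕ) : innerSector n k ⊆ sector n k := by
  rintro _ ⟨r, hr, θ, hθ, rfl⟩
  exact ⟨r, ⟨hr.1.le, hr.2⟩, θ, ⟨hθ.1.le, hθ.2.le⟩, rfl⟩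

theorem innerSector_subset (n k : ℕ) : innerSector n k ⊆ Metric.closedBall 0 1 :=
  (innerSector_subset_sector n k).trans (sector_subset n k)

theorem arc_subset_sphere (n k : ℕ) : arc n k ⊆ Metric.sphere 0 1 := by
  rintro _ ⟨θ, -, rfl⟩
  rw [mem_sphere_zero_iff_norm, Complex.norm_exp_ofReal_mul_I]

theorem openArc_subset_arc (n k : ℕ) : openArc n k ⊆ arc n k := by
  rintro _ ⟨θ, h, rfl⟩
  exact ⟨θ, ⟨h.1.le, h.2.le⟩, rfl⟩

theorem openArc_subset_innerSector (n k : ℕ) : openArc n k ⊆ innerSector n k := by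
  rintro _ ⟨θ, h, rfl⟩
  exact ⟨1, ⟨one_pos, le_rfl⟩, θ, h, by simp⟩

theorem arc_subset (n k : ℕ) : arc n k ⊆ Metric.closedBall 0 1 :=
  (arc_subset_sphere n k).trans Metric.sphere_subset_closedBall

theorem openArc_subset (n k : ℕ) : openArc n k ⊆ Metric.closedBall 0 1 :=
  (openArc_subset_arc n k).trans (arc_subset n k)

theorem tip_mem_closedBall (n k : ℕ) : tip n k ∈ Metric.closedBall (0 : ℂ) 1 := by
  rw [mem_closedBall_zero_iff, norm_tip]

theorem tip_mem_spoke (n k : ℕ) : tip n k ∈ spoke n k := ⟨1, ⟨zero_le_one, le_rfl⟩, by simp⟩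

theorem zero_mem_spoke (n k : ℕ) : (0 : ℂ) ∈ spoke n k := ⟨0, ⟨le_rfl, zero_le_one⟩, by simp⟩

theorem tip_mem_arc_left {n : ℕ} (hn : 0 < n) (k : ℕ) : tip n k ∈ arc n k :=
  (mem_arc hn).2 ⟨k, ⟨le_rfl, by linarith⟩, tip_eq_polar n k⟩

theorem tip_mem_arc_right {n : ℕ} (hn : 0 < n) (k : ℕ) : tip n (k + 1) ∈ arc n k :=
  (mem_arc hn).2 ⟨(k + 1 : ℕ), ⟨by push_cast; linarith, by push_cast; rfl⟩, tip_eq_polar n (k + 1)⟩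

theorem openArc_nonempty {n : ℕ} (hn : 0 < n) (k : ℕ) : (openArc n k).Nonempty :=
  ⟨_, (mem_openArc hn).2 ⟨k + 1 / 2, ⟨by linarith, by linarith⟩, rfl⟩⟩

theorem mem_openArc_or_tip {n : ℕ} (hn : 0 < n) {k : ℕ} {z : ℂ} (h : z ∈ arc n k) :
    z ∈ openArc n k ∨ z = tip n k ∨ z = tip n (k + 1) := by
  obtain ⟨t, ⟨h1, h2⟩, rfl⟩ := (mem_arc hn).1 h
  rcases h1.eq_or_lt with h1 | h1
  · right; left; rw [tip_eq_polar, h1]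
  rcases h2.eq_or_lt with h2 | h2
  · right; right; rw [tip_eq_polar, h2]; push_cast; rfl
  · left; exact (mem_openArc hn).2 ⟨t, ⟨h1, h2⟩, rfl⟩

theorem mem_innerSector_or_spoke {n : ℕ} (hn : 0 < n) {k : ℕ} {z : ℂ} (h : z ∈ sector n k) :
    z ∈ innerSector n k ∨ z ∈ spoke n k ∪ spoke n (k + 1) := by
  obtain ⟨r, hr, t, ⟨h1, h2⟩, rfl⟩ := (mem_sector hn).1 h
  rcases hr.1.eq_or_lt with h0 | h0
  · right; left; rw [← h0, polar_zero]; exact zero_mem_spoke n k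
  rcases h1.eq_or_lt with h1 | h1
  · right; left; exact mem_spoke.2 ⟨r, hr, by rw [h1]⟩
  rcases h2.eq_or_lt with h2 | h2
  · right; right; exact mem_spoke.2 ⟨r, hr, by rw [h2]; push_cast; rfl⟩
  · left; exact (mem_innerSector hn).2 ⟨r, ⟨h0, hr.2⟩, t, ⟨h1, h2⟩, rfl⟩

theorem spoke_left_subset_sector {n : ℕ} (hn : 0 < n) (k : ℕ) : spoke n k ⊆ sector n k := by
  intro z hz
  obtain ⟨r, hr, rfl⟩ := mem_spoke.1 hz
  exact (mem_sector hn).2 ⟨r, hr, k, ⟨le_rfl, by linarith⟩, rfl⟩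

theorem spoke_right_subset_sector {n : ℕ} (hn : 0 < n) (k : ℕ) :
    spoke n (k + 1) ⊆ sector n k := by
  intro z hz
  obtain ⟨r, hr, rfl⟩ := mem_spoke.1 hz
  exact (mem_sector hn).2 ⟨r, hr, (k + 1 : ℕ), ⟨by push_cast; linarith, by push_cast; rfl⟩, rfl⟩

theorem exists_mem_sector {n : ℕ} (hn : 0 < n) {z : ℂ} (hz : z ∈ Metric.closedBall (0 : ℂ) 1) :
    ∃ k : Fin n, z ∈ sector n k := by
  rw [mem_closedBall_zero_iff] at hz
  obtain ⟨t, ⟨h1, h2⟩, ht⟩ := exists_polar hn z 0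
  rw [zero_add] at h2
  refine ⟨⟨⌊t⌋₊, (Nat.floor_lt h1).2 h2⟩, (mem_sector hn).2 ⟨‖z‖, ⟨norm_nonneg _, hz⟩, t, ⟨?_, ?_⟩, ht⟩⟩
  · exact Nat.floor_le h1
  · exact (Nat.lt_floor_add_one t).le

theorem innerSector_disjoint_spoke {n : ℕ} (hn : 0 < n) {j k : ℕ} {z : ℂ}
    (h : z ∈ innerSector n k) : z ∉ spoke n j := by
  intro h'
  obtain ⟨r, hr, t, ⟨h1, h2⟩, rfl⟩ := (mem_innerSector hn).1 h
  obtain ⟨r', hr', he⟩ := mem_spoke.1 h'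
  obtain ⟨-, m, rfl⟩ := polar_eq hn hr.1 hr'.1 he
  have h3 : (k : ℤ) < j + n * m := by exact_mod_cast h1
  have h4 : (j + n * m : ℤ) < k + 1 := by exact_mod_cast h2
  omega

theorem innerSector_inter_sector {n : ℕ} (hn : 0 < n) {j k : Fin n} {z : ℂ}
    (h : z ∈ innerSector n j) (h' : z ∈ sector n k) : j = k := by
  obtain ⟨r, hr, t, ⟨h1, h2⟩, rfl⟩ := (mem_innerSector hn).1 h
  obtain ⟨r', hr', t', ⟨h3, h4⟩, he⟩ := (mem_sector hn).1 h'
  obtain ⟨-, m, rfl⟩ := polar_eq hn hr.1 hr'.1 he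
  have h5 : ((j : ℕ) : ℤ) < k + 1 + n * m := by
    have : ((j : ℕ) : ℝ) < k + 1 + n * m := by linarith
    exact_mod_cast this
  have h6 : ((k : ℕ) + n * m : ℤ) < j + 1 := by
    have : ((k : ℕ) + n * m : ℝ) < j + 1 := by linarith
    exact_mod_cast this
  have hj := j.2
  have hk := k.2
  have hm : m = 0 := by
    have h7 : (n : ℤ) * m < n * 1 := by omega
    have h8 : (n : ℤ) * (-1) < n * m := by omega
    have hn' : (0 : ℤ) < n := by exact_mod_cast hn
    have := lt_of_mul_lt_mul_left h7 hn'.le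
    have := lt_of_mul_lt_mul_left h8 hn'.le
    omega
  subst hm
  ext
  omega

theorem tip_notMem_innerSector {n : ℕ} (hn : 0 < n) {j k : ℕ} : tip n j ∉ innerSector n k :=
  fun h => innerSector_disjoint_spoke hn h (tip_mem_spoke n j)

theorem innerSector_mem_openArc {n : ℕ} (hn : 0 < n) {k : ℕ} {z : ℂ} (h : z ∈ innerSector n k)
    (h1 : ‖z‖ = 1) : z ∈ openArc n k := by
  obtain ⟨r, hr, t, ht, rfl⟩ := (mem_innerSector hn).1 h
  rw [norm_polar, abs_of_pos hr.1] at h1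
  exact (mem_openArc hn).2 ⟨t, ht, by rw [h1]⟩

theorem polar_congr_mod {n : ℕ} (hn : 0 < n) {j k : ℕ} (h : j ≡ k [MOD n]) (r : ℝ) :
    polar n r j = polar n r k := by
  obtain ⟨m, hm⟩ := (Nat.modEq_iff_dvd.1 h)
  rw [← polar_add_int n hn r j m]
  congr 1
  have : (k : ℤ) = j + n * m := by linarith
  exact_mod_cast this.symm

theorem tip_congr_mod {n : ℕ} (hn : 0 < n) {j k : ℕ} (h : j ≡ k [MOD n]) : tip n j = tip n k := by
  rw [tip_eq_polar, tip_eq_polar, polar_congr_mod hn h]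

theorem spoke_congr_mod {n : ℕ} (hn : 0 < n) {j k : ℕ} (h : j ≡ k [MOD n]) :
    spoke n j = spoke n k := by
  ext z
  simp only [mem_spoke, polar_congr_mod hn h]

theorem modEq_of_mem_spoke {n : ℕ} (hn : 0 < n) {j k : ℕ} {r : ℝ} (hr : 0 < r)
    (h : polar n r k ∈ spoke n j) : k ≡ j [MOD n] := by
  obtain ⟨r', hr', he⟩ := mem_spoke.1 h
  obtain ⟨-, m, hm⟩ := polar_eq hn hr hr'.1 he
  have hm' : (k : ℤ) = j + n * m := by exact_mod_cast hm
  exact (Nat.modEq_iff_dvd.2 ⟨m, by linarith⟩ : j ≡ k [MOD n]).symm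

/-- An inner sector is relatively open in the closed disc. -/
theorem isClosed_diff_innerSector {n : ℕ} (hn : 0 < n) (k : Fin n) :
    IsCompact (Metric.closedBall (0 : ℂ) 1 \ innerSector n k) := by
  have : Metric.closedBall (0 : ℂ) 1 \ innerSector n k =
      (⋃ j : Fin n, ⋃ _ : j ≠ k, sector n j) ∪ (spoke n k ∪ spoke n (k + 1)) := by
    ext z
    constructor
    · rintro ⟨h1, h2⟩
      obtain ⟨j, hj⟩ := exists_mem_sector hn h1
      by_cases hjk : j = k
      · subst hjk
        exact Or.inr ((mem_innerSector_or_spoke hn hj).resolve_left h2)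
      · exact Or.inl (mem_iUnion₂.2 ⟨j, hjk, hj⟩)
    · rintro (h | h)
      · obtain ⟨j, hj, h⟩ := mem_iUnion₂.1 h
        exact ⟨sector_subset _ _ h, fun h' => hj (innerSector_inter_sector hn h' h).symm⟩
      · refine ⟨?_, fun h' => ?_⟩
        · exact union_subset (spoke_subset _ _) (spoke_subset _ _) h
        · rcases h with h | h
          · exact innerSector_disjoint_spoke hn h' h
          · exact innerSector_disjoint_spoke hn h' h
  rw [this]
  refine IsCompact.union ?_ ((isCompact_spoke _ _).union (isCompact_spoke _ _))
  exact isCompact_iUnion fun j => isCompact_iUnion fun _ => isCompact_sector _ _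

/-! ### The power map on sectors -/

/-- Modulo n one has (n - 1)m ≡ n - m. With this normalisation a parameter t in [m, m + 1] has image
angle in [n - m, 2n - 1 - m], an interval of n - 1 sectors. What is missing from a full turn is the
sector n - 1 - m. -/
theorem polar_pow_pred {n : ℕ} (hn : 0 < n) {m : ℕ} (r t : ℝ) :
    polar n r t ^ (n - 1) = polar n (r ^ (n - 1)) ((n - 1) * (t - m) + (n - m)) := by
  rw [polar_pow, Nat.cast_pred hn, ← polar_add_int n hn _ ((n - 1) * t) (1 - m)]
  congr 1
  push_cast
  ring

theorem spoke_congr_int {n : ℕ} (hn : 0 < n) {j : ℕ} {r t : ℝ} (hr : r ∈ Icc (0 : ℝ) 1) {m : ℤ}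
    (h : t = j + n * m) : polar n r t ∈ spoke n j :=
  mem_spoke.2 ⟨r, hr, by rw [h, polar_add_int n hn]⟩

theorem pow_mem_Icc {r : ℝ} (hr : r ∈ Icc (0 : ℝ) 1) (j : ℕ) : r ^ j ∈ Icc (0 : ℝ) 1 :=
  ⟨pow_nonneg hr.1 j, pow_le_one₀ hr.1 hr.2⟩

/-- On the sector `m`, the power map avoids the inner sector `n - 1 - m`. -/
theorem pow_notMem_innerSector {n : ℕ} (hn : 2 ≤ n) {m : ℕ} (hm : m < n) {z : ℂ}
    (hz : z ∈ sector n m) : z ^ (n - 1) ∉ innerSector n (n - 1 - m) := by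
  have hn0 : 0 < n := by omega
  obtain ⟨r, hr, t, ⟨h1, h2⟩, rfl⟩ := (mem_sector hn0).1 hz
  rw [polar_pow_pred hn0 (m := m)]
  intro h
  obtain ⟨r', hr', s, ⟨h3, h4⟩, he⟩ := (mem_innerSector hn0).1 h
  obtain ⟨-, j, hj⟩ := polar_eq hn0 hr'.1 (pow_mem_Icc hr (n - 1)).1 he.symm
  have hc : ((n - 1 - m : ℕ) : ℝ) = n - 1 - m := by
    rw [Nat.sub_sub, Nat.cast_sub (by omega)]; push_cast; ring
  rw [hc] at h3 h4
  have hn1 : (2 : ℝ) ≤ n := by exact_mod_cast hn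
  -- The image angle and an angle in the omitted open sector would differ by a multiple of n
  -- strictly between -n and 0.
  have h5 : (0 : ℝ) < -(n * j) := by nlinarith
  have h6 : -(n * j : ℝ) < n := by nlinarith
  have h7 : (j : ℝ) < 0 := by
    by_contra hcon
    push Not at hcon
    nlinarith
  have h8 : (-1 : ℝ) < j := by
    by_contra hcon
    push Not at hcon
    nlinarith
  have h9 : j < 0 := by exact_mod_cast h7
  have h10 : -1 < j := by exact_mod_cast h8
  omega

theorem exists_pow_eq {n : ℕ} (hn : 2 ≤ n) {m : ℕ} (hm : m < n) {w : ℂ}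
    (hw : w ∈ Metric.closedBall (0 : ℂ) 1) (hw' : w ∉ innerSector n (n - 1 - m)) :
    ∃ z ∈ sector n m, z ^ (n - 1) = w := by
  have hn0 : 0 < n := by omega
  have hn1 : (2 : ℝ) ≤ n := by exact_mod_cast hn
  rw [mem_closedBall_zero_iff] at hw
  -- The window starts where the image of the sector m starts; its last unit interval is the omitted
  -- sector, which `h3` excludes.
  obtain ⟨t, ⟨h1, h2⟩, ht⟩ := exists_polar hn0 w (n - m)
  have hr : ∃ r ∈ Icc (0 : ℝ) 1, r ^ (n - 1) = ‖w‖ := by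
    refine ⟨‖w‖ ^ (((n - 1 : ℕ) : ℝ)⁻¹), ⟨by positivity, ?_⟩, ?_⟩
    · exact Real.rpow_le_one (norm_nonneg _) hw (by positivity)
    · exact Real.rpow_inv_natCast_pow (norm_nonneg _) (by omega)
  obtain ⟨r, hr, hrw⟩ := hr
  have hc : ((n - 1 - m : ℕ) : ℝ) = n - 1 - m := by
    rw [Nat.sub_sub, Nat.cast_sub (by omega)]; push_cast; ring
  by_cases h0 : w = 0
  · refine ⟨0, spoke_left_subset_sector hn0 _ (zero_mem_spoke _ _), ?_⟩
    rw [h0, zero_pow (by omega)]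
  have h3 : t ≤ 2 * n - 1 - m := by
    by_contra hcon
    push Not at hcon
    apply hw'
    refine (mem_innerSector hn0).2 ⟨‖w‖, ⟨norm_pos_iff.2 h0, hw⟩, t - n, ⟨?_, ?_⟩, ?_⟩
    · rw [hc]; linarith
    · rw [hc]; linarith
    · conv_lhs => rw [ht]
      rw [← polar_add_int n hn0 _ (t - n) 1]
      congr 1
      push_cast
      ring
  refine ⟨polar n r ((t - (n - m)) / (n - 1) + m), (mem_sector hn0).2 ⟨r, hr, _, ⟨?_, ?_⟩, rfl⟩, ?_⟩
  · have : 0 ≤ (t - (n - m)) / (n - 1) := div_nonneg (by linarith) (by linarith)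
    linarith
  · have : (t - (n - m)) / (n - 1) ≤ 1 := by
      rw [div_le_one (by linarith)]; linarith
    linarith
  · rw [polar_pow_pred hn0 (m := m), hrw]
    conv_rhs => rw [ht]
    congr 1
    have : (n - 1 : ℝ) ≠ 0 := by linarith
    field_simp
    ring

/-- The image of a sector spans n - 1 < n sectors, so it does not close up, and angles of equal
image cannot differ by a nonzero multiple of n. -/
theorem pow_injOn_sector {n : ℕ} (hn : 2 ≤ n) {m : ℕ} :
    InjOn (fun z : ℂ => z ^ (n - 1)) (sector n m) := by
  have hn0 : 0 < n := by omega
  have hn1 : (2 : ℝ) ≤ n := by exact_mod_cast hn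
  intro z hz z' hz' h
  obtain ⟨r, hr, t, ⟨h1, h2⟩, rfl⟩ := (mem_sector hn0).1 hz
  obtain ⟨r', hr', t', ⟨h3, h4⟩, rfl⟩ := (mem_sector hn0).1 hz'
  simp only [polar_pow_pred hn0 (m := m)] at h
  rcases hr.1.eq_or_lt with h0 | h0
  · have := congrArg norm h
    rw [norm_polar, norm_polar, ← h0, zero_pow (by omega), abs_zero, eq_comm, abs_eq_zero,
      pow_eq_zero_iff (by omega)] at this
    rw [← h0, this, polar_zero, polar_zero]
  obtain ⟨hrr, j, hj⟩ := polar_eq hn0 (pow_pos h0 _) (pow_nonneg hr'.1 _) h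
  have hrr' : r = r' := (pow_left_inj₀ hr.1 hr'.1 (by omega)).1 hrr
  have h5 : (n - 1) * (t - t') = n * j := by linarith
  have h6 : (j : ℝ) < 1 := by
    by_contra hcon
    push Not at hcon
    nlinarith
  have h7 : (-1 : ℝ) < j := by
    by_contra hcon
    push Not at hcon
    nlinarith
  have h8 : j < 1 := by exact_mod_cast h6
  have h9 : -1 < j := by exact_mod_cast h7
  have h10 : j = 0 := by omega
  rw [h10, Int.cast_zero, mul_zero] at h5
  have h11 : t - t' = 0 := (mul_eq_zero.1 h5).resolve_left (by linarith)
  rw [hrr', sub_eq_zero.1 h11]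

/-- A point of the sector `m` which is mapped by the power map to the boundary of the omitted
sector lies on the boundary spokes of the sector `m`. -/
theorem exists_nat_of_pow_mem_spoke {n : ℕ} (hn : 2 ≤ n) {m : ℕ} (hm : m < n) {z : ℂ}
    (hz : z ∈ sector n m)
    (h : z ^ (n - 1) ∈ spoke n (n - 1 - m) ∪ spoke n (n - 1 - m + 1)) :
    ∃ j : ℕ, ∃ r ∈ Icc (0 : ℝ) 1, z = polar n r j := by
  have hn0 : 0 < n := by omega
  have hn1 : (2 : ℝ) ≤ n := by exact_mod_cast hn
  obtain ⟨r, hr, t, ⟨h1, h2⟩, rfl⟩ := (mem_sector hn0).1 hz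
  rcases hr.1.eq_or_lt with h0 | h0
  · exact ⟨0, r, hr, by rw [← h0, polar_zero, polar_zero]⟩
  have hc : ((n - 1 - m : ℕ) : ℝ) = n - 1 - m := by
    rw [Nat.sub_sub, Nat.cast_sub (by omega)]; push_cast; ring
  rw [polar_pow_pred hn0 (m := m)] at h
  -- The left side lies in [0, n - 1]. This forces j = 0 in the first case and j = 1 in the second,
  -- that is, t = m or t = m + 1.
  have key : ∃ j : ℤ, (n - 1) * (t - m) = n * j ∨ (n - 1) * (t - m) = n * j - 1 := by
    rcases h with h | h
    · obtain ⟨r', hr', he⟩ := mem_spoke.1 h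
      obtain ⟨-, j, hj⟩ := polar_eq hn0 (pow_pos h0 _) hr'.1 he
      rw [hc] at hj
      exact ⟨j, Or.inr (by linarith)⟩
    · obtain ⟨r', hr', he⟩ := mem_spoke.1 h
      obtain ⟨-, j, hj⟩ := polar_eq hn0 (pow_pos h0 _) hr'.1 he
      push_cast [hc] at hj
      exact ⟨j, Or.inl (by linarith)⟩
  obtain ⟨j, hj⟩ := key
  have hlo : 0 ≤ (n - 1) * (t - m) := mul_nonneg (by linarith) (by linarith)
  have hhi : (n - 1) * (t - m) ≤ n - 1 := by nlinarith
  rcases hj with hj | hj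
  · have h6 : (j : ℝ) < 1 := by
      by_contra hcon
      push Not at hcon
      nlinarith
    have h7 : (-1 : ℝ) < j := by
      by_contra hcon
      push Not at hcon
      nlinarith
    have h8 : j < 1 := by exact_mod_cast h6
    have h9 : -1 < j := by exact_mod_cast h7
    have h10 : j = 0 := by omega
    rw [h10, Int.cast_zero, mul_zero] at hj
    have h11 : t - m = 0 := (mul_eq_zero.1 hj).resolve_left (by linarith)
    exact ⟨m, r, hr, by rw [sub_eq_zero.1 h11]⟩
  · have h6 : (j : ℝ) < 2 := by
      by_contra hcon
      push Not at hcon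
      nlinarith
    have h7 : (0 : ℝ) < j := by
      by_contra hcon
      push Not at hcon
      nlinarith
    have h8 : j < 2 := by exact_mod_cast h6
    have h9 : 0 < j := by exact_mod_cast h7
    have h10 : j = 1 := by omega
    rw [h10, Int.cast_one, mul_one] at hj
    have h11 : (n - 1) * (t - m - 1) = 0 := by linarith
    have h12 : t - m - 1 = 0 := (mul_eq_zero.1 h11).resolve_left (by linarith)
    exact ⟨m + 1, r, hr, by push_cast; rw [show t = m + 1 by linarith]⟩

/-- On spokes the power map acts as j ↦ (n - 1)j ≡ -j modulo n, which is injective. Hence pieces of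
the ramified disc that share a spoke downstairs share it upstairs. -/
theorem eq_of_pow_eq_on_spokes {n : ℕ} (hn : 2 ≤ n) {j j' : ℕ} {r r' : ℝ} (hr : r ∈ Icc (0 : ℝ) 1)
    (hr' : r' ∈ Icc (0 : ℝ) 1) (h : polar n r j ^ (n - 1) = polar n r' j' ^ (n - 1)) :
    polar n r j = polar n r' j' := by
  have hn0 : 0 < n := by omega
  rcases hr.1.eq_or_lt with h0 | h0
  · have := congrArg norm h
    rw [norm_pow, norm_pow, norm_polar, norm_polar, ← h0, abs_zero, zero_pow (by omega), eq_comm,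
      pow_eq_zero_iff (by omega), abs_eq_zero] at this
    rw [← h0, this, polar_zero, polar_zero]
  rw [polar_pow, polar_pow] at h
  obtain ⟨hrr, m, hm⟩ := polar_eq hn0 (pow_pos h0 _) (pow_nonneg hr'.1 _) h
  have hrr' : r = r' := (pow_left_inj₀ hr.1 hr'.1 (by omega)).1 hrr
  rw [Nat.cast_pred hn0] at hm
  rw [hrr', ← polar_add_int n hn0 r' j (m - j + j')]
  rw [show (j : ℝ) + n * ((m - j + j' : ℤ) : ℝ) = j' + n * 0 by push_cast; linarith]
  rw [mul_zero, add_zero]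

/-- The order is reversed: the spoke m goes to the spoke n - m and the spoke m + 1 to the spoke n -
1 - m. -/
theorem pow_mem_spoke {n : ℕ} (hn : 2 ≤ n) {m : ℕ} (hm : m < n) {z : ℂ}
    (hz : z ∈ spoke n m ∪ spoke n (m + 1)) :
    z ^ (n - 1) ∈ spoke n (n - 1 - m) ∪ spoke n (n - 1 - m + 1) := by
  have hn0 : 0 < n := by omega
  have hc : ((n - 1 - m : ℕ) : ℝ) = n - 1 - m := by
    rw [Nat.sub_sub, Nat.cast_sub (by omega)]; push_cast; ring
  rcases hz with hz | hz
  · obtain ⟨r, hr, rfl⟩ := mem_spoke.1 hz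
    right
    rw [polar_pow_pred hn0 (m := m)]
    exact spoke_congr_int hn0 (pow_mem_Icc hr _) (m := 0) (by push_cast [hc]; ring)
  · obtain ⟨r, hr, rfl⟩ := mem_spoke.1 hz
    left
    rw [polar_pow_pred hn0 (m := m)]
    exact spoke_congr_int hn0 (pow_mem_Icc hr _) (m := 1) (by push_cast [hc]; ring)

end SpectralWeb
end

noncomputable section
namespace SpectralWeb
variable {V X S : Type*}
namespace WebData

/-! ### Zig-zag domains of a web -/

/-- The coloured domains form a locally finite system of discs which touch each other at
corners. -/
structure Regular [TopologicalSpace X] (D : WebData V X) : Prop where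
  two_le_val : ∀ v, 2 ≤ D.val v
  continuousOn : ∀ v, ContinuousOn (D.disk v) (Metric.closedBall 0 1)
  injOn : ∀ v, InjOn (D.disk v) (Metric.closedBall 0 1)
  isOpen_domainAt : ∀ v, IsOpen (D.domainAt v)
  locallyFinite : LocallyFinite D.closedDomainAt
  meet : ∀ v w, v ≠ w → ∀ z ∈ Metric.closedBall (0 : ℂ) 1, ∀ z' ∈ Metric.closedBall (0 : ℂ) 1,
    D.disk v z = D.disk w z' →
      ¬(D.black v ↔ D.black w) ∧ (∃ k : Fin (D.val v), z = tip (D.val v) k) ∧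
        ∃ l : Fin (D.val w), z' = tip (D.val w) l

theorem corner_pos (D : WebData V X) (c : D.Corner) : 0 < D.val c.1 :=
  Fin.pos_iff_nonempty.2 ⟨c.2⟩

theorem ne_tip_of_mem_ball {n : ℕ} {z : ℂ} (hz : z ∈ Metric.ball (0 : ℂ) 1) (k : ℕ) :
    z ≠ tip n k := by
  rintro rfl
  rw [mem_ball_zero_iff, norm_tip] at hz
  exact lt_irrefl _ hz

theorem ne_tip_of_mem_innerSector {n j : ℕ} {z : ℂ} (hn : 0 < n) (hz : z ∈ innerSector n j)
    (k : ℕ) : z ≠ tip n k := by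
  rintro rfl
  exact tip_notMem_innerSector hn hz

variable [TopologicalSpace X] {D : WebData V X}

namespace Regular

theorem val_pos (hD : D.Regular) (v : V) : 0 < D.val v :=
  lt_of_lt_of_le two_pos (hD.two_le_val v)

theorem eq_of_disk_eq (hD : D.Regular) {u v : V} {z z' : ℂ} (hz : z ∈ Metric.closedBall (0 : ℂ) 1)
    (hz' : z' ∈ Metric.closedBall (0 : ℂ) 1) (ht : ∀ k : ℕ, z ≠ tip (D.val v) k)
    (h : D.disk v z = D.disk u z') : u = v ∧ z' = z := by
  by_cases huv : u = v
  · subst huv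
    exact ⟨rfl, (hD.injOn u hz hz' h).symm⟩
  · obtain ⟨-, ⟨k, hk⟩, -⟩ := hD.meet v u (Ne.symm huv) z hz z' hz' h
    exact absurd hk (ht k)

theorem locallyFinite_corner (hD : D.Regular) :
    LocallyFinite fun c : D.Corner => D.closedDomainAt c.1 := by
  intro x
  obtain ⟨t, ht, hf⟩ := hD.locallyFinite x
  refine ⟨t, ht, (hf.preimage' (f := fun c : D.Corner => c.1) fun v _ => ?_)⟩
  refine (finite_range fun k : Fin (D.val v) => (⟨v, k⟩ : D.Corner)).subset ?_
  rintro ⟨w, k⟩ h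
  obtain rfl : w = v := h
  exact ⟨k, rfl⟩

theorem locallyFinite_image (hD : D.Regular) (K : D.Corner → Set ℂ)
    (h : ∀ c, K c ⊆ Metric.closedBall 0 1) : LocallyFinite fun c : D.Corner => D.disk c.1 '' K c :=
  hD.locallyFinite_corner.subset fun c => image_mono (h c)

variable [T2Space X]

theorem isClosed_image (hD : D.Regular) {v : V} {K : Set ℂ} (h : K ⊆ Metric.closedBall 0 1)
    (hK : IsCompact K) : IsClosed (D.disk v '' K) :=
  (hK.image_of_continuousOn ((hD.continuousOn v).mono h)).isClosed

theorem isClosed_corners (hD : D.Regular) (p : D.Corner → Prop) (K : D.Corner → Set ℂ)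
    (h : ∀ c, K c ⊆ Metric.closedBall 0 1) (hK : ∀ c, IsCompact (K c)) :
    IsClosed {x | ∃ c, p c ∧ x ∈ D.disk c.1 '' K c} := by
  have : {x | ∃ c, p c ∧ x ∈ D.disk c.1 '' K c} = ⋃ c : {c // p c}, D.disk c.1.1 '' K c.1 := by
    ext x; simp
  rw [this]
  exact ((hD.locallyFinite_image K h).comp_injective Subtype.val_injective).isClosed_iUnion
    fun c => hD.isClosed_image (h _) (hK _)

theorem isClosed_zigzag (hD : D.Regular) (γ : D.Strand) : IsClosed (D.zigzag γ) :=
  hD.isClosed_corners _ _ (fun _ => union_subset (spoke_subset _ _) (spoke_subset _ _))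
    fun _ => (isCompact_spoke _ _).union (isCompact_spoke _ _)

theorem graph_eq (hD : D.Regular) :
    D.graph = {x | ∃ c : D.Corner, True ∧ x ∈ D.disk c.1 '' spoke (D.val c.1) c.2} := by
  ext x
  constructor
  · rintro ⟨v, rfl | ⟨k, hk⟩⟩
    · exact ⟨⟨v, ⟨0, hD.val_pos v⟩⟩, trivial, 0, zero_mem_spoke _ _, rfl⟩
    · exact ⟨⟨v, k⟩, trivial, hk⟩
  · rintro ⟨c, -, h⟩
    exact ⟨c.1, Or.inr ⟨c.2, h⟩⟩

theorem isClosed_graph (hD : D.Regular) : IsClosed D.graph := by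
  rw [hD.graph_eq]
  exact hD.isClosed_corners _ _ (fun _ => spoke_subset _ _) fun _ => isCompact_spoke _ _

theorem spoke_subset_graph (hD : D.Regular) (v : V) (k : ℕ) :
    D.disk v '' spoke (D.val v) k ⊆ D.graph := by
  have hk : k % D.val v < D.val v := Nat.mod_lt _ (hD.val_pos v)
  rw [← spoke_congr_mod (hD.val_pos v) (Nat.mod_modEq k _)]
  exact fun x hx => ⟨v, Or.inr ⟨⟨_, hk⟩, hx⟩⟩

theorem zigzag_subset_graph (hD : D.Regular) (γ : D.Strand) : D.zigzag γ ⊆ D.graph := by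
  rintro x ⟨c, -, z, hz | hz, rfl⟩
  · exact hD.spoke_subset_graph _ _ ⟨z, hz, rfl⟩
  · exact hD.spoke_subset_graph _ _ ⟨z, hz, rfl⟩

/-- This makes the graph summand of `Pieces` redundant: every point of the glued surface comes from
some piece `D.face γ`. -/
theorem exists_mem_zigzag (hD : D.Regular) {x : X} (hx : x ∈ D.graph) : ∃ γ, x ∈ D.zigzag γ := by
  rw [hD.graph_eq] at hx
  obtain ⟨c, -, z, hz, rfl⟩ := hx
  exact ⟨_, c, rfl, z, Or.inl hz, rfl⟩

theorem locallyFinite_zigzag (hD : D.Regular) : LocallyFinite D.zigzag := by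
  intro x
  obtain ⟨t, ht, hf⟩ := hD.locallyFinite_corner x
  refine ⟨t, ht, (hf.image D.strandOf).subset ?_⟩
  rintro γ ⟨y, ⟨c, hc, z, hz, rfl⟩, hy⟩
  refine ⟨c, ⟨_, ⟨z, ?_, rfl⟩, hy⟩, hc⟩
  exact union_subset (spoke_subset _ _) (spoke_subset _ _) hz

/-- Closed domains meet only at corners, so a point that is not a corner has positive room to all
other closed domains, by local finiteness. -/
theorem eventually_notMem_closedDomainAt (hD : D.Regular) {v : V} {z : ℂ}
    (hz : z ∈ Metric.closedBall (0 : ℂ) 1) (ht : ∀ k : ℕ, z ≠ tip (D.val v) k) :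
    ∀ᶠ x in 𝓝 (D.disk v z), ∀ u, u ≠ v → x ∉ D.closedDomainAt u := by
  have := hD.locallyFinite.iInter_compl_mem_nhds (fun u => hD.isClosed_image subset_rfl
    (isCompact_closedBall 0 1)) (D.disk v z)
  filter_upwards [this] with x hx u hu
  refine mem_iInter₂.1 hx u ?_
  rintro ⟨z', hz', h⟩
  exact hu (hD.eq_of_disk_eq hz hz' ht h.symm).1

/-- Near a point of an inner sector, the closed domain agrees with the inner sector. -/
theorem eventually_mem_innerSector (hD : D.Regular) {v : V} {k : Fin (D.val v)} {z : ℂ}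
    (hz : z ∈ innerSector (D.val v) k) :
    ∀ᶠ x in 𝓝 (D.disk v z), x ∈ D.closedDomainAt v → x ∈ D.disk v '' innerSector (D.val v) k := by
  have hc := hD.isClosed_image (v := v) sdiff_subset
    (isClosed_diff_innerSector (hD.val_pos v) k)
  have : D.disk v z ∉ D.disk v '' (Metric.closedBall (0 : ℂ) 1 \ innerSector (D.val v) k) := by
    rintro ⟨z', hz', h⟩
    exact hz'.2 ((hD.injOn v hz'.1 (innerSector_subset _ _ hz) h) ▸ hz)
  filter_upwards [hc.isOpen_compl.mem_nhds this] with x hx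
  rintro ⟨z', hz', rfl⟩
  exact ⟨z', by_contra fun h => hx ⟨z', ⟨hz', h⟩, rfl⟩, rfl⟩

theorem disk_mem_nhds (hD : D.Regular) {v : V} {z : ℂ} (hz : z ∈ Metric.ball (0 : ℂ) 1) :
    D.domainAt v ∈ 𝓝 (D.disk v z) :=
  (hD.isOpen_domainAt v).mem_nhds ⟨z, hz, rfl⟩

theorem domainAt_subset (v : V) : D.domainAt v ⊆ D.closedDomainAt v :=
  image_mono Metric.ball_subset_closedBall

theorem domainAt_disjoint_strandSet (hD : D.Regular) (v : V) (γ : D.Strand) :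
    D.domainAt v ⊆ (D.strandSet γ)ᶜ := by
  rintro _ ⟨z, hz, rfl⟩ ⟨c, -, z', hz', h⟩
  obtain ⟨-, rfl⟩ := hD.eq_of_disk_eq (Metric.ball_subset_closedBall hz) (arc_subset _ _ hz')
    (ne_tip_of_mem_ball hz) h.symm
  have := arc_subset_sphere _ _ hz'
  rw [mem_sphere_zero_iff_norm] at this
  rw [mem_ball_zero_iff, this] at hz
  exact lt_irrefl _ hz

theorem isPreconnected_domainAt (hD : D.Regular) (v : V) : IsPreconnected (D.domainAt v) :=
  (convex_ball 0 1).isPreconnected.image _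
    ((hD.continuousOn v).mono Metric.ball_subset_closedBall)

theorem mem_closure_domainAt (hD : D.Regular) {v : V} {z : ℂ} (hz : z ∈ Metric.closedBall (0 : ℂ) 1) :
    D.disk v z ∈ closure (D.domainAt v) := by
  refine ((hD.continuousOn v z hz).mono Metric.ball_subset_closedBall).mem_closure_image ?_
  rwa [closure_ball _ one_ne_zero]

/-! ### The two sides of a strand, and the domain bounded by its zig-zag path -/

section Cuts

variable {γ : D.Strand} {A B : Set X}

/-- The open domain is connected and misses the strand, so it lies on one side. Near the side of the
domain along `γ` it agrees with `A`, which decides which one. -/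
theorem domainAt_subset_right (hD : D.Regular) (h : D.Cuts γ A B) {c : D.Corner}
    (hc : D.strandOf c = γ) (hb : D.black c.1) : D.domainAt c.1 ⊆ A := by
  refine (hD.isPreconnected_domainAt c.1).subset_left_of_subset_union h.isOpen_right h.isOpen_left
    h.disjoint ?_ ?_
  · rw [h.union]; exact hD.domainAt_disjoint_strandSet _ _
  · obtain ⟨z, hz⟩ := openArc_nonempty (D.corner_pos c) c.2
    have h1 := mem_closure_iff_frequently.1
      (hD.mem_closure_domainAt (v := c.1) (openArc_subset _ _ hz))
    obtain ⟨x, hx, hx'⟩ := (h1.and_eventually (h.right c hc hb _ ⟨z, hz, rfl⟩)).exists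
    exact ⟨x, hx, hx'.2 hx⟩

theorem domainAt_subset_left (hD : D.Regular) (h : D.Cuts γ A B) {c : D.Corner}
    (hc : D.strandOf c = γ) (hb : ¬D.black c.1) : D.domainAt c.1 ⊆ B := by
  refine (hD.isPreconnected_domainAt c.1).subset_left_of_subset_union h.isOpen_left h.isOpen_right
    h.disjoint.symm ?_ ?_
  · rw [union_comm, h.union]; exact hD.domainAt_disjoint_strandSet _ _
  · obtain ⟨z, hz⟩ := openArc_nonempty (D.corner_pos c) c.2
    have h1 := mem_closure_iff_frequently.1
      (hD.mem_closure_domainAt (v := c.1) (openArc_subset _ _ hz))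
    obtain ⟨x, hx, hx'⟩ := (h1.and_eventually (h.left c hc hb _ ⟨z, hz, rfl⟩)).exists
    exact ⟨x, hx, hx'.2 hx⟩

/-- A strand has at least one corner. The coloured domain there lies on a prescribed side in both
decompositions, and connectedness of that side then forces the decompositions to agree. For a
`◦`-corner the left sides are compared and complements are taken. -/
theorem cuts_unique (hD : D.Regular) (h : D.Cuts γ A B) {A' B' : Set X} (h' : D.Cuts γ A' B') :
    A' ⊆ A := by
  obtain ⟨c, hc⟩ : ∃ c, D.strandOf c = γ := Quot.exists_rep γ
  have hne : (D.domainAt c.1).Nonempty := ⟨_, 0, Metric.mem_ball_self one_pos, rfl⟩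
  by_cases hb : D.black c.1
  · refine h'.isConnected_right.isPreconnected.subset_left_of_subset_union h.isOpen_right
      h.isOpen_left h.disjoint ?_ ?_
    · rw [h.union, ← h'.union]; exact subset_union_left
    · obtain ⟨x, hx⟩ := hne
      exact ⟨x, hD.domainAt_subset_right h' hc hb hx, hD.domainAt_subset_right h hc hb hx⟩
  · have hBB : B ⊆ B' := by
      refine h.isConnected_left.isPreconnected.subset_left_of_subset_union h'.isOpen_left
        h'.isOpen_right h'.disjoint.symm ?_ ?_
      · rw [union_comm, h'.union, ← h.union]; exact subset_union_right
      · obtain ⟨x, hx⟩ := hne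
        exact ⟨x, hD.domainAt_subset_left h hc hb hx, hD.domainAt_subset_left h' hc hb hx⟩
    intro x hx
    have : x ∈ A ∪ B := by rw [h.union, ← h'.union]; exact Or.inl hx
    exact this.resolve_right fun hxB => h'.disjoint.le_bot ⟨hx, hBB hxB⟩

theorem rightSide_eq (hD : D.Regular) (h : D.Cuts γ A B) : D.rightSide γ = A := by
  ext x
  constructor
  · rintro ⟨A', B', h', hx⟩
    exact hD.cuts_unique h h' hx
  · exact fun hx => ⟨A, B, h, hx⟩

/-- The closed sectors of the `•`-vertices along a strand. -/
def blackSectors (D : WebData V X) (γ : D.Strand) : Set X :=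
  {x | ∃ c : D.Corner, D.strandOf c = γ ∧ D.black c.1 ∧ x ∈ D.disk c.1 '' sector (D.val c.1) c.2}

/-- The inner sectors of the `◦`-vertices along a strand. -/
def whiteSectors (D : WebData V X) (γ : D.Strand) : Set X :=
  {x | ∃ c : D.Corner, D.strandOf c = γ ∧ ¬D.black c.1 ∧
    x ∈ D.disk c.1 '' innerSector (D.val c.1) c.2}

theorem zigzagDomain_eq (hD : D.Regular) (h : D.Cuts γ A B) :
    D.zigzagDomain γ = A \ blackSectors D γ ∪ whiteSectors D γ := by
  rw [← hD.rightSide_eq h]; rfl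

theorem isClosed_blackSectors (hD : D.Regular) (γ : D.Strand) : IsClosed (blackSectors D γ) := by
  have := hD.isClosed_corners (fun c => D.strandOf c = γ ∧ D.black c.1)
    (fun c => sector (D.val c.1) c.2) (fun _ => sector_subset _ _) fun _ => isCompact_sector _ _
  simp only [and_assoc] at this
  exact this

theorem notMem_right_of_strandSet (h : D.Cuts γ A B) {x : X} (hx : x ∈ D.strandSet γ) : x ∉ A :=
  fun hA => (h.union ▸ (Or.inl hA : x ∈ A ∪ B) : x ∈ (D.strandSet γ)ᶜ) hx

theorem tip_left_mem_strandSet {c : D.Corner} (hc : D.strandOf c = γ) :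
    D.disk c.1 (tip (D.val c.1) c.2) ∈ D.strandSet γ :=
  ⟨c, hc, _, tip_mem_arc_left (D.corner_pos c) _, rfl⟩

theorem tip_right_mem_strandSet {c : D.Corner} (hc : D.strandOf c = γ) :
    D.disk c.1 (tip (D.val c.1) (c.2 + 1)) ∈ D.strandSet γ :=
  ⟨c, hc, _, tip_mem_arc_right (D.corner_pos c) _, rfl⟩

/-- At a `•`-vertex the two spokes lie in the closed sector that was removed. At a `◦`-vertex they
lie in the left side, apart from their tips, which are on the strand. Inner sectors contain no
points of spokes. -/
theorem disjoint_zigzag (hD : D.Regular) (h : D.Cuts γ A B) {x : X} (hx : x ∈ D.zigzag γ) :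
    x ∉ D.zigzagDomain γ := by
  rw [hD.zigzagDomain_eq h]
  obtain ⟨c, hc, z, hz, rfl⟩ := hx
  have hp := D.corner_pos c
  have hzb : z ∈ Metric.closedBall (0 : ℂ) 1 :=
    union_subset (spoke_subset _ _) (spoke_subset _ _) hz
  rintro (⟨hA, hK⟩ | ⟨c', hc', hw, z', hz', he⟩)
  · by_cases hb : D.black c.1
    · refine hK ⟨c, hc, hb, z, ?_, rfl⟩
      exact union_subset (spoke_left_subset_sector hp _) (spoke_right_subset_sector hp _) hz
    · by_cases hz1 : ‖z‖ < 1
      · exact h.disjoint.le_bot ⟨hA, hD.domainAt_subset_left h hc hb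
          ⟨z, mem_ball_zero_iff.2 hz1, rfl⟩⟩
      · rw [mem_closedBall_zero_iff] at hzb
        have hz1 : ‖z‖ = 1 := le_antisymm hzb (not_lt.1 hz1)
        have key : ∀ j : ℕ, z ∈ spoke (D.val c.1) j → z = tip (D.val c.1) j := by
          rintro j ⟨r, hr, rfl⟩
          rw [norm_mul, norm_tip, mul_one, Complex.norm_real, Real.norm_eq_abs,
            abs_of_nonneg hr.1] at hz1
          rw [hz1, Complex.ofReal_one, one_mul]
        rcases hz with hz | hz
        · rw [key _ hz] at hA
          exact notMem_right_of_strandSet h (tip_left_mem_strandSet hc) hA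
        · rw [key _ hz] at hA
          exact notMem_right_of_strandSet h (tip_right_mem_strandSet hc) hA
  · have hp' := D.corner_pos c'
    obtain ⟨h1, h2⟩ := hD.eq_of_disk_eq (innerSector_subset _ _ hz') hzb
      (ne_tip_of_mem_innerSector hp' hz') he
    obtain ⟨j, hj⟩ : ∃ j : ℕ, z ∈ spoke (D.val c.1) j := by
      rcases hz with hz | hz
      exacts [⟨_, hz⟩, ⟨_, hz⟩]
    rw [h2, h1] at hj
    exact innerSector_disjoint_spoke hp' hz' hj

/-- Near a point of the side of a domain which belongs to the strand. -/
theorem eventually_openArc (hD : D.Regular) {c : D.Corner} {z : ℂ}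
    (hz : z ∈ openArc (D.val c.1) c.2) :
    ∀ᶠ x in 𝓝 (D.disk c.1 z), (∀ u, u ≠ c.1 → x ∉ D.closedDomainAt u) ∧
      (x ∈ D.closedDomainAt c.1 → x ∈ D.disk c.1 '' innerSector (D.val c.1) c.2) := by
  have hz' := openArc_subset_innerSector _ _ hz
  exact (hD.eventually_notMem_closedDomainAt (innerSector_subset _ _ hz')
    (ne_tip_of_mem_innerSector (D.corner_pos c) hz')).and (hD.eventually_mem_innerSector hz')

/-- The colour plays no role: this serves `isOpen_zigzagDomain` at `◦`-vertices and `isClosed_face`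
at `•`-vertices. -/
theorem mem_whiteSectors_nhds_of_mem_ball (hD : D.Regular) {c : D.Corner} {z : ℂ}
    (hz : z ∈ innerSector (D.val c.1) c.2) (hz1 : ‖z‖ < 1) :
    ∀ᶠ x in 𝓝 (D.disk c.1 z), x ∈ D.domainAt c.1 ∧
      x ∈ D.disk c.1 '' innerSector (D.val c.1) c.2 := by
  filter_upwards [hD.eventually_mem_innerSector hz, hD.disk_mem_nhds (mem_ball_zero_iff.2 hz1)]
    with x h1 h2
  exact ⟨h2, h1 (domainAt_subset _ h2)⟩

/-- The only delicate points are those on the strand itself, on the side of a `◦`-domain. There the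
added inner sector on the left meets the right side of the strand, and together they fill a
neighbourhood. -/
theorem isOpen_zigzagDomain (hD : D.Regular) (h : D.Cuts γ A B) : IsOpen (D.zigzagDomain γ) := by
  rw [hD.zigzagDomain_eq h, isOpen_iff_mem_nhds]
  rintro x (hx | ⟨c, hc, hw, z, hz, rfl⟩)
  · exact mem_of_superset ((h.isOpen_right.sdiff (hD.isClosed_blackSectors γ)).mem_nhds hx)
      subset_union_left
  · rcases lt_or_ge ‖z‖ 1 with hz1 | hz1
    · filter_upwards [hD.mem_whiteSectors_nhds_of_mem_ball hz hz1] with x hx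
      exact Or.inr ⟨c, hc, hw, hx.2⟩
    · have hzb := innerSector_subset _ _ hz
      rw [mem_closedBall_zero_iff] at hzb
      have hz2 := innerSector_mem_openArc (D.corner_pos c) hz (le_antisymm hzb hz1)
      filter_upwards [hD.eventually_openArc hz2, h.left c hc hw _ ⟨z, hz2, rfl⟩] with x hx hxB
      by_cases hxv : x ∈ D.closedDomainAt c.1
      · exact Or.inr ⟨c, hc, hw, hx.2 hxv⟩
      · left
        have h1 : ∀ u, x ∉ D.closedDomainAt u := by
          intro u
          by_cases hu : u = c.1
          · rwa [hu]
          · exact hx.1 u hu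
        refine ⟨?_, ?_⟩
        · have : x ∈ A ∪ B := by
            rw [h.union]
            rintro ⟨c', -, y, hy, rfl⟩
            exact h1 c'.1 ⟨y, arc_subset _ _ hy, rfl⟩
          refine this.resolve_right fun hB => hxv (domainAt_subset _ (hxB.1 hB))
        · rintro ⟨c', -, -, y, hy, rfl⟩
          exact h1 c'.1 ⟨y, sector_subset _ _ hy, rfl⟩

theorem isClosed_face (hD : D.Regular) (h : D.Cuts γ A B) : IsClosed (D.face γ) := by
  rw [← isOpen_compl_iff, isOpen_iff_mem_nhds]
  intro x hx
  have hxZ : x ∉ D.zigzag γ := fun h' => hx (Or.inr h')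
  have hxD : x ∉ A \ blackSectors D γ ∪ whiteSectors D γ := by
    rw [← hD.zigzagDomain_eq h]; exact fun h' => hx (Or.inl h')
  suffices ∀ᶠ y in 𝓝 x, y ∉ A \ blackSectors D γ ∪ whiteSectors D γ by
    filter_upwards [this, (hD.isClosed_zigzag γ).isOpen_compl.mem_nhds hxZ] with y h1 h2
    rintro (h3 | h3)
    · rw [hD.zigzagDomain_eq h] at h3
      exact h1 h3
    · exact h2 h3
  by_cases hxS : x ∈ D.strandSet γ
  · obtain ⟨c, hc, z, hz, rfl⟩ := hxS
    have hp := D.corner_pos c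
    rcases mem_openArc_or_tip hp hz with hz | rfl | rfl
    · have hz' := openArc_subset_innerSector _ _ hz
      by_cases hb : D.black c.1
      · filter_upwards [hD.eventually_openArc hz, h.right c hc hb _ ⟨z, hz, rfl⟩] with y hy hyA
        rintro (⟨h1, h2⟩ | ⟨c', hc', hw, y', hy', rfl⟩)
        · obtain ⟨z', hz', rfl⟩ := hy.2 (domainAt_subset _ (hyA.1 h1))
          exact h2 ⟨c, hc, hb, z', innerSector_subset_sector _ _ hz', rfl⟩
        · refine hy.1 c'.1 (fun h' => hw (h' ▸ hb)) ⟨y', innerSector_subset _ _ hy', rfl⟩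
      · exact absurd (Or.inr ⟨c, hc, hb, z, hz', rfl⟩) hxD
    · exact absurd ⟨c, hc, _, Or.inl (tip_mem_spoke _ _), rfl⟩ hxZ
    · exact absurd ⟨c, hc, _, Or.inr (tip_mem_spoke _ _), rfl⟩ hxZ
  · have hAB : x ∈ A ∪ B := by rw [h.union]; exact hxS
    rcases hAB with hA | hB
    · have hK : x ∈ blackSectors D γ := by_contra fun h' => hxD (Or.inl ⟨hA, h'⟩)
      obtain ⟨c, hc, hb, z, hz, rfl⟩ := hK
      have hp := D.corner_pos c
      rcases mem_innerSector_or_spoke hp hz with hz' | hz'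
      · have hz1 : ‖z‖ < 1 := by
          refine lt_of_le_of_ne (mem_closedBall_zero_iff.1 (sector_subset _ _ hz)) fun h1 => ?_
          exact hxS ⟨c, hc, z, openArc_subset_arc _ _ (innerSector_mem_openArc hp hz' h1), rfl⟩
        filter_upwards [hD.mem_whiteSectors_nhds_of_mem_ball hz' hz1] with y hy
        rintro (⟨-, h2⟩ | ⟨c', hc', hw, y', hy', rfl⟩)
        · obtain ⟨y', hy', rfl⟩ := hy.2
          exact h2 ⟨c, hc, hb, y', innerSector_subset_sector _ _ hy', rfl⟩
        · obtain ⟨z', hz', he⟩ := hy.1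
          refine hw ?_
          rw [(hD.eq_of_disk_eq (Metric.ball_subset_closedBall hz') (innerSector_subset _ _ hy')
            (ne_tip_of_mem_ball hz') he).1]
          exact hb
      · exact absurd ⟨c, hc, z, hz', rfl⟩ hxZ
    -- On the left of the strand the piece can only be met in `◦`-sectors. The point avoids the
    -- inner sectors and the spokes, hence the closed sectors, whose union is closed by local
    -- finiteness.
    · have hcl : IsClosed {x | ∃ c : D.Corner, (D.strandOf c = γ ∧ ¬D.black c.1) ∧
          x ∈ D.disk c.1 '' sector (D.val c.1) c.2} :=
        hD.isClosed_corners _ _ (fun _ => sector_subset _ _) fun _ => isCompact_sector _ _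
      have hxc : x ∉ {x | ∃ c : D.Corner, (D.strandOf c = γ ∧ ¬D.black c.1) ∧
          x ∈ D.disk c.1 '' sector (D.val c.1) c.2} := by
        rintro ⟨c, ⟨hc, hw⟩, z, hz, rfl⟩
        rcases mem_innerSector_or_spoke (D.corner_pos c) hz with hz' | hz'
        · exact hxD (Or.inr ⟨c, hc, hw, z, hz', rfl⟩)
        · exact hxZ ⟨c, hc, z, hz', rfl⟩
      filter_upwards [hcl.isOpen_compl.mem_nhds hxc, h.isOpen_left.mem_nhds hB] with y h1 h2
      rintro (⟨h3, -⟩ | ⟨c, hc, hw, z, hz, rfl⟩)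
      · exact h.disjoint.le_bot ⟨h3, h2⟩
      · exact h1 ⟨c, ⟨hc, hw⟩, z, innerSector_subset_sector _ _ hz, rfl⟩

/-- Inside a `•`-domain along `γ`, the domain of `γ` is the complement of the closed sectors of
`γ`. -/
theorem mem_zigzagDomain_black (hD : D.Regular) (h : D.Cuts γ A B) {v : V} (hb : D.black v)
    {k : Fin (D.val v)} (hk : D.strandOf ⟨v, k⟩ = γ) {z : ℂ} (hz : z ∈ Metric.ball (0 : ℂ) 1) :
    D.disk v z ∈ D.zigzagDomain γ ↔
      ∀ j : Fin (D.val v), D.strandOf ⟨v, j⟩ = γ → z ∉ sector (D.val v) j := by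
  rw [hD.zigzagDomain_eq h]
  have hzb := Metric.ball_subset_closedBall hz
  constructor
  · rintro (⟨-, hK⟩ | ⟨c, -, hw, z', hz', he⟩) j hj hzj
    · exact hK ⟨⟨v, j⟩, hj, hb, z, hzj, rfl⟩
    · rw [(hD.eq_of_disk_eq hzb (innerSector_subset _ _ hz') (ne_tip_of_mem_ball hz) he.symm).1]
        at hw
      exact hw hb
  · intro hj
    refine Or.inl ⟨hD.domainAt_subset_right h hk hb ⟨z, hz, rfl⟩, ?_⟩
    rintro ⟨⟨u, j⟩, hc, hcb, z', hz', he⟩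
    obtain ⟨h1, rfl⟩ := hD.eq_of_disk_eq hzb (sector_subset _ _ hz') (ne_tip_of_mem_ball hz) he.symm
    obtain rfl : u = v := h1
    exact hj j hc hz'

/-- Inside a `◦`-domain along `γ`, the domain of `γ` is the union of the inner sectors of `γ`. -/
theorem mem_zigzagDomain_white (hD : D.Regular) (h : D.Cuts γ A B) {v : V} (hw : ¬D.black v)
    {k : Fin (D.val v)} (hk : D.strandOf ⟨v, k⟩ = γ) {z : ℂ} (hz : z ∈ Metric.ball (0 : ℂ) 1) :
    D.disk v z ∈ D.zigzagDomain γ ↔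
      ∃ j : Fin (D.val v), D.strandOf ⟨v, j⟩ = γ ∧ z ∈ innerSector (D.val v) j := by
  rw [hD.zigzagDomain_eq h]
  have hzb := Metric.ball_subset_closedBall hz
  constructor
  · rintro (⟨hA, -⟩ | ⟨⟨u, j⟩, hj, -, z', hz', he⟩)
    · exact absurd ⟨hA, hD.domainAt_subset_left h hk hw ⟨z, hz, rfl⟩⟩ (h.disjoint.le_bot ·)
    · obtain ⟨h1, rfl⟩ := hD.eq_of_disk_eq hzb (innerSector_subset _ _ hz') (ne_tip_of_mem_ball hz)
        he.symm
      obtain rfl : u = v := h1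
      exact ⟨j, hj, hz'⟩
  · rintro ⟨j, hj, hzj⟩
    exact Or.inr ⟨⟨v, j⟩, hj, hw, z, hzj, rfl⟩

end Cuts

end Regular

/-- The local properties of a web which determine the topology of the glued surface. -/
structure Tame (D : WebData V X) : Prop extends D.Regular where
  /-- Near a point of a spoke, other than the centre, the graph separates the surface into two
  connected parts, which contain points of the two adjacent sectors. -/
  twoSided : ∀ v, ∀ k k' : Fin (D.val v), (k' + 1 : ℕ) ≡ k [MOD D.val v] → ∀ r ∈ Ioc (0 : ℝ) 1,
    ∀ N ∈ 𝓝 (D.disk v (polar (D.val v) r k)), ∃ P Q : Set X, IsPreconnected P ∧ IsPreconnected Q ∧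
      P ⊆ N \ D.graph ∧ Q ⊆ N \ D.graph ∧ P ∪ Q ∪ D.graph ∈ 𝓝 (D.disk v (polar (D.val v) r k)) ∧
      (P ∩ D.disk v '' (innerSector (D.val v) k ∩ Metric.ball 0 1)).Nonempty ∧
      (Q ∩ D.disk v '' (innerSector (D.val v) k' ∩ Metric.ball 0 1)).Nonempty

end WebData
end SpectralWeb
end

noncomputable section
namespace SpectralWeb
universe w
variable {V : Type w} {X S : Type*}

/-! ### Sheets -/

/-- Over the open set `U`, the map `f` is a disjoint union of open sheets. -/
def HasSheets {E B : Type*} [TopologicalSpace E] [TopologicalSpace B] (f : E → B)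
    (U : Set B) : Prop :=
  IsOpen U ∧ ∃ (I : Type w) (s : I → U → E), (∀ i, Continuous (s i)) ∧ (∀ i, IsOpen (range (s i))) ∧
    (∀ i u, f (s i u) = u) ∧ ∀ a, f a ∈ U → ∃! i, a ∈ range (s i)

theorem HasSheets.mono {E B : Type*} [TopologicalSpace E] [TopologicalSpace B] {f : E → B}
    (hf : Continuous f) {U U' : Set B} (h : HasSheets.{w} f U) (hU' : IsOpen U') (hs : U' ⊆ U) :
    HasSheets.{w} f U' := by
  obtain ⟨-, I, s, h1, h2, h3, h4⟩ := h
  have key : ∀ i a, a ∈ range (s i ∘ inclusion hs) ↔ a ∈ range (s i) ∧ f a ∈ U' := by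
    intro i a
    constructor
    · rintro ⟨u, rfl⟩
      refine ⟨⟨_, rfl⟩, ?_⟩
      simp only [Function.comp_apply, h3]
      exact u.2
    · rintro ⟨⟨u, rfl⟩, hu⟩
      rw [h3] at hu
      exact ⟨⟨u, hu⟩, rfl⟩
  refine ⟨hU', I, fun i => s i ∘ inclusion hs, fun i => (h1 i).comp (continuous_inclusion hs),
    fun i => ?_, fun i u => h3 i _, fun a ha => ?_⟩
  · have : range (s i ∘ inclusion hs) = range (s i) ∩ f ⁻¹' U' := by
      ext a; exact key i a
    rw [this]
    exact (h2 i).inter (hU'.preimage hf)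
  · obtain ⟨i, hi, hu⟩ := h4 a (hs ha)
    exact ⟨i, (key i a).2 ⟨hi, ha⟩, fun j hj => hu j ((key j a).1 hj).1⟩

/-- The trivialisation sends a point to its image and the index of its unique sheet; that index is
locally constant because the sheets are open. -/
theorem HasSheets.isEvenlyCovered {E B : Type*} [TopologicalSpace E] [TopologicalSpace B]
    {f : E → B} (hf : Continuous f) {U : Set B} (h : HasSheets.{w} f U) {x : B} (hx : x ∈ U) :
    IsEvenlyCovered f x (f ⁻¹' {x}) := by
  obtain ⟨hU, I, s, h1, h2, h3, h4⟩ := h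
  let _ : TopologicalSpace I := ⊥
  have : DiscreteTopology I := ⟨rfl⟩
  suffices IsEvenlyCovered f x I from this.to_isEvenlyCovered_preimage
  choose i hi hu using h4
  have hs : ∀ a (ha : f a ∈ U), s (i a ha) ⟨f a, ha⟩ = a := by
    intro a ha
    obtain ⟨u, hu⟩ := hi a ha
    have : u = ⟨f a, ha⟩ := Subtype.ext (by rw [← h3 (i a ha) u, hu])
    rw [← this, hu]
  refine ⟨inferInstance, U, hx, hU, hU.preimage hf,
    { toFun := fun a => (⟨f a.1, a.2⟩, i a.1 a.2)
      invFun := fun q => ⟨s q.2 q.1, by rw [mem_preimage, h3]; exact q.1.2⟩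
      left_inv := fun a => Subtype.ext (hs a.1 a.2)
      right_inv := fun q => ?_
      continuous_toFun := ?_
      continuous_invFun := ?_ }, fun a => rfl⟩
  · have h5 : f (s q.2 q.1) ∈ U := by rw [h3]; exact q.1.2
    exact Prod.ext (Subtype.ext (h3 _ _)) (hu _ h5 q.2 ⟨_, rfl⟩).symm
  · refine Continuous.prodMk (by fun_prop) (continuous_discrete_rng.2 fun j => ?_)
    have : (fun a : f ⁻¹' U => i a.1 a.2) ⁻¹' {j} = Subtype.val ⁻¹' range (s j) := by
      ext a
      constructor
      · rintro rfl; exact hi _ _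
      · exact fun ha => (hu a.1 a.2 j ha).symm
    rw [this]
    exact (h2 j).preimage continuous_subtype_val
  · refine Continuous.subtype_mk ?_ _
    exact (continuous_prod_of_discrete_right (f := fun q : U × I => s q.2 q.1)).2 h1

namespace WebData
variable [TopologicalSpace X] {D : WebData V X}

/-! ### The topology of the glued surface -/

/-- A point of the piece `F_γ`, as a point of the glued surface. -/
def mkFace (D : WebData V X) (γ : D.Strand) (x : D.face γ) : D.Glued :=
  Quotient.mk D.gluing (Sum.inr ⟨γ, x⟩)

/-- A point of the graph, as a point of the glued surface. -/
def mkGraph (D : WebData V X) (x : D.graph) : D.Glued := Quotient.mk D.gluing (Sum.inl x)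

theorem continuous_mk : Continuous (Quotient.mk D.gluing : D.Pieces → D.Glued) :=
  continuous_quotient_mk'

theorem continuous_mkFace (γ : D.Strand) : Continuous (D.mkFace γ) :=
  continuous_mk.comp (continuous_inr.comp continuous_sigmaMk)

theorem continuous_gluedMap : Continuous D.gluedMap := by
  refine Continuous.quotient_lift ?_ _
  refine Continuous.congr (f := Sum.elim Subtype.val fun y => y.2.1) ?_ ?_
  · exact continuous_subtype_val.sumElim (continuous_sigma fun γ => continuous_subtype_val)
  · rintro (x | x) <;> rfl

theorem mkFace_eq_mkFace {γ γ' : D.Strand} {x : D.face γ} {x' : D.face γ'} :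
    D.mkFace γ x = D.mkFace γ' x' ↔
      x.1 = x'.1 ∧ (γ = γ' ∨ x.1 ∈ D.zigzag γ ∧ x.1 ∈ D.zigzag γ') := by
  have : D.mkFace γ x = D.mkFace γ' x' ↔ D.gluing (Sum.inr ⟨γ, x⟩) (Sum.inr ⟨γ', x'⟩) :=
    Quotient.eq
  rw [this]
  constructor
  · rintro (h | ⟨h1, h2, h3⟩)
    · simp only [Sum.inr.injEq] at h
      cases h
      exact ⟨rfl, Or.inl rfl⟩
    · change x.1 ∈ D.zigzag γ at h1
      change x'.1 ∈ D.zigzag γ' at h2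
      change x.1 = x'.1 at h3
      exact ⟨h3, Or.inr ⟨h1, h3 ▸ h2⟩⟩
  · rintro ⟨h, rfl | ⟨h1, h2⟩⟩
    · left
      rw [Subtype.ext h]
    · exact Or.inr ⟨h1, (h ▸ h2 : x'.1 ∈ D.zigzag γ'), h⟩

theorem mkGraph_eq_mkFace {γ : D.Strand} {x : D.graph} {x' : D.face γ} (h : x.1 = x'.1)
    (hx : x.1 ∈ D.zigzag γ) : D.mkGraph x = D.mkFace γ x' :=
  Quotient.sound (s := D.gluing) (Or.inr ⟨trivial, (h ▸ hx : x'.1 ∈ D.zigzag γ), h⟩)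

/-- Every strand cuts the surface into two components. -/
def AllCut (D : WebData V X) : Prop := ∀ γ : D.Strand, ∃ A B, D.Cuts γ A B

variable [T2Space X]

namespace Tame

theorem exists_mkFace (hD : D.Tame) (a : D.Glued) : ∃ γ x, a = D.mkFace γ x := by
  obtain ⟨a', rfl⟩ := Quotient.exists_rep a
  rcases a' with x | ⟨γ, x⟩
  · obtain ⟨γ, hγ⟩ := hD.exists_mem_zigzag x.2
    exact ⟨γ, ⟨x.1, Or.inr hγ⟩, mkGraph_eq_mkFace rfl hγ⟩
  · exact ⟨γ, x, rfl⟩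

theorem isOpen_zigzagDomain' (hD : D.Tame) (hc : D.AllCut) (γ : D.Strand) :
    IsOpen (D.zigzagDomain γ) :=
  let ⟨_, _, h⟩ := hc γ
  hD.isOpen_zigzagDomain h

theorem isClosed_face' (hD : D.Tame) (hc : D.AllCut) (γ : D.Strand) : IsClosed (D.face γ) :=
  let ⟨_, _, h⟩ := hc γ
  hD.isClosed_face h

theorem notMem_zigzag (hD : D.Tame) (hc : D.AllCut) {γ : D.Strand} {x : X}
    (hx : x ∈ D.zigzagDomain γ) : x ∉ D.zigzag γ :=
  let ⟨_, _, h⟩ := hc γ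
  fun h' => hD.disjoint_zigzag h h' hx

/-- The glued surface carries the quotient topology of the pieces `F_γ` alone. -/
theorem isOpen_glued (hD : D.Tame) (hc : D.AllCut) {W : Set D.Glued}
    (h : ∀ γ, IsOpen (D.mkFace γ ⁻¹' W)) : IsOpen W := by
  have h0 : IsOpen ((Quotient.mk D.gluing : D.Pieces → D.Glued) ⁻¹' W) := by
    refine isOpen_sum_iff.2 ⟨?_, isOpen_sigma_iff.2 h⟩
    change IsOpen (D.mkGraph ⁻¹' W)
    rw [← isClosed_compl_iff, hD.isClosed_graph.isClosedEmbedding_subtypeVal.isClosed_iff_image_isClosed]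
    -- The graph is a locally finite union of the zig-zag paths, each closed in a piece, so
    -- closedness of the complement can be tested piece by piece.
    have : Subtype.val '' (D.mkGraph ⁻¹' W)ᶜ =
        ⋃ γ, Subtype.val '' ((D.mkFace γ ⁻¹' W)ᶜ ∩ Subtype.val ⁻¹' D.zigzag γ) := by
      ext x
      simp only [mem_iUnion]
      constructor
      · rintro ⟨y, hy, rfl⟩
        obtain ⟨γ, hγ⟩ := hD.exists_mem_zigzag y.2
        refine ⟨γ, ⟨y.1, Or.inr hγ⟩, ⟨?_, hγ⟩, rfl⟩
        rw [mem_compl_iff, mem_preimage, ← mkGraph_eq_mkFace (x := y) rfl hγ]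
        exact hy
      · rintro ⟨γ, y, ⟨hy, hγ⟩, rfl⟩
        refine ⟨⟨y.1, hD.zigzag_subset_graph γ hγ⟩, ?_, rfl⟩
        rw [mem_compl_iff, mem_preimage,
          mkGraph_eq_mkFace (x := ⟨y.1, hD.zigzag_subset_graph γ hγ⟩) (x' := y) rfl hγ]
        exact hy
    rw [this]
    refine LocallyFinite.isClosed_iUnion ?_ fun γ => ?_
    · refine hD.locallyFinite_zigzag.subset fun γ => ?_
      rintro _ ⟨y, ⟨-, hγ⟩, rfl⟩
      exact hγ
    · refine (hD.isClosed_face' hc γ).isClosedEmbedding_subtypeVal.isClosedMap _ ?_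
      exact (h γ).isClosed_compl.inter ((hD.isClosed_zigzag γ).preimage continuous_subtype_val)
  exact h0

/-- The part of `F_γ` inside the domain of `γ` is open in the glued surface. -/
theorem isOpen_range_mkFace (hD : D.Tame) (hc : D.AllCut) {γ : D.Strand} {U : Set X}
    (hU : IsOpen U) (hs : U ⊆ D.zigzagDomain γ) :
    IsOpen (range fun u : U => D.mkFace γ ⟨u, Or.inl (hs u.2)⟩) := by
  refine hD.isOpen_glued hc fun γ' => ?_
  by_cases h : γ = γ'
  · subst h
    convert! hU.preimage (continuous_subtype_val (p := (· ∈ D.face γ))) using 1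
    ext x
    constructor
    · rintro ⟨u, hu⟩
      rw [mem_preimage, ← (mkFace_eq_mkFace.1 hu).1]
      exact u.2
    · exact fun hx => ⟨⟨x, hx⟩, rfl⟩
  · convert isOpen_empty
    rw [eq_empty_iff_forall_notMem]
    rintro x ⟨u, hu⟩
    rcases (mkFace_eq_mkFace.1 hu).2 with h' | h'
    · exact h h'
    · exact hD.notMem_zigzag hc (hs u.2) h'.1

/-- Finitely many pieces of the glued surface which fit together along the graph form an open
part of the glued surface. -/
theorem exists_chart (hD : D.Tame) (hc : D.AllCut) {Y ι : Type*} [TopologicalSpace Y] [Finite ι]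
    {C : ι → Set Y} (hC : ∀ i, IsClosed (C i)) (hcov : ∀ y, ∃ i, y ∈ C i) {q : Y → X}
    (hq : Continuous q) {γ : ι → D.Strand} (hγ : Function.Injective γ) {U : Set X} (hU : IsOpen U)
    (himg : ∀ i, q '' C i = D.face (γ i) ∩ U)
    (hemb : ∀ i W, IsOpen W → ∃ O, IsOpen O ∧ q '' (C i ∩ W) = q '' C i ∩ O)
    (hinj : ∀ i, InjOn q (C i))
    (hglue : ∀ i j, i ≠ j → ∀ y ∈ C i, y ∈ C j → q y ∈ D.zigzag (γ i) ∧ q y ∈ D.zigzag (γ j))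
    (hsep : ∀ i j, i ≠ j → ∀ y ∈ C i, ∀ y' ∈ C j, q y = q y' → q y ∈ D.zigzag (γ i) →
      q y ∈ D.zigzag (γ j) → y = y')
    (hother : ∀ γ', (∀ i, γ i ≠ γ') → ∀ x ∈ D.zigzag γ', x ∉ U) :
    ∃ ψ : Y → D.Glued, Continuous ψ ∧ Function.Injective ψ ∧ IsOpenMap ψ ∧
      (∀ y, D.gluedMap (ψ y) = q y) ∧
      ∀ i y, y ∈ C i → ∀ h : q y ∈ D.face (γ i), ψ y = D.mkFace (γ i) ⟨q y, h⟩ := by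
  have hmem : ∀ i y, y ∈ C i → q y ∈ D.face (γ i) ∩ U := fun i y hy => himg i ▸ ⟨y, hy, rfl⟩
  choose i hi using hcov
  let ψ : Y → D.Glued := fun y => D.mkFace (γ (i y)) ⟨q y, (hmem _ y (hi y)).1⟩
  have hψ : ∀ j y, y ∈ C j → ∀ h : q y ∈ D.face (γ j), ψ y = D.mkFace (γ j) ⟨q y, h⟩ := by
    intro j y hy h
    refine mkFace_eq_mkFace.2 ⟨rfl, ?_⟩
    by_cases hij : i y = j
    · exact Or.inl (congrArg γ hij)
    · exact Or.inr (hglue _ _ hij y (hi y) hy)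
  have hinjψ : Function.Injective ψ := by
    intro y y' h
    obtain ⟨h1, h2⟩ := mkFace_eq_mkFace.1 h
    by_cases hij : i y = i y'
    · exact hinj _ (hi y) (hij ▸ hi y') h1
    · rcases h2 with h2 | h2
      · exact absurd (hγ h2) hij
      · exact hsep _ _ hij y (hi y) y' (hi y') h1 h2.1 h2.2
  refine ⟨ψ, ?_, hinjψ, ?_, fun y => rfl, hψ⟩
  -- On each of the finitely many closed sets `C j` the map agrees with the inclusion of one piece,
  -- whatever index was chosen at a point.
  · refine (locallyFinite_of_finite C).continuous ?_ hC fun j => ?_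
    · exact eq_univ_of_forall fun y => mem_iUnion.2 ⟨i y, hi y⟩
    · rw [continuousOn_iff_continuous_domRestrict]
      refine Continuous.congr (f := fun y : C j => D.mkFace (γ j) ⟨q y, (hmem j y y.2).1⟩) ?_
        fun y => (hψ j y y.2 _).symm
      exact (continuous_mkFace _).comp (Continuous.subtype_mk (hq.comp continuous_subtype_val) _)
  · intro W hW
    refine hD.isOpen_glued hc fun γ' => ?_
    by_cases h : ∃ j, γ j = γ'
    · obtain ⟨j, rfl⟩ := h
      obtain ⟨O, hO, hOW⟩ := hemb j W hW
      convert! (hU.inter hO).preimage (continuous_subtype_val (p := (· ∈ D.face (γ j)))) using 1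
      ext x
      have key : x.1 ∈ q '' (C j ∩ W) ↔ x.1 ∈ U ∩ O := by
        rw [hOW, himg, inter_assoc]
        exact ⟨fun h => h.2, fun h => ⟨x.2, h⟩⟩
      rw [mem_preimage, mem_preimage, ← key]
      constructor
      · rintro ⟨y, hyW, hy⟩
        have h1 : q y = x := (mkFace_eq_mkFace.1 hy).1
        have h2 : x.1 ∈ q '' C j := by
          rw [himg, ← h1]
          exact ⟨h1 ▸ x.2, (hmem _ y (hi y)).2⟩
        obtain ⟨y', hy', h3⟩ := h2
        -- The index chosen for `y` need not be `j`. Injectivity of `ψ` shows that `y` nevertheless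
        -- lies in `C j`.
        have h4 : y' = y := by
          apply hinjψ
          rw [hy, hψ j y' hy' (h3 ▸ x.2)]
          exact mkFace_eq_mkFace.2 ⟨h3, Or.inl rfl⟩
        subst h4
        exact ⟨y', ⟨hy', hyW⟩, h3⟩
      · rintro ⟨y, ⟨hy, hyW⟩, h1⟩
        refine ⟨y, hyW, ?_⟩
        rw [hψ j y hy (h1 ▸ x.2)]
        exact mkFace_eq_mkFace.2 ⟨h1, Or.inl rfl⟩
    -- A piece outside the family could meet the image only along its own zig-zag path, which avoids
    -- `U`.
    · push Not at h
      convert isOpen_empty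
      rw [eq_empty_iff_forall_notMem]
      rintro x ⟨y, -, hy⟩
      obtain ⟨h1, h2 | h2⟩ := mkFace_eq_mkFace.1 hy
      · exact h _ h2
      · exact hother γ' h _ h2.2 (hmem _ y (hi y)).2

/-- A connected set which avoids the zig-zag path of `γ` is contained in the domain of `γ` or
disjoint from it. -/
theorem subset_zigzagDomain (hD : D.Tame) (hc : D.AllCut) {γ : D.Strand} {U : Set X}
    (hU : IsPreconnected U) (hz : ∀ y ∈ U, y ∉ D.zigzag γ) {x y : X} (hx : x ∈ U) (hy : y ∈ U)
    (hyF : y ∈ D.face γ) : U ⊆ D.zigzagDomain γ ∧ x ∈ D.zigzagDomain γ := by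
  have : U ⊆ D.zigzagDomain γ := by
    refine hU.subset_left_of_subset_union (hD.isOpen_zigzagDomain' hc γ)
      (hD.isClosed_face' hc γ).isOpen_compl (disjoint_left.2 fun a h1 h2 => h2 (Or.inl h1)) ?_
      ⟨y, hy, hyF.resolve_right (hz y hy)⟩
    intro a ha
    by_cases haF : a ∈ D.face γ
    · exact Or.inl (haF.resolve_right (hz a ha))
    · exact Or.inr haF
  exact ⟨this, this hx⟩

/-- A component of the complement of the graph meets no zig-zag path, so each piece contains all of
it or none of it. The sheets are the pieces that contain it. -/
theorem hasSheets_of_notMem_graph [LocallyConnectedSpace X] (hD : D.Tame) (hc : D.AllCut) {x : X}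
    (hx : x ∉ D.graph) : ∃ U, x ∈ U ∧ HasSheets.{w} D.gluedMap U := by
  have hU : IsOpen (connectedComponentIn D.graphᶜ x) :=
    hD.isClosed_graph.isOpen_compl.connectedComponentIn
  have hxU : x ∈ connectedComponentIn D.graphᶜ x := mem_connectedComponentIn hx
  have hz : ∀ γ, ∀ y ∈ connectedComponentIn D.graphᶜ x, y ∉ D.zigzag γ := fun γ y hy h =>
    connectedComponentIn_subset _ _ hy (hD.zigzag_subset_graph γ h)
  have hsub : ∀ γ, ∀ y ∈ connectedComponentIn D.graphᶜ x, y ∈ D.face γ → _ := fun γ y hy hyF =>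
    hD.subset_zigzagDomain hc isPreconnected_connectedComponentIn (hz γ) hxU hy hyF
  have hs : ∀ γ : {γ // x ∈ D.zigzagDomain γ}, connectedComponentIn D.graphᶜ x ⊆
      D.zigzagDomain γ.1 := fun γ => (hsub γ.1 x hxU (Or.inl γ.2)).1
  refine ⟨_, hxU, hU, {γ // x ∈ D.zigzagDomain γ},
    fun γ u => D.mkFace γ.1 ⟨u, Or.inl (hs γ u.2)⟩, fun γ => ?_, fun γ => ?_, fun γ u => rfl, ?_⟩
  · exact (continuous_mkFace _).comp (by fun_prop)
  · exact hD.isOpen_range_mkFace hc hU (hs γ)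
  · intro a ha
    obtain ⟨γ, y, rfl⟩ := hD.exists_mkFace a
    refine ⟨⟨γ, (hsub γ y ha y.2).2⟩, ⟨⟨y, ha⟩, rfl⟩, ?_⟩
    rintro γ' ⟨u, hu⟩
    obtain ⟨h1, h2 | h2⟩ := mkFace_eq_mkFace.1 hu
    · exact Subtype.ext h2
    · exact absurd h2.1 (hz _ _ u.2)

/-- The glued surface is a covering near a point of the graph around which the pieces through this
point form one sheet. -/
theorem hasSheets_of_mem_graph [LocallyConnectedSpace X] (hD : D.Tame) (hc : D.AllCut) {x : X}
    {M : Set X} (hM : M ∈ 𝓝 x) (h1 : ∀ y ∈ M, ∃ γ, x ∈ D.zigzag γ ∧ y ∈ D.face γ)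
    (h2 : ∀ y ∈ M, ∀ γ γ', γ ≠ γ' → x ∈ D.zigzag γ → x ∈ D.zigzag γ' → y ∈ D.face γ →
      y ∈ D.face γ' → y ∈ D.zigzag γ ∧ y ∈ D.zigzag γ') :
    ∃ U, x ∈ U ∧ HasSheets.{w} D.gluedMap U := by
  -- Shrinking away from the zig-zag paths not through `x` makes every other piece all or nothing
  -- over the connected set `U`.
  have hN := inter_mem hM (hD.locallyFinite_zigzag.iInter_compl_mem_nhds hD.isClosed_zigzag x)
  obtain ⟨N, hNs, hNo, hxN⟩ := mem_nhds_iff.1 hN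
  set U := connectedComponentIn N x with hUdef
  have hU : IsOpen U := hNo.connectedComponentIn
  have hxU : x ∈ U := mem_connectedComponentIn hxN
  have hUM : ∀ y ∈ U, y ∈ M := fun y hy => (hNs (connectedComponentIn_subset _ _ hy)).1
  have hz : ∀ γ, x ∉ D.zigzag γ → ∀ y ∈ U, y ∉ D.zigzag γ := fun γ hγ y hy =>
    mem_iInter₂.1 (hNs (connectedComponentIn_subset _ _ hy)).2 γ hγ
  have hsub : ∀ γ, x ∉ D.zigzag γ → ∀ y ∈ U, y ∈ D.face γ →
      U ⊆ D.zigzagDomain γ ∧ x ∈ D.zigzagDomain γ := fun γ hγ y hy hyF =>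
    hD.subset_zigzagDomain hc isPreconnected_connectedComponentIn (hz γ hγ) hxU hy hyF
  have hs : ∀ γ : {γ // x ∈ D.zigzagDomain γ}, U ⊆ D.zigzagDomain γ.1 := fun γ =>
    (hsub γ.1 (hD.notMem_zigzag hc γ.2) x hxU (Or.inl γ.2)).1
  have hfin : Finite {γ // x ∈ D.zigzag γ} := (hD.locallyFinite_zigzag.point_finite x).to_subtype
  have himg : ∀ i : {γ // x ∈ D.zigzag γ},
      (Subtype.val : U → X) '' (Subtype.val ⁻¹' D.face i.1) = D.face i.1 ∩ U := fun i => by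
    rw [Subtype.image_preimage_coe, inter_comm]
  obtain ⟨ψ, hψ1, hψ2, hψ3, hψ4, hψ5⟩ := hD.exists_chart hc (Y := U)
    (ι := {γ // x ∈ D.zigzag γ}) (C := fun γ => Subtype.val ⁻¹' D.face γ.1)
    (fun γ => (hD.isClosed_face' hc γ.1).preimage continuous_subtype_val)
    (fun y => by
      obtain ⟨γ, hγ, hy⟩ := h1 y (hUM y y.2)
      exact ⟨⟨γ, hγ⟩, hy⟩)
    (q := Subtype.val) continuous_subtype_val (γ := Subtype.val) Subtype.val_injective hU himg
    (fun i W hW => by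
      obtain ⟨O, hO, rfl⟩ := isOpen_induced_iff.1 hW
      exact ⟨O, hO, image_inter_preimage _ _ _⟩)
    (fun i => Subtype.val_injective.injOn)
    (fun i j hij y hi hj => h2 y (hUM y y.2) i.1 j.1 (fun h => hij (Subtype.ext h)) i.2 j.2 hi hj)
    (fun i j _ y _ y' _ h _ _ => Subtype.ext h)
    (fun γ' hγ' y hy hyU => hz γ' (fun h => hγ' ⟨γ', h⟩ rfl) y hyU hy)
  -- The index `none` is the sheet joined from all pieces whose zig-zag path passes through `x`;
  -- each `some γ` is a piece with `x` in its interior.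
  refine ⟨U, hxU, hU, Option {γ // x ∈ D.zigzagDomain γ},
    fun i => i.elim ψ fun γ u => D.mkFace γ.1 ⟨u, Or.inl (hs γ u.2)⟩, ?_, ?_, ?_, ?_⟩
  · rintro (_ | γ)
    · exact hψ1
    · exact (continuous_mkFace _).comp (by fun_prop)
  · rintro (_ | γ)
    · exact hψ3.isOpen_range
    · exact hD.isOpen_range_mkFace hc hU (hs γ)
  · rintro (_ | γ) u
    · exact hψ4 u
    · rfl
  · intro a ha
    obtain ⟨γ, y, rfl⟩ := hD.exists_mkFace a
    by_cases hγ : x ∈ D.zigzag γ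
    · refine ⟨none, ⟨⟨y, ha⟩, hψ5 ⟨γ, hγ⟩ ⟨y, ha⟩ y.2 y.2⟩, ?_⟩
      rintro (_ | γ') ⟨u, hu⟩
      · rfl
      · obtain ⟨-, h4 | h4⟩ := mkFace_eq_mkFace.1 hu
        · exact absurd (h4 ▸ hγ) (hD.notMem_zigzag hc γ'.2)
        · exact absurd h4.1 (hD.notMem_zigzag hc (hs γ' u.2))
    · have hy := hsub γ hγ y ha y.2
      refine ⟨some ⟨γ, hy.2⟩, ⟨⟨y, ha⟩, rfl⟩, ?_⟩
      rintro (_ | γ') ⟨u, hu⟩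
      · obtain ⟨γ', hγ', hu'⟩ := h1 u (hUM u u.2)
        have hu2 : ψ u = D.mkFace γ y := hu
        rw [hψ5 ⟨γ', hγ'⟩ u hu' hu'] at hu2
        obtain ⟨h3, h4 | h4⟩ := mkFace_eq_mkFace.1 hu2
        · exact absurd (h4 ▸ hγ') hγ
        · exact absurd h4.2 (hz γ hγ _ u.2)
      · obtain ⟨h3, h4 | h4⟩ := mkFace_eq_mkFace.1 hu
        · exact congrArg some (Subtype.ext h4)
        · exact absurd h4.1 (hD.notMem_zigzag hc (hs γ' u.2))

end Tame
end WebData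
end SpectralWeb
end

noncomputable section
namespace SpectralWeb
universe w
variable {V : Type w} {X : Type*}
namespace WebData
variable [TopologicalSpace X] {D : WebData V X}

/-! ### The glued surface near the graph -/

theorem eq_tip_of_mem_spoke {n k : ℕ} {z : ℂ} (hz : z ∈ spoke n k) (h1 : ‖z‖ = 1) :
    z = tip n k := by
  obtain ⟨r, hr, rfl⟩ := hz
  rw [norm_mul, norm_tip, mul_one, Complex.norm_real, Real.norm_eq_abs, abs_of_nonneg hr.1] at h1
  rw [h1, Complex.ofReal_one, one_mul]

theorem exists_pred {n : ℕ} (k : Fin n) : ∃ k' : Fin n, (k' + 1 : ℕ) ≡ k [MOD n] := by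
  have hn : 0 < n := Fin.pos_iff_nonempty.2 ⟨k⟩
  refine ⟨⟨(k + (n - 1)) % n, Nat.mod_lt _ hn⟩, ?_⟩
  have h1 : (k + (n - 1)) % n + 1 ≡ (k + (n - 1)) + 1 [MOD n] := (Nat.mod_modEq _ _).add_right 1
  refine h1.trans ?_
  rw [show (k : ℕ) + (n - 1) + 1 = k + n by omega]
  exact Nat.add_modEq_right

theorem fin_eq_of_modEq {n : ℕ} {j k : Fin n} (h : (j : ℕ) ≡ k [MOD n]) : j = k :=
  Fin.ext (Nat.ModEq.eq_of_lt_of_lt h j.2 k.2)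

theorem pred_ne {n : ℕ} (hn : 2 ≤ n) {k k' : Fin n} (h : (k' + 1 : ℕ) ≡ k [MOD n]) : k ≠ k' := by
  rintro rfl
  have h1 : (k : ℕ) + 1 ≡ k + 0 [MOD n] := h
  have h2 := Nat.ModEq.add_left_cancel' _ h1
  have h3 : n ∣ 1 := (Nat.modEq_zero_iff_dvd).1 h2
  have := Nat.le_of_dvd one_pos h3
  omega

theorem strandOf_eq_of_follows {c c' : D.Corner} (h : D.Follows c c') :
    D.strandOf c = D.strandOf c' := Quot.sound h

/-- Two corners touching each other at their left ends belong to the same strand. -/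
theorem strandOf_eq_left {c c' : D.Corner} (hb : ¬(D.black c.1 ↔ D.black c'.1))
    (h : D.disk c.1 (tip (D.val c.1) c.2) = D.disk c'.1 (tip (D.val c'.1) c'.2)) :
    D.strandOf c = D.strandOf c' := by
  by_cases hc : D.black c.1
  · exact strandOf_eq_of_follows (Or.inl ⟨hc, fun h' => hb (by tauto), h⟩)
  · exact (strandOf_eq_of_follows (Or.inl ⟨by tauto, hc, h.symm⟩)).symm

/-- Two corners touching each other at their right ends belong to the same strand. -/
theorem strandOf_eq_right {c c' : D.Corner} (hb : ¬(D.black c.1 ↔ D.black c'.1))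
    (h : D.disk c.1 (tip (D.val c.1) (c.2 + 1)) = D.disk c'.1 (tip (D.val c'.1) (c'.2 + 1))) :
    D.strandOf c = D.strandOf c' := by
  by_cases hc : D.black c.1
  · exact (strandOf_eq_of_follows (Or.inr ⟨by tauto, hc, h.symm⟩)).symm
  · exact strandOf_eq_of_follows (Or.inr ⟨hc, by tauto, h⟩)

/-- A zig-zag path does not pass twice through the same `•`-vertex. -/
def BlackInjective (D : WebData V X) : Prop :=
  ∀ v, D.black v → ∀ k l : Fin (D.val v), D.strandOf ⟨v, k⟩ = D.strandOf ⟨v, l⟩ → k = l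

namespace Tame

/-- Only the two zig-zag paths along an edge pass through a point of this edge. -/
theorem strand_of_mem_zigzag (hD : D.Tame) {v : V} {k k' : Fin (D.val v)}
    (hk : (k' + 1 : ℕ) ≡ k [MOD D.val v]) {r : ℝ} (hr : r ∈ Ioc (0 : ℝ) 1) {γ : D.Strand}
    (h : D.disk v (polar (D.val v) r k) ∈ D.zigzag γ) :
    γ = D.strandOf ⟨v, k⟩ ∨ γ = D.strandOf ⟨v, k'⟩ := by
  obtain ⟨⟨u, j⟩, hc, z, hz, he⟩ := h
  have hn := hD.val_pos v
  change z ∈ spoke (D.val u) j ∪ spoke (D.val u) (j + 1) at hz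
  change D.disk u z = _ at he
  have hzb : z ∈ Metric.closedBall (0 : ℂ) 1 :=
    union_subset (spoke_subset _ _) (spoke_subset _ _) hz
  have hpb : polar (D.val v) r k ∈ Metric.closedBall (0 : ℂ) 1 :=
    polar_mem_closedBall ⟨hr.1.le, hr.2⟩
  by_cases huv : u = v
  · subst huv
    have hzp := hD.injOn u hzb hpb he
    subst hzp
    rcases hz with hz | hz
    · left
      rw [← hc, fin_eq_of_modEq (modEq_of_mem_spoke hn hr.1 hz)]
    · right
      rw [← hc, fin_eq_of_modEq
        (Nat.ModEq.add_right_cancel' 1 (hk.trans (modEq_of_mem_spoke hn hr.1 hz)))]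
  -- A second vertex occurs only at the crossing point r = 1. There strands continue from one domain
  -- to the other, so no new strand appears.
  · obtain ⟨hb, ⟨l, hl⟩, ⟨l', hl'⟩⟩ := hD.meet u v huv z hzb _ hpb he
    have hr1 : r = 1 := by
      have := congrArg norm hl'
      rwa [norm_polar, norm_tip, abs_of_pos hr.1] at this
    rw [hr1, ← tip_eq_polar] at he
    have hz1 : ‖z‖ = 1 := by rw [hl, norm_tip]
    rcases hz with hz | hz
    · left
      rw [eq_tip_of_mem_spoke hz hz1] at he
      rw [← hc]
      exact strandOf_eq_left (c := ⟨u, j⟩) (c' := ⟨v, k⟩) hb he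
    · right
      rw [eq_tip_of_mem_spoke hz hz1, ← tip_congr_mod hn hk] at he
      rw [← hc]
      exact strandOf_eq_right (c := ⟨u, j⟩) (c' := ⟨v, k'⟩) hb he

theorem spoke_subset_zigzag (hD : D.Tame) {v : V} {k k' : Fin (D.val v)}
    (hk : (k' + 1 : ℕ) ≡ k [MOD D.val v]) {γ : D.Strand}
    (h : γ = D.strandOf ⟨v, k⟩ ∨ γ = D.strandOf ⟨v, k'⟩) :
    D.disk v '' spoke (D.val v) k ⊆ D.zigzag γ := by
  rintro _ ⟨z, hz, rfl⟩
  rcases h with rfl | rfl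
  · exact ⟨⟨v, k⟩, rfl, z, Or.inl hz, rfl⟩
  · refine ⟨⟨v, k'⟩, rfl, z, Or.inr ?_, rfl⟩
    change z ∈ spoke (D.val v) (k' + 1)
    rwa [spoke_congr_mod (hD.val_pos v) hk]

/-- The zig-zag paths inside a domain. -/
theorem mem_zigzag_iff (hD : D.Tame) {v : V} {z : ℂ} (hz : z ∈ Metric.ball (0 : ℂ) 1)
    {γ : D.Strand} : D.disk v z ∈ D.zigzag γ ↔ ∃ j : Fin (D.val v), D.strandOf ⟨v, j⟩ = γ ∧
      z ∈ spoke (D.val v) j ∪ spoke (D.val v) (j + 1) := by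
  constructor
  · rintro ⟨⟨u, j⟩, hc, z', hz', he⟩
    obtain ⟨h1, rfl⟩ := hD.eq_of_disk_eq (Metric.ball_subset_closedBall hz)
      (union_subset (spoke_subset _ _) (spoke_subset _ _) hz') (ne_tip_of_mem_ball hz) he.symm
    obtain rfl : u = v := h1
    exact ⟨j, hc, hz'⟩
  · rintro ⟨j, hj, hz⟩
    exact ⟨⟨v, j⟩, hj, z, hz, rfl⟩

variable [T2Space X]

/-- The sheet in the inner sector `k`, at a spoke which bounds this sector and the sector `k'`. -/
theorem mem_zigzagDomain_innerSector (hD : D.Tame) (hc : D.AllCut) (hs : D.BlackInjective) {v : V}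
    {k k' : Fin (D.val v)} (hkk : k ≠ k') {z : ℂ}
    (hz : z ∈ innerSector (D.val v) k ∩ Metric.ball 0 1) {γ : D.Strand}
    (hγ : γ = D.strandOf ⟨v, k⟩ ∨ γ = D.strandOf ⟨v, k'⟩) :
    (D.black v → (D.disk v z ∈ D.zigzagDomain γ ↔ γ = D.strandOf ⟨v, k'⟩)) ∧
    (¬D.black v → (D.disk v z ∈ D.zigzagDomain γ ↔ γ = D.strandOf ⟨v, k⟩)) := by
  obtain ⟨A, B, h⟩ := hc γ
  have hn := hD.val_pos v
  obtain ⟨i, hi⟩ : ∃ i, D.strandOf ⟨v, i⟩ = γ := by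
    rcases hγ with rfl | rfl
    exacts [⟨k, rfl⟩, ⟨k', rfl⟩]
  constructor
  · intro hb
    rw [hD.mem_zigzagDomain_black h hb hi hz.2]
    constructor
    · intro h'
      exact hγ.resolve_left fun h1 => h' k h1.symm (innerSector_subset_sector _ _ hz.1)
    · rintro rfl j hj hzj
      -- Simple passage is essential here: the strand of `k'` removes only the sector `k'`, hence
      -- keeps the sector `k`.
      rw [hs v hb j k' hj] at hzj
      exact hkk (innerSector_inter_sector hn hz.1 hzj)
  · intro hw
    rw [hD.mem_zigzagDomain_white h hw hi hz.2]
    constructor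
    · rintro ⟨j, rfl, hzj⟩
      rw [innerSector_inter_sector hn hz.1 (innerSector_subset_sector _ _ hzj)]
    · rintro rfl
      exact ⟨k, rfl, hz.1⟩

/-- Each side of the edge is connected off the graph, so the pieces over it can be read off in the
sector where it starts, inside the domain of `v`. By `mem_zigzagDomain_innerSector`, exactly one of
the pieces whose zig-zag path contains the point is present there. -/
theorem hasSheets_of_spoke [LocallyConnectedSpace X] (hD : D.Tame) (hc : D.AllCut)
    (hs : D.BlackInjective) {v : V} {k : Fin (D.val v)} {r : ℝ} (hr : r ∈ Ioc (0 : ℝ) 1) :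
    ∃ U, D.disk v (polar (D.val v) r k) ∈ U ∧ HasSheets.{w} D.gluedMap U := by
  obtain ⟨k', hk⟩ := exists_pred k
  have hkk := pred_ne (hD.two_le_val v) hk
  obtain ⟨P, Q, hP, hQ, hPG, hQG, hPQ, hPne, hQne⟩ := hD.twoSided v k k' hk r hr univ univ_mem
  set x := D.disk v (polar (D.val v) r k) with hx
  have hxs : x ∈ D.disk v '' spoke (D.val v) k :=
    ⟨_, mem_spoke.2 ⟨r, ⟨hr.1.le, hr.2⟩, rfl⟩, rfl⟩
  have hγ : ∀ γ, x ∈ D.zigzag γ ↔ γ = D.strandOf ⟨v, k⟩ ∨ γ = D.strandOf ⟨v, k'⟩ := fun γ =>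
    ⟨fun h => hD.strand_of_mem_zigzag hk hr h, fun h => hD.spoke_subset_zigzag hk h hxs⟩
  have hside : ∀ (R : Set X) (a b : Fin (D.val v)), IsPreconnected R → R ⊆ univ \ D.graph →
      (R ∩ D.disk v '' (innerSector (D.val v) a ∩ Metric.ball 0 1)).Nonempty → a ≠ b →
      (∀ γ, x ∈ D.zigzag γ ↔ γ = D.strandOf ⟨v, a⟩ ∨ γ = D.strandOf ⟨v, b⟩) →
      ∃ g, x ∈ D.zigzag g ∧ ∀ γ, x ∈ D.zigzag γ → ∀ y ∈ R, (y ∈ D.face γ ↔ γ = g) := by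
    rintro R a b hR hRG ⟨_, hpR, z, hz, rfl⟩ hab hγ
    have hg : ∃ g, x ∈ D.zigzag g ∧ ∀ γ, x ∈ D.zigzag γ →
        (D.disk v z ∈ D.zigzagDomain γ ↔ γ = g) := by
      by_cases hb : D.black v
      · exact ⟨D.strandOf ⟨v, b⟩, (hγ _).2 (Or.inr rfl), fun γ h =>
          (hD.mem_zigzagDomain_innerSector hc hs hab hz ((hγ γ).1 h)).1 hb⟩
      · exact ⟨D.strandOf ⟨v, a⟩, (hγ _).2 (Or.inl rfl), fun γ h =>
          (hD.mem_zigzagDomain_innerSector hc hs hab hz ((hγ γ).1 h)).2 hb⟩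
    obtain ⟨g, hg1, hg2⟩ := hg
    have hRz : ∀ γ, ∀ y ∈ R, y ∉ D.zigzag γ := fun γ y hy h =>
      (hRG hy).2 (hD.zigzag_subset_graph γ h)
    refine ⟨g, hg1, fun γ h y hy => ⟨fun hyF => ?_, fun h' => ?_⟩⟩
    · exact (hg2 γ h).1 (hD.subset_zigzagDomain hc hR (hRz γ) hpR hy hyF).2
    · have h1 := (hg2 γ h).2 h'
      exact Or.inl ((hD.subset_zigzagDomain hc hR (hRz γ) hy hpR (Or.inl h1)).2)
  obtain ⟨gP, hgP, hPg⟩ := hside P k k' hP hPG hPne hkk hγ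
  obtain ⟨gQ, hgQ, hQg⟩ := hside Q k' k hQ hQG hQne hkk.symm fun γ => (hγ γ).trans or_comm
  have hsp := (hD.locallyFinite_image (fun c => spoke (D.val c.1) c.2)
    fun c => spoke_subset _ _).iInter_compl_mem_nhds
      (fun c => hD.isClosed_image (spoke_subset _ _) (isCompact_spoke _ _)) x
  -- Nearby graph points lie on spokes through `x`, and a zig-zag path through a non-central point
  -- of a spoke contains the whole spoke.
  have hG : ∀ y ∈ D.graph, y ∈ (⋂ (c : D.Corner) (_ : x ∉ D.disk c.1 '' spoke (D.val c.1) c.2),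
      (D.disk c.1 '' spoke (D.val c.1) c.2)ᶜ) → ∀ γ, x ∈ D.zigzag γ → y ∈ D.zigzag γ := by
    intro y hyG hy γ hxγ
    rw [hD.graph_eq] at hyG
    obtain ⟨⟨u, j⟩, -, hyc⟩ := hyG
    have hxc : x ∈ D.disk u '' spoke (D.val u) j :=
      by_contra fun h => mem_iInter₂.1 hy ⟨u, j⟩ h hyc
    obtain ⟨z, hz, hzx⟩ := hxc
    obtain ⟨r', hr', rfl⟩ := mem_spoke.1 hz
    have hr0 : 0 < r' := by
      refine lt_of_le_of_ne hr'.1 fun h0 => ?_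
      rw [← h0, polar_zero, hx] at hzx
      have h1 := (hD.eq_of_disk_eq (Metric.mem_closedBall_self zero_le_one)
        (polar_mem_closedBall ⟨hr.1.le, hr.2⟩)
        (ne_tip_of_mem_ball (Metric.mem_ball_self one_pos)) hzx).2
      have h2 := congrArg norm h1
      rw [norm_polar, norm_zero, abs_of_pos hr.1] at h2
      exact hr.1.ne' h2
    obtain ⟨j', hj⟩ := exists_pred j
    rw [← hzx] at hxγ
    exact hD.spoke_subset_zigzag hj (hD.strand_of_mem_zigzag hj ⟨hr0, hr'.2⟩ hxγ) hyc
  refine hD.hasSheets_of_mem_graph hc (inter_mem hPQ hsp) ?_ ?_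
  · rintro y ⟨(hy | hy) | hy, hy'⟩
    · exact ⟨gP, hgP, (hPg gP hgP y hy).2 rfl⟩
    · exact ⟨gQ, hgQ, (hQg gQ hgQ y hy).2 rfl⟩
    · exact ⟨gP, hgP, Or.inr (hG y hy hy' gP hgP)⟩
  · rintro y ⟨(hy | hy) | hy, hy'⟩ γ γ' hne h1 h2 h3 h4
    · exact absurd (((hPg γ h1 y hy).1 h3).trans ((hPg γ' h2 y hy).1 h4).symm) hne
    · exact absurd (((hQg γ h1 y hy).1 h3).trans ((hQg γ' h2 y hy).1 h4).symm) hne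
    · exact ⟨hG y hy hy' γ h1, hG y hy hy' γ' h2⟩

/-- Inside a `◦`-domain a piece consists of the sectors at its own corners, so the disc is tiled
once. A zig-zag path may return to the vertex: its piece then supplies several sectors of the same
sheet. -/
theorem hasSheets_of_white [LocallyConnectedSpace X] (hD : D.Tame) (hc : D.AllCut) {v : V}
    (hw : ¬D.black v) : ∃ U, D.disk v 0 ∈ U ∧ HasSheets.{w} D.gluedMap U := by
  have h0 : (0 : ℂ) ∈ Metric.ball (0 : ℂ) 1 := Metric.mem_ball_self one_pos
  have hn := hD.val_pos v
  refine hD.hasSheets_of_mem_graph hc (hD.disk_mem_nhds h0) ?_ ?_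
  · rintro _ ⟨z, hz, rfl⟩
    obtain ⟨j, hj⟩ := exists_mem_sector hn (Metric.ball_subset_closedBall hz)
    refine ⟨D.strandOf ⟨v, j⟩, (hD.mem_zigzag_iff h0).2 ⟨j, rfl, Or.inl (zero_mem_spoke _ _)⟩, ?_⟩
    rcases mem_innerSector_or_spoke hn hj with hj | hj
    · obtain ⟨A, B, h⟩ := hc (D.strandOf ⟨v, j⟩)
      exact Or.inl ((hD.mem_zigzagDomain_white h hw rfl hz).2 ⟨j, rfl, hj⟩)
    · exact Or.inr ((hD.mem_zigzag_iff hz).2 ⟨j, rfl, hj⟩)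
  · rintro _ ⟨z, hz, rfl⟩ γ γ' hne h1 h2 h3 h4
    have key : ∀ g g' : D.Strand, g ≠ g' → D.disk v 0 ∈ D.zigzag g → D.disk v 0 ∈ D.zigzag g' →
        D.disk v z ∈ D.zigzagDomain g → D.disk v z ∉ D.face g' := by
      intro g g' hne hg hg' hz1 hz2
      obtain ⟨i, hi, -⟩ := (hD.mem_zigzag_iff h0).1 hg
      obtain ⟨i', hi', -⟩ := (hD.mem_zigzag_iff h0).1 hg'
      obtain ⟨A, B, h⟩ := hc g
      obtain ⟨A', B', h'⟩ := hc g'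
      obtain ⟨j, rfl, hzj⟩ := (hD.mem_zigzagDomain_white h hw hi hz).1 hz1
      rcases hz2 with hz2 | hz2
      · obtain ⟨j', rfl, hzj'⟩ := (hD.mem_zigzagDomain_white h' hw hi' hz).1 hz2
        exact hne (by rw [innerSector_inter_sector hn hzj (innerSector_subset_sector _ _ hzj')])
      · obtain ⟨j', -, hzj' | hzj'⟩ := (hD.mem_zigzag_iff hz).1 hz2
        · exact innerSector_disjoint_spoke hn hzj hzj'
        · exact innerSector_disjoint_spoke hn hzj hzj'
    refine ⟨h3.resolve_left fun h5 => key γ γ' hne h1 h2 h5 h4,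
      h4.resolve_left fun h5 => key γ' γ hne.symm h2 h1 h5 h3⟩

/-- The glued surface is a covering over the complement of the `•`-vertices. -/
theorem exists_hasSheets [LocallyConnectedSpace X] (hD : D.Tame) (hc : D.AllCut)
    (hs : D.BlackInjective) {x : X} (hx : ∀ v, D.black v → x ≠ D.disk v 0) :
    ∃ U, x ∈ U ∧ HasSheets.{w} D.gluedMap U := by
  by_cases hxG : x ∈ D.graph
  · rw [hD.graph_eq] at hxG
    obtain ⟨⟨v, k⟩, -, z, hz, rfl⟩ := hxG
    obtain ⟨r, hr, rfl⟩ := mem_spoke.1 hz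
    rcases hr.1.eq_or_lt with h0 | h0
    · rw [← h0, polar_zero] at hx ⊢
      exact hD.hasSheets_of_white hc fun hb => hx v hb rfl
    · exact hD.hasSheets_of_spoke hc hs ⟨h0, hr.2⟩
  · exact hD.hasSheets_of_notMem_graph hc hxG

/-! ### The ramification at the `•`-vertices -/

/-- The domain loses the closed sector at each passage of the strand; there is only one passage, and
the zig-zag path restores the two bounding spokes. -/
theorem mem_face_black (hD : D.Tame) (hc : D.AllCut) (hs : D.BlackInjective) {v : V}
    (hb : D.black v) {k : Fin (D.val v)} {z : ℂ} (hz : z ∈ Metric.ball (0 : ℂ) 1) :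
    D.disk v z ∈ D.face (D.strandOf ⟨v, k⟩) ↔ z ∉ innerSector (D.val v) k := by
  have hn := hD.val_pos v
  obtain ⟨A, B, h⟩ := hc (D.strandOf ⟨v, k⟩)
  rw [face, mem_union, hD.mem_zigzagDomain_black h hb rfl hz, hD.mem_zigzag_iff hz]
  constructor
  · rintro (h1 | ⟨j, -, h1 | h1⟩) hzk
    · exact h1 k rfl (innerSector_subset_sector _ _ hzk)
    · exact innerSector_disjoint_spoke hn hzk h1
    · exact innerSector_disjoint_spoke hn hzk h1
  · intro hzk
    by_cases hzs : z ∈ sector (D.val v) k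
    · exact Or.inr ⟨k, rfl, (mem_innerSector_or_spoke hn hzs).resolve_left hzk⟩
    · left
      intro j hj
      rwa [hs v hb j k hj]

theorem pow_mem_ball {z : ℂ} (hz : z ∈ Metric.ball (0 : ℂ) 1) {j : ℕ} (hj : j ≠ 0) :
    z ^ j ∈ Metric.ball (0 : ℂ) 1 := by
  rw [mem_ball_zero_iff] at hz ⊢
  rw [norm_pow]
  exact pow_lt_one₀ (norm_nonneg _) hz hj

theorem mem_ball_of_pow {z : ℂ} {j : ℕ} (hz : z ^ j ∈ Metric.ball (0 : ℂ) 1) :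
    z ∈ Metric.ball (0 : ℂ) 1 := by
  rw [mem_ball_zero_iff, norm_pow] at hz
  rw [mem_ball_zero_iff]
  by_contra h
  exact absurd hz (not_lt.2 (one_le_pow₀ (not_lt.1 h)))

/-- Near a `•`-vertex of valency `n`, the glued surface is a disc on which the map to the surface
is `z ↦ z ^ (n - 1)`. -/
theorem exists_ramified_chart (hD : D.Tame) (hc : D.AllCut) (hs : D.BlackInjective) {v : V}
    (hb : D.black v) (hv : D.disk v 0 ∈ D.graph) :
    ∃ ψ : Metric.ball (0 : ℂ) 1 → D.Glued, Continuous ψ ∧ Function.Injective ψ ∧ IsOpenMap ψ ∧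
      (∀ y, D.gluedMap (ψ y) = D.disk v (y.1 ^ (D.val v - 1))) ∧
      ψ ⟨0, Metric.mem_ball_self one_pos⟩ = D.mkGraph ⟨D.disk v 0, hv⟩ := by
  have hn2 := hD.two_le_val v
  have hn := hD.val_pos v
  have hn1 : D.val v - 1 ≠ 0 := by omega
  -- The power map carries the sector `m` onto the disc without the open sector `opp m`, which is
  -- the piece of the corner `opp m`.
  let opp : Fin (D.val v) → Fin (D.val v) := fun m => ⟨D.val v - 1 - m, by omega⟩
  have hopp : ∀ m, opp (opp m) = m := fun m => by
    apply Fin.ext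
    change D.val v - 1 - (D.val v - 1 - m) = m
    omega
  have hopp_inj : Function.Injective opp := Function.LeftInverse.injective hopp
  let f : ℂ → X := fun z => D.disk v (z ^ (D.val v - 1))
  have hmaps : MapsTo (fun z : ℂ => z ^ (D.val v - 1)) (Metric.closedBall 0 1)
      (Metric.closedBall 0 1) := by
    intro z hz
    rw [mem_closedBall_zero_iff] at hz ⊢
    rw [norm_pow]
    exact pow_le_one₀ (norm_nonneg _) hz
  have hfc : ContinuousOn f (Metric.closedBall 0 1) :=
    (hD.continuousOn v).comp (continuous_pow _).continuousOn hmaps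
  have hfi : ∀ m, InjOn f (sector (D.val v) m) := fun m z hz z' hz' h =>
    pow_injOn_sector hn2 hz hz' (hD.injOn v (hmaps (sector_subset _ _ hz))
      (hmaps (sector_subset _ _ hz')) h)
  have hzz : ∀ (m : Fin (D.val v)) (z : ℂ), z ∈ Metric.ball (0 : ℂ) 1 →
      (f z ∈ D.zigzag (D.strandOf ⟨v, opp m⟩) ↔ z ^ (D.val v - 1) ∈
        spoke (D.val v) (D.val v - 1 - m) ∪ spoke (D.val v) (D.val v - 1 - m + 1)) := by
    intro m z hz
    rw [hD.mem_zigzag_iff (pow_mem_ball hz hn1)]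
    constructor
    · rintro ⟨j, hj, h⟩
      rw [hs v hb _ _ hj] at h
      exact h
    · exact fun h => ⟨opp m, rfl, h⟩
  obtain ⟨ψ, h1, h2, h3, h4, h5⟩ := hD.exists_chart hc (Y := Metric.ball (0 : ℂ) 1)
    (ι := Fin (D.val v)) (C := fun m => Subtype.val ⁻¹' sector (D.val v) m)
    (fun m => (isCompact_sector _ _).isClosed.preimage continuous_subtype_val)
    (fun y => exists_mem_sector hn (Metric.ball_subset_closedBall y.2))
    (q := fun y => f y)
    (hfc.comp_continuous continuous_subtype_val fun y => Metric.ball_subset_closedBall y.2)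
    (γ := fun m => D.strandOf ⟨v, opp m⟩) (fun m m' h => hopp_inj (hs v hb _ _ h))
    (hD.isOpen_domainAt v)
    (fun m => by
      ext x
      constructor
      · rintro ⟨y, hy, rfl⟩
        refine ⟨?_, _, pow_mem_ball y.2 hn1, rfl⟩
        exact (hD.mem_face_black hc hs hb (pow_mem_ball y.2 hn1)).2
          (pow_notMem_innerSector hn2 m.2 hy)
      · rintro ⟨hxF, w, hw, rfl⟩
        rw [hD.mem_face_black hc hs hb hw] at hxF
        obtain ⟨z, hz, hzw⟩ := exists_pow_eq hn2 m.2 (Metric.ball_subset_closedBall hw) hxF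
        exact ⟨⟨z, mem_ball_of_pow (hzw ▸ hw)⟩, hz, congrArg (D.disk v) hzw⟩)
    -- The power map is injective on the compact sector, so removing the compact image of the rest
    -- cuts out exactly the image of `W`.
    (fun m W hW => by
      obtain ⟨W', hW', rfl⟩ := isOpen_induced_iff.1 hW
      refine ⟨(f '' (sector (D.val v) m \ W'))ᶜ, ?_, ?_⟩
      · rw [isOpen_compl_iff]
        refine (((isCompact_sector _ _).diff hW').image_of_continuousOn (hfc.mono ?_)).isClosed
        exact sdiff_subset.trans (sector_subset _ _)
      · ext x
        constructor
        · rintro ⟨y, ⟨hy, hyW⟩, rfl⟩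
          refine ⟨⟨y, hy, rfl⟩, ?_⟩
          rintro ⟨z, ⟨hz, hzW⟩, he⟩
          exact hzW (hfi m hz hy he ▸ hyW)
        · rintro ⟨⟨y, hy, rfl⟩, hyO⟩
          exact ⟨y, ⟨hy, by_contra fun h => hyO ⟨y, ⟨hy, h⟩, rfl⟩⟩, rfl⟩)
    (fun m y hy y' hy' h => Subtype.ext (hfi m hy hy' h))
    (fun m m' hmm y hy hy' => by
      have key : ∀ a b : Fin (D.val v), a ≠ b → y.1 ∈ sector (D.val v) a →
          y.1 ∈ sector (D.val v) b → f y ∈ D.zigzag (D.strandOf ⟨v, opp a⟩) := by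
        intro a b hab ha hb'
        refine (hzz a y y.2).2 (pow_mem_spoke hn2 a.2 ?_)
        exact (mem_innerSector_or_spoke hn ha).resolve_left fun h =>
          hab (innerSector_inter_sector hn h hb')
      exact ⟨key m m' hmm hy hy', key m' m hmm.symm hy' hy⟩)
    -- Points over the bounding zig-zag paths lie on spokes of the source, where the power map is
    -- injective; so gluing in the surface adds no identification beyond the adjacency of sectors.
    (fun m m' hmm y hy y' hy' he hz hz' => by
      have hz2 := (hzz m y y.2).1 hz
      have hz2' := (hzz m' y' y'.2).1 (he ▸ hz')
      obtain ⟨j, r, hr, hj⟩ := exists_nat_of_pow_mem_spoke hn2 m.2 hy hz2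
      obtain ⟨j', r', hr', hj'⟩ := exists_nat_of_pow_mem_spoke hn2 m'.2 hy' hz2'
      have hpow : y.1 ^ (D.val v - 1) = y'.1 ^ (D.val v - 1) :=
        hD.injOn v (hmaps (Metric.ball_subset_closedBall y.2))
          (hmaps (Metric.ball_subset_closedBall y'.2)) he
      apply Subtype.ext
      rw [hj, hj'] at hpow ⊢
      exact eq_of_pow_eq_on_spokes hn2 hr hr' hpow)
    (fun γ' hγ' x hx hxU => by
      obtain ⟨z, hz, rfl⟩ := hxU
      obtain ⟨j, hj, -⟩ := (hD.mem_zigzag_iff hz).1 hx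
      exact hγ' (opp j) (by rw [hopp, hj]))
  refine ⟨ψ, h1, h2, h3, h4, ?_⟩
  have h0 : (0 : ℂ) ∈ Metric.ball (0 : ℂ) 1 := Metric.mem_ball_self one_pos
  have hf0 : f 0 = D.disk v 0 := by
    change D.disk v (0 ^ _) = _
    rw [zero_pow hn1]
  have hz : D.disk v 0 ∈ D.zigzag (D.strandOf ⟨v, opp ⟨0, hn⟩⟩) :=
    (hD.mem_zigzag_iff h0).2 ⟨_, rfl, Or.inl (zero_mem_spoke _ _)⟩
  rw [h5 ⟨0, hn⟩ ⟨0, h0⟩ (spoke_left_subset_sector hn _ (zero_mem_spoke _ _))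
    (Or.inr (hf0.symm ▸ hz))]
  exact (mkGraph_eq_mkFace hf0.symm hz).symm

end Tame
end WebData
end SpectralWeb
end

noncomputable section
namespace SpectralWeb
universe w
variable {V : Type w} {X S : Type*}

/-! ### Webs are tame -/

theorem polar_add_eq (n k : ℕ) (ρ t : ℝ) :
    polar n ρ (k + t) = tip n k * polar n ρ t := by
  rw [tip_eq_polar, polar, polar, polar, Complex.ofReal_one, one_mul, mul_left_comm,
    ← Complex.exp_add]
  congr 2
  push_cast
  ring

theorem polar_im (n : ℕ) (ρ t : ℝ) : (polar n ρ t).im = ρ * Real.sin (2 * Real.pi * t / n) := by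
  rw [polar, Complex.im_ofReal_mul, Complex.exp_ofReal_mul_I_im]

theorem polar_im_pos {n : ℕ} (hn : 2 ≤ n) {ρ t : ℝ} (hρ : 0 < ρ) (ht : t ∈ Ioo (0 : ℝ) 1) :
    0 < (polar n ρ t).im := by
  rw [polar_im]
  have hn' : (2 : ℝ) ≤ n := by exact_mod_cast hn
  have := Real.pi_pos
  refine mul_pos hρ (Real.sin_pos_of_pos_of_lt_pi ?_ ?_)
  · have := ht.1
    positivity
  · rw [div_lt_iff₀ (by linarith)]
    nlinarith [ht.2]

theorem polar_neg_im (n : ℕ) (ρ t : ℝ) : (polar n ρ (-t)).im = -(polar n ρ t).im := by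
  rw [polar_im, polar_im, mul_neg, neg_div, Real.sin_neg, mul_neg]

theorem continuous_polar (n : ℕ) : Continuous fun q : ℝ × ℝ => polar n q.1 q.2 := by
  unfold polar
  fun_prop

theorem tip_mul_real_mem_spoke {n k : ℕ} {s : ℝ} (hs : s ∈ Icc (0 : ℝ) 1) :
    tip n k * (s : ℂ) ∈ spoke n k := ⟨s, hs, mul_comm _ _⟩

namespace WebData
variable [TopologicalSpace X] {D : WebData V X}

namespace Regular
variable [T2Space X]

/-- This is continuity of the inverse of the parametrisation: the part of the closed disc away from
`z₀` is compact, with closed image missing the point. -/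
theorem eventually_norm_sub_lt (hD : D.Regular) {v : V} {z₀ : ℂ}
    (hz₀ : z₀ ∈ Metric.closedBall (0 : ℂ) 1) {ε : ℝ} (hε : 0 < ε) :
    ∀ᶠ x in 𝓝 (D.disk v z₀), ∀ z ∈ Metric.closedBall (0 : ℂ) 1, D.disk v z = x → ‖z - z₀‖ < ε := by
  have hc := hD.isClosed_image (v := v) (K := Metric.closedBall 0 1 \ Metric.ball z₀ ε) sdiff_subset
    ((isCompact_closedBall 0 1).diff Metric.isOpen_ball)
  have hn : D.disk v z₀ ∉ D.disk v '' (Metric.closedBall 0 1 \ Metric.ball z₀ ε) := by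
    rintro ⟨z, ⟨hz, hz'⟩, he⟩
    rw [hD.injOn v hz hz₀ he] at hz'
    exact hz' (Metric.mem_ball_self hε)
  filter_upwards [hc.isOpen_compl.mem_nhds hn] with x hx z hz he
  rw [← dist_eq_norm]
  exact not_not.1 fun h => hx ⟨z, ⟨hz, h⟩, he⟩

theorem isOpen_image_disk (hD : D.Regular) {v : V} {W : Set ℂ} (hW : IsOpen W)
    (hs : W ⊆ Metric.ball 0 1) : IsOpen (D.disk v '' W) := by
  have hc := hD.isClosed_image (v := v) (K := Metric.closedBall 0 1 \ W) sdiff_subset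
    ((isCompact_closedBall 0 1).diff hW)
  convert (hD.isOpen_domainAt v).sdiff hc using 1
  ext x
  constructor
  · rintro ⟨z, hz, rfl⟩
    refine ⟨⟨z, hs hz, rfl⟩, ?_⟩
    rintro ⟨z', ⟨hz', hzW⟩, he⟩
    rw [hD.injOn v hz' (Metric.ball_subset_closedBall (hs hz)) he] at hzW
    exact hzW hz
  · rintro ⟨⟨z, hz, rfl⟩, hx⟩
    exact ⟨z, by_contra fun h => hx ⟨z, ⟨Metric.ball_subset_closedBall hz, h⟩, rfl⟩, rfl⟩

/-- Near a point, the graph consists of the spokes through this point. -/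
theorem eventually_mem_spoke (hD : D.Regular) (x : X) : ∀ᶠ y in 𝓝 x, y ∈ D.graph →
    ∃ u, ∃ j : Fin (D.val u), x ∈ D.disk u '' spoke (D.val u) j ∧
      y ∈ D.disk u '' spoke (D.val u) j := by
  filter_upwards [(hD.locallyFinite_image (fun c => spoke (D.val c.1) c.2)
    fun c => spoke_subset _ _).iInter_compl_mem_nhds
      (fun c => hD.isClosed_image (spoke_subset _ _) (isCompact_spoke _ _)) x] with y hy hyG
  rw [hD.graph_eq] at hyG
  obtain ⟨⟨u, j⟩, -, hyc⟩ := hyG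
  exact ⟨u, j, by_contra fun h => mem_iInter₂.1 hy ⟨u, j⟩ h hyc, hyc⟩

/-- A chart in which the graph is a segment of the real line separates the two sides of a spoke. -/
theorem twoSided_of_chart (hD : D.Regular) {v : V} {k k' : Fin (D.val v)}
    (hk : (k' + 1 : ℕ) ≡ k [MOD D.val v]) {r : ℝ} (hr : r ∈ Ioc (0 : ℝ) 1) {H : Set ℂ}
    (hH : Convex ℝ H) {ε : ℝ} (hε : 0 < ε) {χ : ℂ → X}
    (h0 : (0 : ℂ) ∈ H) (hχ0 : χ 0 = D.disk v (polar (D.val v) r k))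
    (hχ : ContinuousOn χ (H ∩ Metric.ball 0 ε))
    (hnhds : ∀ δ, 0 < δ → δ ≤ ε →
      χ '' (H ∩ Metric.ball 0 δ) ∈ 𝓝 (D.disk v (polar (D.val v) r k)))
    (hG : ∀ ζ ∈ H ∩ Metric.ball 0 ε, χ ζ ∈ D.graph ↔ ζ.im = 0)
    (hdisk : ∀ ζ ∈ Metric.ball (0 : ℂ) ε, ‖r + ζ‖ < 1 →
      ζ ∈ H ∧ χ ζ = D.disk v (tip (D.val v) k * (r + ζ)))
    {N : Set X} (hN : N ∈ 𝓝 (D.disk v (polar (D.val v) r k))) :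
    ∃ P Q : Set X, IsPreconnected P ∧ IsPreconnected Q ∧
      P ⊆ N \ D.graph ∧ Q ⊆ N \ D.graph ∧ P ∪ Q ∪ D.graph ∈ 𝓝 (D.disk v (polar (D.val v) r k)) ∧
      (P ∩ D.disk v '' (innerSector (D.val v) k ∩ Metric.ball 0 1)).Nonempty ∧
      (Q ∩ D.disk v '' (innerSector (D.val v) k' ∩ Metric.ball 0 1)).Nonempty := by
  have hn := hD.val_pos v
  have h0b : (0 : ℂ) ∈ H ∩ Metric.ball 0 ε := ⟨h0, Metric.mem_ball_self hε⟩
  have hNχ : χ ⁻¹' N ∈ 𝓝[H ∩ Metric.ball 0 ε] 0 := hχ 0 h0b (hχ0 ▸ hN)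
  obtain ⟨δ₁, hδ₁, hδN⟩ := Metric.mem_nhdsWithin_iff.1 hNχ
  set δ := min δ₁ ε with hδdef
  have hδ : 0 < δ := lt_min hδ₁ hε
  have hsubε : H ∩ Metric.ball 0 δ ⊆ H ∩ Metric.ball 0 ε :=
    inter_subset_inter_right _ (Metric.ball_subset_ball (min_le_right _ _))
  have hsubN : ∀ ζ ∈ H ∩ Metric.ball 0 δ, χ ζ ∈ N := fun ζ hζ =>
    hδN ⟨Metric.ball_subset_ball (min_le_left _ _) hζ.2, hsubε hζ⟩
  have hconv := hH.inter (convex_ball (0 : ℂ) δ)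
  have hpos : Convex ℝ {ζ : ℂ | 0 < ζ.im} := convex_halfSpace_im_gt 0
  have hneg : Convex ℝ {ζ : ℂ | ζ.im < 0} := convex_halfSpace_im_lt 0
  -- Test points on the two sides have radius r(1 - t) and angle k ± t. Decreasing the radius keeps
  -- them in the open disc even when r = 1.
  have hlim : ∀ σ : ℝ, Tendsto (fun t : ℝ => polar (D.val v) (r * (1 - t)) (σ * t) - r)
      (𝓝[>] 0) (𝓝 0) := by
    intro σ
    have hc : Continuous fun t : ℝ => polar (D.val v) (r * (1 - t)) (σ * t) - r :=
      ((continuous_polar _).comp (by fun_prop : Continuous fun t : ℝ => (r * (1 - t), σ * t))).sub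
        continuous_const
    have := hc.tendsto 0
    have h2 : polar (D.val v) (r * (1 - 0)) (σ * 0) - r = 0 := by simp [polar]
    rw [h2] at this
    exact this.mono_left nhdsWithin_le_nhds
  have hpt : ∀ σ : ℝ, ∃ t ∈ Ioo (0 : ℝ) 1,
      polar (D.val v) (r * (1 - t)) (σ * t) - r ∈ H ∩ Metric.ball 0 δ ∧
      r * (1 - t) ∈ Ioo (0 : ℝ) 1 ∧
      χ (polar (D.val v) (r * (1 - t)) (σ * t) - r) =
        D.disk v (polar (D.val v) (r * (1 - t)) (k + σ * t)) := by
    intro σ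
    have h1 : ∀ᶠ t : ℝ in 𝓝[>] 0, t ∈ Ioo (0 : ℝ) 1 := Ioo_mem_nhdsGT one_pos
    obtain ⟨t, ht, htδ⟩ := (h1.and ((hlim σ).eventually (Metric.ball_mem_nhds 0 hδ))).exists
    have hr1 : r * (1 - t) ∈ Ioo (0 : ℝ) 1 := by
      constructor
      · exact mul_pos hr.1 (by linarith [ht.2])
      · nlinarith [hr.2, ht.1, hr.1]
    have hadd : (r : ℂ) + (polar (D.val v) (r * (1 - t)) (σ * t) - r) =
        polar (D.val v) (r * (1 - t)) (σ * t) := by ring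
    obtain ⟨h2, h3⟩ := hdisk (polar (D.val v) (r * (1 - t)) (σ * t) - r)
      (Metric.ball_subset_ball (min_le_right _ _) htδ) (by
        rw [hadd, norm_polar, abs_of_pos hr1.1]; exact hr1.2)
    refine ⟨t, ht, ⟨h2, htδ⟩, hr1, ?_⟩
    rw [h3, hadd, polar_add_eq]
  refine ⟨χ '' (H ∩ Metric.ball 0 δ ∩ {ζ | 0 < ζ.im}), χ '' (H ∩ Metric.ball 0 δ ∩ {ζ | ζ.im < 0}),
    (hconv.inter hpos).isPreconnected.image _ (hχ.mono (inter_subset_left.trans hsubε)),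
    (hconv.inter hneg).isPreconnected.image _ (hχ.mono (inter_subset_left.trans hsubε)),
    ?_, ?_, ?_, ?_, ?_⟩
  · rintro _ ⟨ζ, ⟨hζ, him⟩, rfl⟩
    exact ⟨hsubN ζ hζ, fun h => (ne_of_gt him) ((hG ζ (hsubε hζ)).1 h)⟩
  · rintro _ ⟨ζ, ⟨hζ, him⟩, rfl⟩
    exact ⟨hsubN ζ hζ, fun h => (ne_of_lt him) ((hG ζ (hsubε hζ)).1 h)⟩
  · refine mem_of_superset (hnhds δ hδ (min_le_right _ _)) ?_
    rintro _ ⟨ζ, hζ, rfl⟩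
    rcases lt_trichotomy ζ.im 0 with h | h | h
    · exact Or.inl (Or.inr ⟨ζ, ⟨hζ, h⟩, rfl⟩)
    · exact Or.inr ((hG ζ (hsubε hζ)).2 h)
    · exact Or.inl (Or.inl ⟨ζ, ⟨hζ, h⟩, rfl⟩)
  · obtain ⟨t, ht, hζ, hr1, he⟩ := hpt 1
    rw [one_mul] at hζ he
    refine ⟨_, ⟨_, ⟨hζ, ?_⟩, rfl⟩, ?_⟩
    · change 0 < Complex.im _
      rw [Complex.sub_im, Complex.ofReal_im, sub_zero]
      exact polar_im_pos (hD.two_le_val v) hr1.1 ht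
    · rw [he]
      refine ⟨_, ⟨(mem_innerSector hn).2 ⟨_, ⟨hr1.1, hr1.2.le⟩, k + t, ⟨?_, ?_⟩, rfl⟩, ?_⟩, rfl⟩
      · linarith [ht.1]
      · linarith [ht.2]
      · rw [mem_ball_zero_iff, norm_polar, abs_of_pos hr1.1]
        exact hr1.2
  · obtain ⟨t, ht, hζ, hr1, he⟩ := hpt (-1)
    rw [neg_one_mul] at hζ he
    refine ⟨_, ⟨_, ⟨hζ, ?_⟩, rfl⟩, ?_⟩
    · change Complex.im _ < 0
      rw [Complex.sub_im, Complex.ofReal_im, sub_zero, polar_neg_im]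
      exact neg_neg_of_pos (polar_im_pos (hD.two_le_val v) hr1.1 ht)
    · rw [he]
      -- Modulo n the angle k - t is k' + (1 - t), which lies in the preceding sector.
      obtain ⟨m, hm⟩ := Nat.modEq_iff_dvd.1 hk
      have hm' : ((k : ℕ) : ℝ) = k' + 1 + D.val v * m := by
        have : ((k : ℕ) : ℤ) = k' + 1 + D.val v * m := by push_cast at hm; linarith
        exact_mod_cast this
      rw [show (k : ℝ) + -t = (k' + (1 - t)) + D.val v * m by rw [hm']; ring, polar_add_int _ hn]
      refine ⟨_, ⟨(mem_innerSector hn).2 ⟨_, ⟨hr1.1, hr1.2.le⟩, _, ⟨?_, ?_⟩, rfl⟩, ?_⟩, rfl⟩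
      · linarith [ht.2]
      · linarith [ht.1]
      · rw [mem_ball_zero_iff, norm_polar, abs_of_pos hr1.1]
        exact hr1.2

end Regular

theorem IsWeb.regular [TopologicalSpace S] {O : OrientedSurface S} {D : WebData V S}
    (h : D.IsWeb O) : D.Regular :=
  ⟨h.two_le_val, h.continuousOn, h.injOn, h.isOpen_domainAt, h.locallyFinite, h.meet⟩

namespace Regular
variable [T2Space X]

/-- Inside the open domain the parametrisation itself, rotated so that the spoke becomes real, is
the required chart. -/
theorem twoSided_interior (hD : D.Regular) {v : V} {k k' : Fin (D.val v)}
    (hk : (k' + 1 : ℕ) ≡ k [MOD D.val v]) {r : ℝ} (hr : r ∈ Ioo (0 : ℝ) 1)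
    {N : Set X} (hN : N ∈ 𝓝 (D.disk v (polar (D.val v) r k))) :
    ∃ P Q : Set X, IsPreconnected P ∧ IsPreconnected Q ∧
      P ⊆ N \ D.graph ∧ Q ⊆ N \ D.graph ∧ P ∪ Q ∪ D.graph ∈ 𝓝 (D.disk v (polar (D.val v) r k)) ∧
      (P ∩ D.disk v '' (innerSector (D.val v) k ∩ Metric.ball 0 1)).Nonempty ∧
      (Q ∩ D.disk v '' (innerSector (D.val v) k' ∩ Metric.ball 0 1)).Nonempty := by
  have hn := hD.val_pos v
  have hpb : polar (D.val v) r k ∈ Metric.ball (0 : ℂ) 1 := by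
    rw [mem_ball_zero_iff, norm_polar, abs_of_pos hr.1]; exact hr.2
  have hpol : polar (D.val v) r k = tip (D.val v) k * (r + 0) := by
    rw [← mul_tip_eq_polar, add_zero, mul_comm]
  -- This radius keeps r + ζ within the unit disc and, for real ζ, between 0 and 1, away from the
  -- opposite ray.
  set ε₀ := min r (1 - r) with hε₀
  have hε₀pos : 0 < ε₀ := lt_min hr.1 (by linarith [hr.2])
  have hball : ∀ ζ ∈ Metric.ball (0 : ℂ) ε₀,
      tip (D.val v) k * (r + ζ) ∈ Metric.ball (0 : ℂ) 1 := by
    intro ζ hζ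
    rw [mem_ball_zero_iff] at hζ ⊢
    rw [norm_mul, norm_tip, one_mul]
    calc ‖(r : ℂ) + ζ‖ ≤ ‖(r : ℂ)‖ + ‖ζ‖ := norm_add_le _ _
      _ < r + (1 - r) := by
        rw [Complex.norm_real, Real.norm_eq_abs, abs_of_pos hr.1]
        linarith [min_le_right r (1 - r)]
      _ = 1 := by ring
  let χ : ℂ → X := fun ζ => D.disk v (tip (D.val v) k * (r + ζ))
  have hχ : ContinuousOn χ (Metric.ball 0 ε₀) :=
    ((hD.continuousOn v).mono Metric.ball_subset_closedBall).comp (by fun_prop) hball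
  have hχ0 : χ 0 = D.disk v (polar (D.val v) r k) := by rw [hpol]
  have hev : ∀ᶠ ζ in 𝓝 (0 : ℂ), χ ζ ∈ D.graph → ∃ u, ∃ j : Fin (D.val u),
      χ 0 ∈ D.disk u '' spoke (D.val u) j ∧ χ ζ ∈ D.disk u '' spoke (D.val u) j :=
    (hχ.continuousAt (Metric.ball_mem_nhds 0 hε₀pos)).eventually (hD.eventually_mem_spoke (χ 0))
  obtain ⟨ε₁, hε₁, hεG⟩ := Metric.eventually_nhds_iff_ball.1 hev
  set ε := min ε₀ ε₁ with hεdef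
  have hε : 0 < ε := lt_min hε₀pos hε₁
  have hsub : Metric.ball (0 : ℂ) ε ⊆ Metric.ball 0 ε₀ :=
    Metric.ball_subset_ball (min_le_left _ _)
  refine hD.twoSided_of_chart hk ⟨hr.1, hr.2.le⟩ convex_univ hε (χ := χ) (mem_univ _) hχ0
    (hχ.mono (inter_subset_right.trans hsub)) ?_ ?_ (fun ζ _ _ => ⟨mem_univ _, rfl⟩) hN
  · intro δ hδ hδε
    rw [univ_inter]
    have himg : χ '' Metric.ball 0 δ =
        D.disk v '' ((fun ζ : ℂ => tip (D.val v) k * (r + ζ)) '' Metric.ball 0 δ) := by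
      rw [image_image]
    rw [himg]
    refine (hD.isOpen_image_disk ?_ ?_).mem_nhds ?_
    · have : IsOpenMap fun ζ : ℂ => tip (D.val v) k * (r + ζ) :=
        (Homeomorph.mulLeft₀ _ (tip_ne_zero _ _)).isOpenMap.comp (Homeomorph.addLeft _).isOpenMap
      exact this _ Metric.isOpen_ball
    · rintro _ ⟨ζ, hζ, rfl⟩
      exact hball ζ (hsub (Metric.ball_subset_ball hδε hζ))
    · exact ⟨_, ⟨0, Metric.mem_ball_self hδ, rfl⟩, by rw [hpol]⟩
  · rintro ζ ⟨-, hζ⟩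
    have hζ0 := hball ζ (hsub hζ)
    constructor
    · intro h
      obtain ⟨u, j, ⟨z, hz, hzx⟩, ⟨z', hz', hzy⟩⟩ :=
        hεG ζ (Metric.ball_subset_ball (min_le_right _ _) hζ) h
      rw [hχ0] at hzx
      obtain ⟨rfl, rfl⟩ := hD.eq_of_disk_eq (Metric.ball_subset_closedBall hpb)
        (spoke_subset _ _ hz) (ne_tip_of_mem_ball hpb) hzx.symm
      have hjk := modEq_of_mem_spoke hn hr.1 hz
      rw [spoke_congr_mod hn hjk.symm] at hz'
      have hzz := hD.injOn u (spoke_subset _ _ hz') (Metric.ball_subset_closedBall hζ0) hzy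
      obtain ⟨s, -, rfl⟩ := hz'
      rw [mul_comm] at hzz
      have h2 := mul_left_cancel₀ (tip_ne_zero _ _) hzz
      have h3 := congrArg Complex.im h2
      simpa using h3.symm
    · intro him
      have hre : ζ = (ζ.re : ℂ) := Complex.ext rfl (by simp [him])
      have hζn : |ζ.re| < ε₀ := by
        have := hsub hζ
        rw [mem_ball_zero_iff] at this
        exact lt_of_le_of_lt (Complex.abs_re_le_norm ζ) this
      have h1 := abs_lt.1 hζn
      have h2 := min_le_left r (1 - r)
      have h3 := min_le_right r (1 - r)
      have : χ ζ = D.disk v (tip (D.val v) k * ((r + ζ.re : ℝ) : ℂ)) := by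
        change D.disk v (tip (D.val v) k * (r + ζ)) = _
        rw [Complex.ofReal_add, ← hre]
      rw [this]
      refine hD.spoke_subset_graph v k ⟨_, tip_mul_real_mem_spoke ⟨?_, ?_⟩, rfl⟩
      · linarith
      · linarith

/-- A point near a corner, inside the domain, has small coordinate in a chart at this corner. -/
theorem mem_spoke_chart {u : V} {l : Fin (D.val u)} {r₀ : ℝ} {σ : ℂ}
    (hσ : σ = 1 ∨ σ = -1) {H : Set ℂ} {χ : ℂ → X}
    (hinj : InjOn χ (H ∩ Metric.ball 0 r₀))
    (hdisk : ∀ ζ ∈ Metric.ball (0 : ℂ) r₀, ‖1 + σ * ζ‖ ≤ 1 →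
      ζ ∈ H ∧ χ ζ = D.disk u (tip (D.val u) l * (1 + σ * ζ)))
    {ζ : ℂ} (hζ : ζ ∈ H ∩ Metric.ball 0 r₀)
    (hnear : ∀ z ∈ Metric.closedBall (0 : ℂ) 1, D.disk u z = χ ζ → ‖z - tip (D.val u) l‖ < r₀)
    (hsp : χ ζ ∈ D.disk u '' spoke (D.val u) l) : ζ.im = 0 := by
  have hσσ : σ * σ = 1 := by rcases hσ with rfl | rfl <;> norm_num
  have hσn : ‖σ‖ = 1 := by rcases hσ with rfl | rfl <;> simp
  obtain ⟨z, hz, hzχ⟩ := hsp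
  have hzb := spoke_subset _ _ hz
  have h1 := hnear z hzb hzχ
  obtain ⟨s, hs, rfl⟩ := hz
  have he : (s : ℂ) * tip (D.val u) l - tip (D.val u) l = tip (D.val u) l * (s - 1) := by ring
  rw [he, norm_mul, norm_tip, one_mul] at h1
  -- The point of the spoke at radius s has the real coordinate σ(s - 1), for either of the two
  -- tangent discs.
  have h2 : (1 : ℂ) + σ * (σ * (s - 1)) = s := by rw [← mul_assoc, hσσ]; ring
  have hmem : σ * ((s : ℂ) - 1) ∈ Metric.ball (0 : ℂ) r₀ := by
    rw [mem_ball_zero_iff, norm_mul, hσn, one_mul]; exact h1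
  obtain ⟨h3, h4⟩ := hdisk _ hmem (by
    rw [h2, Complex.norm_real, Real.norm_eq_abs, abs_of_nonneg hs.1]; exact hs.2)
  rw [h2, mul_comm (tip _ _), hzχ] at h4
  have h5 := hinj ⟨h3, hmem⟩ hζ h4
  rw [← h5]
  rcases hσ with rfl | rfl <;> simp

theorem spoke_eq_of_tip_mem (hD : D.Regular) {u : V} {j l : Fin (D.val u)}
    (h : D.disk u (tip (D.val u) l) ∈ D.disk u '' spoke (D.val u) j) : j = l := by
  obtain ⟨z, hz, he⟩ := h
  have := hD.injOn u (spoke_subset _ _ hz) (tip_mem_closedBall _ _) he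
  rw [this, tip_eq_polar] at hz
  exact (fin_eq_of_modEq (modEq_of_mem_spoke (hD.val_pos u) one_pos hz)).symm

/-- The two sides of a corner, in a chart around it. The family `c` lists the domains at this
corner. -/
theorem twoSided_tip (hD : D.Regular) {v : V} {k k' : Fin (D.val v)}
    (hk : (k' + 1 : ℕ) ≡ k [MOD D.val v]) {H : Set ℂ} (hH : Convex ℝ H) (h0 : (0 : ℂ) ∈ H)
    {r₀ : ℝ} (hr₀ : 0 < r₀) {χ : ℂ → X} (hχ : ContinuousOn χ (H ∩ Metric.ball 0 r₀))
    (hinj : InjOn χ (H ∩ Metric.ball 0 r₀))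
    (hnhds : ∀ δ, 0 < δ → δ ≤ r₀ → χ '' (H ∩ Metric.ball 0 δ) ∈ 𝓝 (χ 0))
    (hdisk : ∀ ζ ∈ Metric.ball (0 : ℂ) r₀, ‖1 + ζ‖ ≤ 1 →
      ζ ∈ H ∧ χ ζ = D.disk v (tip (D.val v) k * (1 + ζ)))
    (hother : ∀ u, u ≠ v → D.disk v (tip (D.val v) k) ∈ D.closedDomainAt u →
      ∃ l : Fin (D.val u), D.disk u (tip (D.val u) l) = D.disk v (tip (D.val v) k) ∧
        ∀ ζ ∈ Metric.ball (0 : ℂ) r₀, ‖1 - ζ‖ ≤ 1 →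
          ζ ∈ H ∧ χ ζ = D.disk u (tip (D.val u) l * (1 - ζ)))
    (hreal : ∀ ζ ∈ H ∩ Metric.ball 0 r₀, 0 < ζ.re →
      ∃ u, ∃ l : Fin (D.val u), ‖1 - ζ‖ ≤ 1 → χ ζ = D.disk u (tip (D.val u) l * (1 - ζ)))
    {N : Set X} (hN : N ∈ 𝓝 (D.disk v (tip (D.val v) k))) :
    ∃ P Q : Set X, IsPreconnected P ∧ IsPreconnected Q ∧
      P ⊆ N \ D.graph ∧ Q ⊆ N \ D.graph ∧ P ∪ Q ∪ D.graph ∈ 𝓝 (D.disk v (tip (D.val v) k)) ∧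
      (P ∩ D.disk v '' (innerSector (D.val v) k ∩ Metric.ball 0 1)).Nonempty ∧
      (Q ∩ D.disk v '' (innerSector (D.val v) k' ∩ Metric.ball 0 1)).Nonempty := by
  have hχ0 : χ 0 = D.disk v (tip (D.val v) k) := by
    rw [(hdisk 0 (Metric.mem_ball_self hr₀) (by simp)).2, add_zero, mul_one]
  have hfin : Set.Finite {u | D.disk v (tip (D.val v) k) ∈ D.closedDomainAt u} :=
    hD.locallyFinite.point_finite _
  -- Only finitely many domains meet the corner, so one neighbourhood brings the disc coordinates of
  -- all of them into the range of the chart.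
  have hnear : ∀ᶠ y in 𝓝 (D.disk v (tip (D.val v) k)), ∀ u ∈
      {u | D.disk v (tip (D.val v) k) ∈ D.closedDomainAt u}, ∀ l : Fin (D.val u),
      D.disk u (tip (D.val u) l) = D.disk v (tip (D.val v) k) →
      ∀ z ∈ Metric.closedBall (0 : ℂ) 1, D.disk u z = y → ‖z - tip (D.val u) l‖ < r₀ := by
    rw [eventually_all_finite hfin]
    intro u _
    rw [eventually_all]
    intro l
    by_cases h : D.disk u (tip (D.val u) l) = D.disk v (tip (D.val v) k)
    · rw [← h]
      exact (hD.eventually_norm_sub_lt (tip_mem_closedBall _ _) hr₀).mono fun y hy _ => hy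
    · exact Eventually.of_forall fun y h' => absurd h' h
  have hT : Tendsto χ (𝓝[H ∩ Metric.ball 0 r₀] 0) (𝓝 (D.disk v (tip (D.val v) k))) := by
    rw [← hχ0]; exact hχ 0 ⟨h0, Metric.mem_ball_self hr₀⟩
  have hev := hT.eventually
    (hnear.and (hD.eventually_mem_spoke (D.disk v (tip (D.val v) k))))
  obtain ⟨ε₁, hε₁, hε⟩ := Metric.mem_nhdsWithin_iff.1 hev
  -- The bound 1 ensures that a real coordinate stays on the spoke and does not pass the centre of
  -- the disc.
  set ε := min (min r₀ 1) ε₁ with hεdef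
  have hεpos : 0 < ε := lt_min (lt_min hr₀ one_pos) hε₁
  have hεr : ε ≤ r₀ := (min_le_left _ _).trans (min_le_left _ _)
  have hε1 : ε ≤ 1 := (min_le_left _ _).trans (min_le_right _ _)
  have hpol : polar (D.val v) 1 k = tip (D.val v) k := (tip_eq_polar _ _).symm
  have hsub : H ∩ Metric.ball 0 ε ⊆ H ∩ Metric.ball 0 r₀ :=
    inter_subset_inter_right _ (Metric.ball_subset_ball hεr)
  have key := hD.twoSided_of_chart hk (r := 1) ⟨one_pos, le_rfl⟩ hH hεpos (χ := χ) (N := N) h0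
    (by rw [hpol, hχ0]) (hχ.mono hsub)
    (fun δ hδ hδε => by rw [hpol, ← hχ0]; exact hnhds δ hδ (hδε.trans hεr)) ?_ ?_ (by rwa [hpol])
  · rwa [hpol] at key
  · intro ζ hζ
    have hζ' := hsub hζ
    constructor
    · intro h
      obtain ⟨h1, h2⟩ := hε ⟨Metric.ball_subset_ball (min_le_right _ _) hζ.2, hζ'⟩
      obtain ⟨u, j, hxj, hyj⟩ := h2 h
      have hxu : D.disk v (tip (D.val v) k) ∈ D.closedDomainAt u :=
        image_mono (spoke_subset _ _) hxj
      by_cases huv : u = v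
      · subst huv
        have hjk := hD.spoke_eq_of_tip_mem hxj
        subst hjk
        exact mem_spoke_chart (σ := 1) (Or.inl rfl) hinj (by simpa using hdisk) hζ'
          (h1 u hxu j rfl) hyj
      · obtain ⟨l, hl, hl'⟩ := hother u huv hxu
        rw [← hl] at hxj
        have hjl := hD.spoke_eq_of_tip_mem hxj
        subst hjl
        exact mem_spoke_chart (σ := -1) (Or.inr rfl) hinj
          (by simpa [← sub_eq_add_neg] using hl') hζ' (h1 u hxu j hl) hyj
    · intro him
      have hre : ζ = (ζ.re : ℂ) := Complex.ext rfl (by simp [him])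
      have hζn : |ζ.re| < ε := lt_of_le_of_lt (Complex.abs_re_le_norm ζ)
        (mem_ball_zero_iff.1 hζ.2)
      have h1 := abs_lt.1 hζn
      rcases le_or_gt ζ.re 0 with hneg | hpos
      · have h2 : (1 : ℂ) + ζ = ((1 + ζ.re : ℝ) : ℂ) := by
          rw [Complex.ofReal_add, ← hre, Complex.ofReal_one]
        have h3 : (1 + ζ.re) ∈ Icc (0 : ℝ) 1 := ⟨by linarith, by linarith⟩
        rw [(hdisk ζ hζ'.2 (by
          rw [h2, Complex.norm_real, Real.norm_eq_abs, abs_of_nonneg h3.1]; exact h3.2)).2, h2]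
        exact hD.spoke_subset_graph v k ⟨_, tip_mul_real_mem_spoke h3, rfl⟩
      · obtain ⟨u, l, hul⟩ := hreal ζ hζ' hpos
        have h2 : (1 : ℂ) - ζ = ((1 - ζ.re : ℝ) : ℂ) := by
          rw [Complex.ofReal_sub, ← hre, Complex.ofReal_one]
        have h3 : (1 - ζ.re) ∈ Icc (0 : ℝ) 1 := ⟨by linarith, by linarith⟩
        rw [hul (by
          rw [h2, Complex.norm_real, Real.norm_eq_abs, abs_of_nonneg h3.1]; exact h3.2), h2]
        exact hD.spoke_subset_graph u l ⟨_, tip_mul_real_mem_spoke h3, rfl⟩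
  · intro ζ hζ hn
    rw [Complex.ofReal_one] at hn ⊢
    exact hdisk ζ (Metric.ball_subset_ball hεr hζ) hn.le

end Regular

/-- Inner points of a spoke are handled by its own domain, tips by the two models of generic
position. In both models the graph is the part of the real axis inside the chart. -/
theorem IsWeb.tame [TopologicalSpace S] [T2Space S] {O : OrientedSurface S} {D : WebData V S}
    (h : D.IsWeb O) : D.Tame := by
  refine ⟨h.regular, fun v k k' hk r hr N hN => ?_⟩
  rcases hr.2.eq_or_lt with rfl | hr1
  swap
  · exact h.regular.twoSided_interior hk ⟨hr.1, hr1⟩ hN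
  have hpol : polar (D.val v) 1 k = tip (D.val v) k := (tip_eq_polar _ _).symm
  rw [hpol] at hN ⊢
  rcases h.corner v k with ⟨u, l, hb, r₀, hr₀, χ, hχs, hχv, hχu⟩ | ⟨-, hno, r₀, hr₀, χ, hχs, hχv⟩
  · have hu0 : χ 0 = D.disk u (tip (D.val u) l) := by
      rw [hχu 0 (hχs ▸ Metric.mem_ball_self hr₀) (by simp), sub_zero, mul_one]
    have hv0 : χ 0 = D.disk v (tip (D.val v) k) := by
      rw [hχv 0 (hχs ▸ Metric.mem_ball_self hr₀) (by simp), add_zero, mul_one]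
    refine h.regular.twoSided_tip hk (H := univ) convex_univ (mem_univ _) hr₀ (χ := χ) ?_ ?_ ?_ ?_ ?_
      ?_ hN
    · rw [univ_inter, ← hχs]; exact χ.continuousOn
    · rw [univ_inter, ← hχs]; exact χ.injOn
    · intro δ hδ hδr
      rw [univ_inter]
      have hsub : Metric.ball (0 : ℂ) δ ⊆ χ.source := hχs ▸ Metric.ball_subset_ball hδr
      exact (χ.isOpen_image_of_subset_source Metric.isOpen_ball hsub).mem_nhds
        ⟨0, Metric.mem_ball_self hδ, rfl⟩
    · exact fun ζ hζ hn => ⟨mem_univ _, hχv ζ (hχs ▸ hζ) hn⟩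
    · intro u' hu' hx
      obtain ⟨z, hz, hzx⟩ := hx
      have hb' := (h.meet u' v hu' z hz _ (tip_mem_closedBall _ _) hzx).1
      -- Three distinct domains at one point would need three pairwise different colours.
      have huu : u' = u := by
        by_contra hne
        have hb'' := (h.meet u' u hne z hz _ (tip_mem_closedBall _ _)
          (hzx.trans (hv0.symm.trans hu0))).1
        tauto
      subst huu
      exact ⟨l, hu0.symm.trans hv0, fun ζ hζ hn => ⟨mem_univ _, hχu ζ (hχs ▸ hζ) hn⟩⟩
    · exact fun ζ hζ _ => ⟨u, l, fun hn => hχu ζ (hχs ▸ hζ.2) hn⟩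
  · let H : Set ℂ := {ζ | ζ.re ≤ 0}
    -- The retraction to the half plane turns the boundary chart into a map defined on all of ℂ, as
    -- `twoSided_tip` expects.
    let τ : ℂ → HalfPlane := fun ζ => ⟨⟨min ζ.re 0, ζ.im⟩, min_le_right _ _⟩
    have hτ : Continuous τ := by
      refine Continuous.subtype_mk ?_ _
      have : (fun ζ : ℂ => (⟨min ζ.re 0, ζ.im⟩ : ℂ)) =
          fun ζ => ((min ζ.re 0 : ℝ) : ℂ) + (ζ.im : ℂ) * Complex.I := by
        ext ζ
        exact Complex.mk_eq_add_mul_I _ _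
      rw [this]
      fun_prop
    have hτH : ∀ ζ ∈ H, (τ ζ).1 = ζ := fun ζ hζ =>
      Complex.ext (min_eq_left hζ) rfl
    have hτs : ∀ ζ ∈ H ∩ Metric.ball 0 r₀, τ ζ ∈ χ.source := by
      rintro ζ ⟨h1, h2⟩
      rw [hχs]
      change ‖(τ ζ).1‖ < r₀
      rw [hτH ζ h1]
      exact mem_ball_zero_iff.1 h2
    have hre : ∀ ζ : ℂ, ‖1 + ζ‖ ≤ 1 → ζ ∈ H := by
      intro ζ hζ
      have := (Complex.re_le_norm (1 + ζ)).trans hζ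
      rw [Complex.add_re, Complex.one_re] at this
      change ζ.re ≤ 0
      linarith
    have h0H : (0 : ℂ) ∈ H := le_refl (0 : ℝ)
    have hdisk : ∀ ζ ∈ Metric.ball (0 : ℂ) r₀, ‖1 + ζ‖ ≤ 1 →
        ζ ∈ H ∧ χ (τ ζ) = D.disk v (tip (D.val v) k * (1 + ζ)) := by
      intro ζ hζ hn
      have hζH := hre ζ hn
      refine ⟨hζH, ?_⟩
      have := hχv (τ ζ) (hτs ζ ⟨hζH, hζ⟩)
      rw [hτH ζ hζH] at this
      exact this hn
    refine h.regular.twoSided_tip hk (H := H) (convex_halfSpace_re_le 0) h0H hr₀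
      (χ := fun ζ => χ (τ ζ)) ?_ ?_ ?_ hdisk ?_ ?_ hN
    · exact χ.continuousOn.comp hτ.continuousOn hτs
    · intro ζ hζ ζ' hζ' he
      have := congrArg Subtype.val (χ.injOn (hτs ζ hζ) (hτs ζ' hζ') he)
      rwa [hτH ζ hζ.1, hτH ζ' hζ'.1] at this
    · intro δ hδ hδr
      have himg : (fun ζ => χ (τ ζ)) '' (H ∩ Metric.ball 0 δ) = χ '' {ζ | ‖ζ.1‖ < δ} := by
        ext y
        constructor
        · rintro ⟨ζ, hζ, rfl⟩
          refine ⟨τ ζ, ?_, rfl⟩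
          change ‖(τ ζ).1‖ < δ
          rw [hτH ζ hζ.1]
          exact mem_ball_zero_iff.1 hζ.2
        · rintro ⟨ζ, hζ, rfl⟩
          refine ⟨ζ.1, ⟨ζ.2, mem_ball_zero_iff.2 hζ⟩, ?_⟩
          exact congrArg χ (Subtype.ext (hτH ζ.1 ζ.2))
      rw [himg]
      refine (χ.isOpen_image_of_subset_source ?_ ?_).mem_nhds ⟨τ 0, ?_, rfl⟩
      · exact isOpen_lt (by fun_prop) continuous_const
      · intro ζ hζ
        rw [hχs]
        exact lt_of_lt_of_le hζ hδr
      · change ‖(τ 0).1‖ < δ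
        rw [hτH 0 h0H, norm_zero]
        exact hδ
    · exact fun u hu hx => absurd hx (hno u hu)
    · exact fun ζ hζ hp => absurd hζ.1 (not_le.2 hp)

end WebData
end SpectralWeb
end

noncomputable section
namespace SpectralWeb
universe w
variable {V : Type w} {S T : Type*}

/-! ### The preimage of a web on the universal cover -/

/-- The radial retraction of the plane to the closed unit disc. -/
def discRetraction (z : ℂ) : ℂ := (max 1 ‖z‖)⁻¹ • z

theorem continuous_discRetraction : Continuous discRetraction := by
  unfold discRetraction
  refine ((continuous_const.max continuous_norm).inv₀ fun z => ?_).smul continuous_id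
  exact (lt_of_lt_of_le one_pos (le_max_left _ _)).ne'

theorem discRetraction_mem (z : ℂ) : discRetraction z ∈ Metric.closedBall (0 : ℂ) 1 := by
  have h : 0 < max 1 ‖z‖ := lt_of_lt_of_le one_pos (le_max_left _ _)
  rw [mem_closedBall_zero_iff, discRetraction, norm_smul, norm_inv, Real.norm_eq_abs,
    abs_of_pos h, inv_mul_le_one₀ h]
  exact le_max_right _ _

theorem discRetraction_eq {z : ℂ} (hz : z ∈ Metric.closedBall (0 : ℂ) 1) :
    discRetraction z = z := by
  rw [mem_closedBall_zero_iff] at hz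
  rw [discRetraction, max_eq_left hz, inv_one, one_smul]

namespace WebData
variable [TopologicalSpace S] [TopologicalSpace T] {D : WebData V S} {p : T → S}

theorem t2Space_of_covering [T2Space S] (hp : IsCoveringMap p) : T2Space T := by
  refine ⟨fun x y hxy => ?_⟩
  by_cases h : p x = p y
  · exact hp.isSeparatedMap x y h hxy
  · obtain ⟨U, U', hU, hU', hx, hy, hd⟩ := t2_separation h
    exact ⟨_, _, hU.preimage hp.continuous, hU'.preimage hp.continuous, hx, hy, hd.preimage p⟩

namespace Regular

/-- The radial retraction extends the disc map to the simply connected plane, where the lifting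
criterion applies. The base point `z₀` is arbitrary, so that discs can be lifted through any of
their points. -/
theorem exists_disk_lift (hD : D.Regular) (hp : IsCoveringMap p) {v : V} {z₀ : ℂ}
    (hz₀ : z₀ ∈ Metric.closedBall (0 : ℂ) 1) {x : T} (hx : p x = D.disk v z₀) :
    ∃ f : ℂ → T, ContinuousOn f (Metric.closedBall 0 1) ∧ f z₀ = x ∧
      ∀ z ∈ Metric.closedBall (0 : ℂ) 1, p (f z) = D.disk v z := by
  have hc : Continuous fun z => D.disk v (discRetraction z) :=
    (hD.continuousOn v).comp_continuous continuous_discRetraction discRetraction_mem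
  obtain ⟨F, ⟨hF0, hF⟩, -⟩ := hp.existsUnique_continuousMap_lifts
    (⟨fun z => D.disk v (discRetraction z), hc⟩ : C(ℂ, S)) z₀ x
    (by rw [hx]; exact congrArg _ (discRetraction_eq hz₀).symm)
  refine ⟨F, F.continuous.continuousOn, hF0, fun z hz => ?_⟩
  have := congrFun hF z
  rw [Function.comp_apply] at this
  rw [this]
  exact congrArg _ (discRetraction_eq hz)

theorem disk_lift_unique (hp : IsCoveringMap p) {v : V} {f g : ℂ → T}
    (hf : ContinuousOn f (Metric.closedBall 0 1)) (hg : ContinuousOn g (Metric.closedBall 0 1))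
    (hpf : ∀ z ∈ Metric.closedBall (0 : ℂ) 1, p (f z) = D.disk v z)
    (hpg : ∀ z ∈ Metric.closedBall (0 : ℂ) 1, p (g z) = D.disk v z) {z₀ : ℂ}
    (hz₀ : z₀ ∈ Metric.closedBall (0 : ℂ) 1) (h : f z₀ = g z₀) :
    EqOn f g (Metric.closedBall 0 1) :=
  hp.eqOn_of_comp_eqOn (convex_closedBall 0 1).isPreconnected hf hg
    (fun z hz => (hpf z hz).trans (hpg z hz).symm) hz₀ h

theorem isDiskLift (hD : D.Regular) (hp : IsCoveringMap p) (v : D.LiftVertex p) :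
    D.IsDiskLift p v.1 v.2.1 ((D.lift p).disk v) := by
  have h : ∃ f, D.IsDiskLift p v.1 v.2.1 f :=
    hD.exists_disk_lift hp (Metric.mem_closedBall_self zero_le_one) v.2.2
  simp only [lift, dif_pos h]
  exact h.choose_spec

theorem proj_lift_disk (hD : D.Regular) (hp : IsCoveringMap p) (v : D.LiftVertex p) {z : ℂ}
    (hz : z ∈ Metric.closedBall (0 : ℂ) 1) : p ((D.lift p).disk v z) = D.disk v.1 z :=
  (hD.isDiskLift hp v).2.2 z hz

theorem exists_liftVertex (hD : D.Regular) (hp : IsCoveringMap p) {v : V} {z₀ : ℂ}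
    (hz₀ : z₀ ∈ Metric.closedBall (0 : ℂ) 1) {x : T} (hx : p x = D.disk v z₀) :
    ∃ y, ∃ hy : p y = D.disk v 0, (D.lift p).disk ⟨v, y, hy⟩ z₀ = x := by
  obtain ⟨f, hf, hf0, hpf⟩ := hD.exists_disk_lift hp hz₀ hx
  have h0 : (0 : ℂ) ∈ Metric.closedBall (0 : ℂ) 1 := Metric.mem_closedBall_self zero_le_one
  refine ⟨f 0, hpf 0 h0, ?_⟩
  have h := hD.isDiskLift hp (⟨v, f 0, hpf 0 h0⟩ : D.LiftVertex p)
  rw [← hf0]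
  exact disk_lift_unique hp h.1 hf h.2.2 hpf h0 h.2.1 hz₀

/-- Two lifts of one disc that agree at one parameter agree everywhere, in particular at their
centres. -/
theorem liftVertex_eq (hD : D.Regular) (hp : IsCoveringMap p) {v v' : D.LiftVertex p}
    (hv : v.1 = v'.1) {z : ℂ} (hz : z ∈ Metric.closedBall (0 : ℂ) 1)
    (h : (D.lift p).disk v z = (D.lift p).disk v' z) : v = v' := by
  obtain ⟨v, x, hx⟩ := v
  obtain ⟨v', x', hx'⟩ := v'
  obtain rfl : v = v' := hv
  have h1 := hD.isDiskLift hp (⟨v, x, hx⟩ : D.LiftVertex p)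
  have h2 := hD.isDiskLift hp (⟨v, x', hx'⟩ : D.LiftVertex p)
  have h3 := disk_lift_unique hp h1.1 h2.1 h1.2.2 h2.2.2 hz h
    (Metric.mem_closedBall_self zero_le_one)
  rw [h1.2.1, h2.2.1] at h3
  obtain rfl : x = x' := h3
  rfl

variable [T2Space S]

theorem lift_regular (hD : D.Regular) (hp : IsCoveringMap p) : (D.lift p).Regular where
  two_le_val v := hD.two_le_val v.1
  continuousOn v := (hD.isDiskLift hp v).1
  injOn v z hz z' hz' h := hD.injOn v.1 hz hz' (by
    rw [← hD.proj_lift_disk hp v hz, ← hD.proj_lift_disk hp v hz', h])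
  isOpen_domainAt v := by
    have hb : ∀ z : Metric.ball (0 : ℂ) 1, (z : ℂ) ∈ Metric.closedBall (0 : ℂ) 1 := fun z =>
      Metric.ball_subset_closedBall z.2
    have hc : Continuous fun z : Metric.ball (0 : ℂ) 1 => D.disk v.1 z :=
      (hD.continuousOn v.1).comp_continuous continuous_subtype_val hb
    have ho : IsOpenMap fun z : Metric.ball (0 : ℂ) 1 => D.disk v.1 z := by
      intro W hW
      have : (fun z : Metric.ball (0 : ℂ) 1 => D.disk v.1 z) '' W =
          D.disk v.1 '' (Subtype.val '' W) := by rw [image_image]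
      rw [this]
      refine hD.isOpen_image_disk (Metric.isOpen_ball.isOpenMap_subtype_val _ hW) ?_
      rintro _ ⟨z, -, rfl⟩
      exact z.2
    have hemb := IsOpenEmbedding.of_continuous_injective_isOpenMap hc
      (fun z z' h => Subtype.ext (hD.injOn v.1 (hb z) (hb z') h)) ho
    have hcomp : p ∘ (fun z : Metric.ball (0 : ℂ) 1 => (D.lift p).disk v z) =
        fun z : Metric.ball (0 : ℂ) 1 => D.disk v.1 z :=
      funext fun z => hD.proj_lift_disk hp v (hb z)
    -- The projected disc is an open embedding and `p` is a local homeomorphism, so the lifted disc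
    -- is one too and has open image.
    have hloc : IsLocalHomeomorph fun z : Metric.ball (0 : ℂ) 1 => (D.lift p).disk v z :=
      IsLocalHomeomorph.of_comp (g := p) (hcomp ▸ hemb.isLocalHomeomorph) hp.isLocalHomeomorph
        ((hD.isDiskLift hp v).1.comp_continuous continuous_subtype_val hb)
    have := hloc.isOpenMap.isOpen_range
    change IsOpen ((D.lift p).disk v '' Metric.ball 0 1)
    rw [image_eq_range]
    exact this
  locallyFinite := by
    intro x
    obtain ⟨t, ht, hf⟩ := hD.locallyFinite (p x)
    have hpc := hp.continuous.continuousAt (x := x)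
    -- At most one lift of each disc comes near `x`: nearby points of any lift have parameter close
    -- to `z₀`, where the local injectivity of `p` forces it to be the lift through `x`.
    have key : ∀ v : V, ∃ N ∈ 𝓝 x, {v' : D.LiftVertex p | v'.1 = v ∧
        ((D.lift p).closedDomainAt v' ∩ N).Nonempty}.Finite := by
      intro v
      by_cases hv : p x ∈ D.closedDomainAt v
      · obtain ⟨z₀, hz₀, he⟩ := hv
        obtain ⟨y₀, hy₀, h0⟩ := hD.exists_liftVertex hp hz₀ he.symm
        obtain ⟨e, hxe, rfl⟩ := hp.isLocalHomeomorph x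
        have hcont := (hD.isDiskLift hp (⟨v, y₀, hy₀⟩ : D.LiftVertex e)).1 z₀ hz₀
        obtain ⟨δ, hδ, hδs⟩ := Metric.mem_nhdsWithin_iff.1
          (hcont (e.open_source.mem_nhds (h0.symm ▸ hxe)))
        have hev : ∀ᶠ y in 𝓝 x, ∀ z ∈ Metric.closedBall (0 : ℂ) 1, D.disk v z = e y →
            ‖z - z₀‖ < δ := by
          have := hD.eventually_norm_sub_lt (v := v) hz₀ hδ
          rw [he] at this
          exact hpc.eventually this
        refine ⟨_, inter_mem (e.open_source.mem_nhds hxe) hev, ?_⟩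
        refine (finite_singleton (⟨v, y₀, hy₀⟩ : D.LiftVertex e)).subset ?_
        rintro v' ⟨hv', y, ⟨z, hz, rfl⟩, hye, hy⟩
        have hpz : e ((D.lift e).disk v' z) = D.disk v z := by
          rw [hD.proj_lift_disk hp v' hz, hv']
        have hzδ := hy z hz hpz.symm
        have h1 : (D.lift e).disk ⟨v, y₀, hy₀⟩ z ∈ e.source :=
          hδs ⟨by rwa [Metric.mem_ball, dist_eq_norm], hz⟩
        refine hD.liftVertex_eq hp hv' hz (e.injOn hye h1 ?_)
        rw [hpz, hD.proj_lift_disk hp (⟨v, y₀, hy₀⟩ : D.LiftVertex e) hz]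
      · have hcl : IsClosed (D.closedDomainAt v) :=
          hD.isClosed_image subset_rfl (isCompact_closedBall 0 1)
        refine ⟨_, hpc (hcl.isOpen_compl.mem_nhds hv), ?_⟩
        convert finite_empty
        rw [eq_empty_iff_forall_notMem]
        rintro v' ⟨hv', y, ⟨z, hz, rfl⟩, hy⟩
        exact hy ⟨z, hz, by rw [hD.proj_lift_disk hp v' hz, hv']⟩
    choose N hN hNf using key
    refine ⟨p ⁻¹' t ∩ ⋂ v ∈ {v | (D.closedDomainAt v ∩ t).Nonempty}, N v,
      inter_mem (hpc ht) ((biInter_mem hf).2 fun v _ => hN v), ?_⟩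
    refine (hf.biUnion fun v _ => hNf v).subset ?_
    rintro v' ⟨y, ⟨z, hz, rfl⟩, hyt, hy⟩
    have hv' : v'.1 ∈ {v | (D.closedDomainAt v ∩ t).Nonempty} :=
      ⟨_, ⟨z, hz, rfl⟩, by rw [← hD.proj_lift_disk hp v' hz]; exact hyt⟩
    exact mem_biUnion hv' ⟨rfl, _, ⟨z, hz, rfl⟩, mem_iInter₂.1 hy _ hv'⟩
  meet v v' hne z hz z' hz' h := by
    have hp' : D.disk v.1 z = D.disk v'.1 z' := by
      rw [← hD.proj_lift_disk hp v hz, ← hD.proj_lift_disk hp v' hz', h]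
    by_cases hv : v.1 = v'.1
    · have hzz : z' = z := hD.injOn v.1 hz' hz (by rw [hp', hv])
      subst hzz
      exact absurd (hD.liftVertex_eq hp hv hz h) hne
    · exact hD.meet v.1 v'.1 hv z hz z' hz' hp'

/-- The preimage of the graph is the graph of the preimage. -/
theorem lift_graph (hD : D.Regular) (hp : IsCoveringMap p) :
    (D.lift p).graph = p ⁻¹' D.graph := by
  have := t2Space_of_covering hp
  ext x
  rw [(hD.lift_regular hp).graph_eq, hD.graph_eq, mem_preimage]
  constructor
  · rintro ⟨⟨v, k⟩, -, z, hz, rfl⟩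
    exact ⟨⟨v.1, k⟩, trivial, z, hz, (hD.proj_lift_disk hp v (spoke_subset _ _ hz)).symm⟩
  · rintro ⟨⟨v, k⟩, -, z, hz, he⟩
    obtain ⟨y, hy, h⟩ := hD.exists_liftVertex hp (spoke_subset _ _ hz) he.symm
    exact ⟨⟨⟨v, y, hy⟩, k⟩, trivial, z, hz, h⟩

end Regular

/-- The two sides are carried up by a local inverse of `p`, since the graph upstairs is the full
preimage of the graph. -/
theorem Tame.lift_tame [T2Space S] (hD : D.Tame) (hp : IsCoveringMap p) : (D.lift p).Tame := by
  refine ⟨hD.lift_regular hp, fun v k k' hk r hr N hN => ?_⟩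
  have hz₀ : polar (D.val v.1) r k ∈ Metric.closedBall (0 : ℂ) 1 :=
    polar_mem_closedBall ⟨hr.1.le, hr.2⟩
  set x := (D.lift p).disk v (polar ((D.lift p).val v) r k) with hx
  have hpx : p x = D.disk v.1 (polar (D.val v.1) r k) := hD.proj_lift_disk hp v hz₀
  obtain ⟨e, hxe, rfl⟩ := hp.isLocalHomeomorph x
  have hcont := (hD.isDiskLift hp v).1 _ hz₀
  obtain ⟨δ, hδ, hδs⟩ := Metric.mem_nhdsWithin_iff.1 (hcont (e.open_source.mem_nhds hxe))
  have h1 := hD.eventually_norm_sub_lt (v := v.1) hz₀ hδ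
  have h2 : e.symm ⁻¹' N ∈ 𝓝 (e x) :=
    e.symm.continuousAt (e.map_source hxe) (by rwa [e.left_inv hxe])
  have h3 : e.target ∈ 𝓝 (e x) := e.open_target.mem_nhds (e.map_source hxe)
  rw [hpx] at h2 h3
  -- The freedom in the neighbourhood is used here: the sides must fit into the target of the local
  -- inverse, and their disc parameters must be so near that this inverse returns the disc lifted at
  -- `v`, not another lift.
  obtain ⟨P, Q, hP, hQ, hPN, hQN, hPQ, hPne, hQne⟩ := hD.twoSided v.1 k k' hk r hr _
    (inter_mem h1 (inter_mem h2 h3))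
  have hlift : ∀ R : Set S, IsPreconnected R →
      R ⊆ ({y | ∀ z ∈ Metric.closedBall (0 : ℂ) 1, D.disk v.1 z = y →
        ‖z - polar (D.val v.1) r k‖ < δ} ∩ (e.symm ⁻¹' N ∩ e.target)) \ D.graph →
      ∀ a : Fin (D.val v.1),
      (R ∩ D.disk v.1 '' (innerSector (D.val v.1) a ∩ Metric.ball 0 1)).Nonempty →
      IsPreconnected (e.symm '' R) ∧ e.symm '' R ⊆ N \ (D.lift e).graph ∧
      (e.symm '' R ∩ (D.lift e).disk v '' (innerSector (D.val v.1) a ∩ Metric.ball 0 1)).Nonempty := by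
    intro R hR hRN a hne
    have hRt : R ⊆ e.target := fun y hy => (hRN hy).1.2.2
    refine ⟨hR.image _ (e.continuousOn_symm.mono hRt), ?_, ?_⟩
    · rintro _ ⟨y, hy, rfl⟩
      refine ⟨(hRN hy).1.2.1, fun h => (hRN hy).2 ?_⟩
      rw [hD.lift_graph hp, mem_preimage, e.right_inv (hRt hy)] at h
      exact h
    · obtain ⟨_, hy, z, hz, rfl⟩ := hne
      have hzb := Metric.ball_subset_closedBall hz.2
      have hzδ := (hRN hy).1.1 z hzb rfl
      have hzs : (D.lift e).disk v z ∈ e.source :=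
        hδs ⟨by rwa [Metric.mem_ball, dist_eq_norm], hzb⟩
      refine ⟨_, ⟨_, hy, rfl⟩, z, hz, ?_⟩
      rw [← hD.proj_lift_disk hp v hzb, e.left_inv hzs]
  obtain ⟨hP1, hP2, hP3⟩ := hlift P hP hPN k hPne
  obtain ⟨hQ1, hQ2, hQ3⟩ := hlift Q hQ hQN k' hQne
  refine ⟨e.symm '' P, e.symm '' Q, hP1, hQ1, hP2, hQ2, ?_, hP3, hQ3⟩
  have h4 : e ⁻¹' (P ∪ Q ∪ D.graph) ∈ 𝓝 x := e.continuousAt hxe (hpx ▸ hPQ)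
  filter_upwards [h4, e.open_source.mem_nhds hxe] with y hy hys
  rcases hy with (hy | hy) | hy
  · exact Or.inl (Or.inl ⟨_, hy, e.left_inv hys⟩)
  · exact Or.inl (Or.inr ⟨_, hy, e.left_inv hys⟩)
  · exact Or.inr (by rw [hD.lift_graph hp]; exact hy)

/-! ### Local path connectedness of surfaces and their coverings -/

theorem locallyPathConnectedSpace_of_nhds {X : Type*} [TopologicalSpace X]
    (h : ∀ x : X, ∃ U : Set X, IsOpen U ∧ x ∈ U ∧ LocallyPathConnectedSpace U) :
    LocallyPathConnectedSpace X := by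
  rw [locallyPathConnectedSpace_iff_pathComponentIn_mem_nhds]
  intro x u hu hxu
  obtain ⟨U, hU, hxU, hL⟩ := h x
  have h1 := (hu.preimage (continuous_subtype_val (p := (· ∈ U)))).pathComponentIn (⟨x, hxU⟩ : U)
  refine mem_of_superset ((hU.isOpenMap_subtype_val _ h1).mem_nhds
    ⟨⟨x, hxU⟩, mem_pathComponentIn_self hxu, rfl⟩) ?_
  refine ((isPathConnected_pathComponentIn (x := (⟨x, hxU⟩ : U)) hxu).image
    continuous_subtype_val).subset_pathComponentIn ⟨⟨x, hxU⟩, mem_pathComponentIn_self hxu, rfl⟩ ?_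
  rintro _ ⟨y, hy, rfl⟩
  exact (pathComponentIn_subset hy : y ∈ Subtype.val ⁻¹' u)

/-- The half plane is a retract of the plane, hence a quotient of it, and quotients inherit local
path connectedness. -/
theorem locallyPathConnectedSpace_halfPlane : LocallyPathConnectedSpace HalfPlane := by
  let τ : ℂ → HalfPlane := fun ζ => ⟨⟨min ζ.re 0, ζ.im⟩, min_le_right _ _⟩
  have hτ : Continuous τ := by
    refine Continuous.subtype_mk ?_ _
    have : (fun ζ : ℂ => (⟨min ζ.re 0, ζ.im⟩ : ℂ)) =
        fun ζ => ((min ζ.re 0 : ℝ) : ℂ) + (ζ.im : ℂ) * Complex.I := by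
      ext ζ
      exact Complex.mk_eq_add_mul_I _ _
    rw [this]
    fun_prop
  have hinv : Function.RightInverse (Subtype.val : HalfPlane → ℂ) τ := fun ζ =>
    Subtype.ext (Complex.ext (min_eq_left ζ.2) rfl)
  exact (IsQuotientMap.of_inverse continuous_subtype_val hτ hinv).locallyPathConnectedSpace

theorem locallyPathConnectedSpace_of_openPartialHomeomorph {X Y : Type*} [TopologicalSpace X]
    [TopologicalSpace Y] [LocallyPathConnectedSpace Y] (e : OpenPartialHomeomorph X Y) :
    LocallyPathConnectedSpace e.source := by
  have := e.open_target.locallyPathConnectedSpace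
  exact e.toHomeomorphSourceTarget.isOpenEmbedding.locallyPathConnectedSpace

theorem _root_.SpectralWeb.OrientedSurface.locallyPathConnectedSpace (O : OrientedSurface S) :
    LocallyPathConnectedSpace S := by
  refine locallyPathConnectedSpace_of_nhds fun x => ?_
  rcases O.covered x with ⟨e, -, hx⟩ | ⟨e, hx, -⟩
  · exact ⟨_, e.open_source, hx, locallyPathConnectedSpace_of_openPartialHomeomorph e⟩
  · have := locallyPathConnectedSpace_halfPlane
    exact ⟨_, e.open_source, hx, locallyPathConnectedSpace_of_openPartialHomeomorph e⟩

theorem locallyPathConnectedSpace_of_covering [LocallyPathConnectedSpace S]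
    (hp : IsCoveringMap p) : LocallyPathConnectedSpace T := by
  refine locallyPathConnectedSpace_of_nhds fun x => ?_
  obtain ⟨e, hx, -⟩ := hp.isLocalHomeomorph x
  exact ⟨_, e.open_source, hx, locallyPathConnectedSpace_of_openPartialHomeomorph e⟩

end WebData
end SpectralWeb
end

noncomputable section
namespace SpectralWeb
universe w
variable {V : Type w} {S T : Type*}
namespace WebData
variable [TopologicalSpace S] [TopologicalSpace T] {D : WebData V S} {p : T → S}

/-! ### The action of the deck transformations -/

theorem IsDeck.symm {g : T ≃ₜ T} (hg : IsDeck p g) : IsDeck p g.symm := fun x => by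
  have := hg (g.symm x)
  rwa [g.apply_symm_apply, eq_comm] at this

theorem IsDeck.trans {g h : T ≃ₜ T} (hg : IsDeck p g) (hh : IsDeck p h) : IsDeck p (g.trans h) :=
  fun x => (hh (g x)).trans (hg x)

theorem IsDeck.refl : IsDeck p (Homeomorph.refl T) := fun _ => rfl

/-- The action of a deck transformation on the lifted vertices. -/
def deckVertex (D : WebData V S) (p : T → S) (g : T ≃ₜ T) (hg : IsDeck p g)
    (v : D.LiftVertex p) : D.LiftVertex p :=
  ⟨v.1, ⟨g v.2.1, (hg _).trans v.2.2⟩⟩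

theorem symm_deckCorner {g : T ≃ₜ T} (hg : IsDeck p g) (c : (D.lift p).Corner) :
    D.deckCorner p g.symm hg.symm (D.deckCorner p g hg c) = c := by
  obtain ⟨⟨v, x, hx⟩, k⟩ := c
  have key : ∀ (x y : T) (hx : p x = D.disk v 0) (hy : p y = D.disk v 0), x = y →
      (⟨⟨v, x, hx⟩, k⟩ : (D.lift p).Corner) = ⟨⟨v, y, hy⟩, k⟩ := by
    rintro x _ hx hy rfl
    rfl
  exact key _ _ _ _ (g.symm_apply_apply x)

/-- The projection of the glued surface over the universal cover to the spectral surface. -/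
def toSpectral (D : WebData V S) (p : T → S) (a : (D.lift p).Glued) : D.SpectralSurface p :=
  Quot.mk _ a

theorem continuous_toSpectral : Continuous (D.toSpectral p) := continuous_quot_mk

theorem isQuotientMap_toSpectral : IsQuotientMap (D.toSpectral p) := isQuotientMap_quot_mk

theorem surjective_toSpectral : Function.Surjective (D.toSpectral p) := Quot.exists_rep

theorem spectralMap_toSpectral (a : (D.lift p).Glued) :
    D.spectralMap p (D.toSpectral p a) = p ((D.lift p).gluedMap a) := rfl

theorem continuous_spectralMap (hp : IsCoveringMap p) : Continuous (D.spectralMap p) :=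
  continuous_quot_lift _ (hp.continuous.comp continuous_gluedMap)

namespace Regular

theorem lift_disk_deck (hD : D.Regular) (hp : IsCoveringMap p) {g : T ≃ₜ T} (hg : IsDeck p g)
    (v : D.LiftVertex p) {z : ℂ} (hz : z ∈ Metric.closedBall (0 : ℂ) 1) :
    (D.lift p).disk (D.deckVertex p g hg v) z = g ((D.lift p).disk v z) := by
  have h1 := hD.isDiskLift hp v
  have h2 := hD.isDiskLift hp (D.deckVertex p g hg v)
  refine disk_lift_unique (f := (D.lift p).disk (D.deckVertex p g hg v))
    (g := fun z => g ((D.lift p).disk v z)) hp h2.1 (g.continuous.comp_continuousOn h1.1) h2.2.2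
    (fun z hz => (hg _).trans (h1.2.2 z hz)) (Metric.mem_closedBall_self zero_le_one) ?_ hz
  rw [h2.2.1]
  rw [h1.2.1]
  rfl

theorem follows_deck (hD : D.Regular) (hp : IsCoveringMap p) {g : T ≃ₜ T} (hg : IsDeck p g)
    {c c' : (D.lift p).Corner} (h : (D.lift p).Follows c c') :
    (D.lift p).Follows (D.deckCorner p g hg c) (D.deckCorner p g hg c') := by
  have key : ∀ (a : (D.lift p).Corner) (m : ℕ),
      (D.lift p).disk (D.deckCorner p g hg a).1 (tip ((D.lift p).val a.1) m) =
        g ((D.lift p).disk a.1 (tip ((D.lift p).val a.1) m)) := fun a m =>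
    hD.lift_disk_deck hp hg a.1 (tip_mem_closedBall _ _)
  rcases h with ⟨h1, h2, h3⟩ | ⟨h1, h2, h3⟩
  · exact Or.inl ⟨h1, h2, (key c c.2).trans ((congrArg g h3).trans (key c' c'.2).symm)⟩
  · exact Or.inr ⟨h1, h2, (key c (c.2 + 1)).trans ((congrArg g h3).trans (key c' (c'.2 + 1)).symm)⟩

/-- The action of a deck transformation on the strands. -/
def deckStrand (hD : D.Regular) (hp : IsCoveringMap p) (g : T ≃ₜ T) (hg : IsDeck p g) :
    (D.lift p).Strand → (D.lift p).Strand :=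
  Quot.map (D.deckCorner p g hg) fun _ _ => hD.follows_deck hp hg

theorem strandOf_deckCorner (hD : D.Regular) (hp : IsCoveringMap p) {g : T ≃ₜ T}
    (hg : IsDeck p g) (c : (D.lift p).Corner) : (D.lift p).strandOf (D.deckCorner p g hg c) =
    hD.deckStrand hp g hg ((D.lift p).strandOf c) := rfl

theorem symm_deckStrand (hD : D.Regular) (hp : IsCoveringMap p) {g : T ≃ₜ T}
    (hg : IsDeck p g) (γ : (D.lift p).Strand) :
    hD.deckStrand hp g.symm hg.symm (hD.deckStrand hp g hg γ) = γ := by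
  obtain ⟨c, rfl⟩ := Quot.exists_rep γ
  exact congrArg (Quot.mk _) (symm_deckCorner hg c)

theorem movesStrand_iff (hD : D.Regular) (hp : IsCoveringMap p) {g : T ≃ₜ T}
    (hg : IsDeck p g) {γ γ' : (D.lift p).Strand} :
    D.MovesStrand p g hg γ γ' ↔ γ' = hD.deckStrand hp g hg γ := by
  constructor
  · rintro ⟨c, rfl, rfl⟩
    rfl
  · rintro rfl
    obtain ⟨c, rfl⟩ := Quot.exists_rep γ
    exact ⟨c, rfl, rfl⟩

theorem mem_image_deck (hD : D.Regular) (hp : IsCoveringMap p) {g : T ≃ₜ T}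
    (hg : IsDeck p g) {v : D.LiftVertex p} {K : Set ℂ} (hK : K ⊆ Metric.closedBall 0 1) {x : T} :
    g x ∈ (D.lift p).disk (D.deckVertex p g hg v) '' K ↔ x ∈ (D.lift p).disk v '' K := by
  constructor
  · rintro ⟨z, hz, he⟩
    rw [hD.lift_disk_deck hp hg v (hK hz)] at he
    exact ⟨z, hz, g.injective he⟩
  · rintro ⟨z, hz, rfl⟩
    exact ⟨z, hz, hD.lift_disk_deck hp hg v (hK hz)⟩

/-- Sets composed of pieces at the corners along a strand are moved by deck transformations. -/
theorem mem_corners_deck (hD : D.Regular) (hp : IsCoveringMap p) {g : T ≃ₜ T}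
    (hg : IsDeck p g) (q : Prop → Prop) (K : ℕ → ℕ → Set ℂ)
    (hK : ∀ n k, K n k ⊆ Metric.closedBall 0 1) {γ : (D.lift p).Strand} {x : T} :
    (∃ c : (D.lift p).Corner, (D.lift p).strandOf c = hD.deckStrand hp g hg γ ∧
      q ((D.lift p).black c.1) ∧ g x ∈ (D.lift p).disk c.1 '' K ((D.lift p).val c.1) c.2) ↔
    ∃ c : (D.lift p).Corner, (D.lift p).strandOf c = γ ∧
      q ((D.lift p).black c.1) ∧ x ∈ (D.lift p).disk c.1 '' K ((D.lift p).val c.1) c.2 := by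
  constructor
  · rintro ⟨c, hc, hq, hx⟩
    refine ⟨D.deckCorner p g.symm hg.symm c, ?_, hq, ?_⟩
    · rw [hD.strandOf_deckCorner hp, hc, hD.symm_deckStrand hp]
    · have := (hD.mem_image_deck hp hg.symm (v := c.1) (hK ((D.lift p).val c.1) c.2)).2 hx
      rwa [g.symm_apply_apply] at this
  · rintro ⟨c, rfl, hq, hx⟩
    exact ⟨D.deckCorner p g hg c, rfl, hq,
      (hD.mem_image_deck hp hg (v := c.1) (hK ((D.lift p).val c.1) c.2)).2 hx⟩

theorem mem_strandSet_deck (hD : D.Regular) (hp : IsCoveringMap p) {g : T ≃ₜ T}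
    (hg : IsDeck p g) {γ : (D.lift p).Strand} {x : T} :
    g x ∈ (D.lift p).strandSet (hD.deckStrand hp g hg γ) ↔ x ∈ (D.lift p).strandSet γ := by
  simpa only [true_and] using! hD.mem_corners_deck hp hg (fun _ => True) arc arc_subset
    (γ := γ) (x := x)

theorem mem_zigzag_deck (hD : D.Regular) (hp : IsCoveringMap p) {g : T ≃ₜ T}
    (hg : IsDeck p g) {γ : (D.lift p).Strand} {x : T} :
    g x ∈ (D.lift p).zigzag (hD.deckStrand hp g hg γ) ↔ x ∈ (D.lift p).zigzag γ := by
  simpa only [true_and] using! hD.mem_corners_deck hp hg (fun _ => True)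
    (fun n k => spoke n k ∪ spoke n (k + 1))
    (fun n k => union_subset (spoke_subset _ _) (spoke_subset _ _)) (γ := γ) (x := x)

/-- A deck transformation permutes the lifted discs, keeping parameters and colours, so it carries
sides of strands to sides, right to right and left to left. -/
theorem cuts_deck (hD : D.Regular) (hp : IsCoveringMap p) {g : T ≃ₜ T}
    (hg : IsDeck p g) {γ : (D.lift p).Strand} {A B : Set T} (h : (D.lift p).Cuts γ A B) :
    (D.lift p).Cuts (hD.deckStrand hp g hg γ) (g.symm ⁻¹' A) (g.symm ⁻¹' B) where
  isOpen_right := h.isOpen_right.preimage g.symm.continuous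
  isOpen_left := h.isOpen_left.preimage g.symm.continuous
  isConnected_right := by
    rw [← g.image_eq_preimage_symm]
    exact h.isConnected_right.image _ g.continuous.continuousOn
  isConnected_left := by
    rw [← g.image_eq_preimage_symm]
    exact h.isConnected_left.image _ g.continuous.continuousOn
  disjoint := h.disjoint.preimage _
  union := by
    rw [← preimage_union, h.union]
    ext x
    rw [mem_preimage, mem_compl_iff, mem_compl_iff, ← hD.mem_strandSet_deck hp hg,
      g.apply_symm_apply]
  right c hc hb y hy := by
    have h1 : (D.lift p).strandOf (D.deckCorner p g.symm hg.symm c) = γ := by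
      rw [hD.strandOf_deckCorner hp, hc, hD.symm_deckStrand hp]
    have h2 := h.right _ h1 hb (g.symm y)
      ((hD.mem_image_deck hp hg.symm (v := c.1) (openArc_subset _ _)).2 hy)
    filter_upwards [g.symm.continuous.continuousAt.eventually h2] with x hx
    exact hx.trans (hD.mem_image_deck hp hg.symm (v := c.1) Metric.ball_subset_closedBall)
  left c hc hb y hy := by
    have h1 : (D.lift p).strandOf (D.deckCorner p g.symm hg.symm c) = γ := by
      rw [hD.strandOf_deckCorner hp, hc, hD.symm_deckStrand hp]
    have h2 := h.left _ h1 hb (g.symm y)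
      ((hD.mem_image_deck hp hg.symm (v := c.1) (openArc_subset _ _)).2 hy)
    filter_upwards [g.symm.continuous.continuousAt.eventually h2] with x hx
    exact hx.trans (hD.mem_image_deck hp hg.symm (v := c.1) Metric.ball_subset_closedBall)

theorem mem_rightSide_deck (hD : D.Regular) (hp : IsCoveringMap p) {g : T ≃ₜ T}
    (hg : IsDeck p g) {γ : (D.lift p).Strand} {x : T} (hx : x ∈ (D.lift p).rightSide γ) :
    g x ∈ (D.lift p).rightSide (hD.deckStrand hp g hg γ) := by
  obtain ⟨A, B, h, hA⟩ := hx
  exact ⟨_, _, hD.cuts_deck hp hg h, by rwa [mem_preimage, g.symm_apply_apply]⟩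

theorem mem_face_deck (hD : D.Regular) (hp : IsCoveringMap p) {g : T ≃ₜ T}
    (hg : IsDeck p g) {γ : (D.lift p).Strand} {x : T} (hx : x ∈ (D.lift p).face γ) :
    g x ∈ (D.lift p).face (hD.deckStrand hp g hg γ) := by
  rcases hx with (⟨hA, hK⟩ | hI) | hz
  · refine Or.inl (Or.inl ⟨hD.mem_rightSide_deck hp hg hA, fun h => hK ?_⟩)
    exact (hD.mem_corners_deck hp hg (fun q => q) sector sector_subset).1 h
  · exact Or.inl (Or.inr
      ((hD.mem_corners_deck hp hg (fun q => ¬q) innerSector innerSector_subset).2 hI))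
  · exact Or.inr ((hD.mem_zigzag_deck hp hg).2 hz)

theorem mem_graph_deck (hD : D.Regular) (hp : IsCoveringMap p) {g : T ≃ₜ T}
    (hg : IsDeck p g) {x : T} (hx : x ∈ (D.lift p).graph) : g x ∈ (D.lift p).graph := by
  obtain ⟨v, hx⟩ := hx
  refine ⟨D.deckVertex p g hg v, ?_⟩
  rcases hx with rfl | ⟨k, hk⟩
  · exact Or.inl (hD.lift_disk_deck hp hg v (Metric.mem_closedBall_self zero_le_one)).symm
  · exact Or.inr ⟨k, (hD.mem_image_deck hp hg (spoke_subset _ _)).2 hk⟩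

/-- The action of a deck transformation on the pieces. -/
def deckPiece (hD : D.Regular) (hp : IsCoveringMap p) (g : T ≃ₜ T) (hg : IsDeck p g) :
    (D.lift p).Pieces → (D.lift p).Pieces
  | .inl x => .inl ⟨g x.1, hD.mem_graph_deck hp hg x.2⟩
  | .inr y => .inr ⟨hD.deckStrand hp g hg y.1, g y.2.1, hD.mem_face_deck hp hg y.2.2⟩

theorem piecesMap_deckPiece (hD : D.Regular) (hp : IsCoveringMap p) {g : T ≃ₜ T} (hg : IsDeck p g)
    (a : (D.lift p).Pieces) :
    (D.lift p).piecesMap (hD.deckPiece hp g hg a) = g ((D.lift p).piecesMap a) := by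
  rcases a with a | a <;> rfl

theorem continuous_deckPiece (hD : D.Regular) (hp : IsCoveringMap p) {g : T ≃ₜ T}
    (hg : IsDeck p g) : Continuous (hD.deckPiece hp g hg) := by
  refine continuous_sum_dom.2 ⟨?_, ?_⟩
  · exact continuous_inl.comp ((g.continuous.comp continuous_subtype_val).subtype_mk _)
  · refine continuous_sigma fun γ => ?_
    have h : Continuous fun x : (D.lift p).face γ =>
        (⟨g x.1, hD.mem_face_deck hp hg x.2⟩ : (D.lift p).face (hD.deckStrand hp g hg γ)) :=
      (g.continuous.comp continuous_subtype_val).subtype_mk _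
    exact continuous_inr.comp
      ((continuous_sigmaMk (σ := fun γ => (D.lift p).face γ)).comp h)

/-- The action of a deck transformation on the glued surface. -/
def deckGlued (hD : D.Regular) (hp : IsCoveringMap p) (g : T ≃ₜ T) (hg : IsDeck p g) :
    (D.lift p).Glued → (D.lift p).Glued :=
  Quotient.map (hD.deckPiece hp g hg) (by
    rintro a b (rfl | ⟨h1, h2, h3⟩)
    · exact Or.inl rfl
    · have key : ∀ a, (D.lift p).OnGraph a → (D.lift p).OnGraph (hD.deckPiece hp g hg a) := by
        rintro (a | a) ha
        · trivial
        · exact (hD.mem_zigzag_deck hp hg).2 ha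
      refine Or.inr ⟨key a h1, key b h2, ?_⟩
      rw [hD.piecesMap_deckPiece hp, hD.piecesMap_deckPiece hp, h3])

theorem continuous_deckGlued (hD : D.Regular) (hp : IsCoveringMap p) {g : T ≃ₜ T}
    (hg : IsDeck p g) : Continuous (hD.deckGlued hp g hg) :=
  (hD.continuous_deckPiece hp hg).quotient_map' _

theorem gluedMap_deckGlued (hD : D.Regular) (hp : IsCoveringMap p) {g : T ≃ₜ T} (hg : IsDeck p g)
    (a : (D.lift p).Glued) :
    (D.lift p).gluedMap (hD.deckGlued hp g hg a) = g ((D.lift p).gluedMap a) := by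
  obtain ⟨a, rfl⟩ := Quotient.exists_rep a
  exact hD.piecesMap_deckPiece hp hg a

/-- `SameOrbit` is phrased by representatives in the pieces; this turns it into the orbit relation
of an action by continuous maps. -/
theorem sameOrbit_iff (hD : D.Regular) (hp : IsCoveringMap p) {a b : (D.lift p).Glued} :
    D.SameOrbit p a b ↔ ∃ (g : T ≃ₜ T) (hg : IsDeck p g), b = hD.deckGlued hp g hg a := by
  constructor
  · rintro ⟨g, hg, a', b', rfl, rfl, h⟩
    refine ⟨g, hg, congrArg (Quotient.mk _) ?_⟩
    rcases a' with x | ⟨γ, x⟩ <;> rcases b' with y | ⟨γ', y⟩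
    · exact congrArg Sum.inl (Subtype.ext h.symm)
    · exact h.elim
    · exact h.elim
    · obtain ⟨h1, h2⟩ := h
      obtain rfl := (hD.movesStrand_iff hp hg).1 h1
      exact congrArg Sum.inr (Sigma.ext rfl (heq_of_eq (Subtype.ext h2.symm)))
  · rintro ⟨g, hg, rfl⟩
    obtain ⟨a', rfl⟩ := Quotient.exists_rep a
    refine ⟨g, hg, a', hD.deckPiece hp g hg a', rfl, rfl, ?_⟩
    rcases a' with x | x
    · rfl
    · exact ⟨(hD.movesStrand_iff hp hg).2 rfl, rfl⟩

theorem deckGlued_trans (hD : D.Regular) (hp : IsCoveringMap p) {g h : T ≃ₜ T} (hg : IsDeck p g)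
    (hh : IsDeck p h) (a : (D.lift p).Glued) :
    hD.deckGlued hp h hh (hD.deckGlued hp g hg a) =
      hD.deckGlued hp (g.trans h) (hg.trans hh) a := by
  obtain ⟨a', rfl⟩ := Quotient.exists_rep a
  refine congrArg (Quotient.mk _) ?_
  rcases a' with x | ⟨γ, x⟩
  · rfl
  · obtain ⟨c, rfl⟩ := Quot.exists_rep γ
    rfl

theorem deckGlued_refl (hD : D.Regular) (hp : IsCoveringMap p) {g : T ≃ₜ T} (hg : IsDeck p g)
    (h : g = Homeomorph.refl T) (a : (D.lift p).Glued) : hD.deckGlued hp g hg a = a := by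
  subst h
  obtain ⟨a', rfl⟩ := Quotient.exists_rep a
  refine congrArg (Quotient.mk _) ?_
  rcases a' with x | ⟨γ, x⟩
  · rfl
  · obtain ⟨c, rfl⟩ := Quot.exists_rep γ
    rfl

theorem sameOrbit_equivalence (hD : D.Regular) (hp : IsCoveringMap p) :
    Equivalence (D.SameOrbit p) where
  refl a := (hD.sameOrbit_iff hp).2 ⟨_, IsDeck.refl, (hD.deckGlued_refl hp _ rfl a).symm⟩
  symm {a b} h := by
    obtain ⟨g, hg, rfl⟩ := (hD.sameOrbit_iff hp).1 h
    refine (hD.sameOrbit_iff hp).2 ⟨g.symm, hg.symm, ?_⟩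
    rw [hD.deckGlued_trans hp]
    exact (hD.deckGlued_refl hp _ g.self_trans_symm a).symm
  trans {a b c} h h' := by
    obtain ⟨g, hg, rfl⟩ := (hD.sameOrbit_iff hp).1 h
    obtain ⟨g', hg', rfl⟩ := (hD.sameOrbit_iff hp).1 h'
    exact (hD.sameOrbit_iff hp).2 ⟨_, hg.trans hg', hD.deckGlued_trans hp hg hg' a⟩

theorem toSpectral_eq_iff (hD : D.Regular) (hp : IsCoveringMap p) {a b : (D.lift p).Glued} :
    D.toSpectral p a = D.toSpectral p b ↔
      ∃ (g : T ≃ₜ T) (hg : IsDeck p g), b = hD.deckGlued hp g hg a := by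
  rw [← hD.sameOrbit_iff hp]
  exact ⟨fun h => (hD.sameOrbit_equivalence hp).eqvGen_iff.1 (Quot.eqvGen_exact h), Quot.sound⟩

/-- The saturation of an open set is the union of its preimages under the deck transformations,
hence open. -/
theorem isOpenMap_toSpectral (hD : D.Regular) (hp : IsCoveringMap p) :
    IsOpenMap (D.toSpectral p) := by
  intro W hW
  have h : D.toSpectral p ⁻¹' (D.toSpectral p '' W) =
      ⋃ (g : T ≃ₜ T) (hg : IsDeck p g), hD.deckGlued hp g hg ⁻¹' W := by
    ext a
    simp only [mem_iUnion]
    constructor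
    · rintro ⟨b, hb, he⟩
      obtain ⟨g, hg, rfl⟩ := (hD.toSpectral_eq_iff hp).1 he.symm
      exact ⟨g, hg, hb⟩
    · rintro ⟨g, hg, ha⟩
      exact ⟨_, ha, ((hD.toSpectral_eq_iff hp).2 ⟨g, hg, rfl⟩).symm⟩
  refine isQuotientMap_toSpectral.isOpen_preimage.1 ?_
  rw [h]
  exact isOpen_iUnion fun g => isOpen_iUnion fun hg => hW.preimage (hD.continuous_deckGlued hp hg)

end Regular

/-- A deck transformation with a fixed point is the identity. -/
theorem IsDeck.eq_refl [PreconnectedSpace T] (hp : IsCoveringMap p) {g : T ≃ₜ T}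
    (hg : IsDeck p g) {x : T} (hx : g x = x) : g = Homeomorph.refl T := by
  ext y
  exact congrFun (hp.eq_of_comp_eq g.continuous continuous_id (funext hg) x hx) y

/-- The deck transformations of the universal cover act transitively on its fibres. -/
theorem exists_deck [SimplyConnectedSpace T] [LocallyPathConnectedSpace T] (hp : IsCoveringMap p)
    {x y : T} (h : p x = p y) : ∃ g : T ≃ₜ T, IsDeck p g ∧ g x = y := by
  have key : ∀ x y : T, p x = p y → ∃ F : C(T, T), F x = y ∧ p ∘ F = p := fun x y h => by
    obtain ⟨F, hF, -⟩ := hp.existsUnique_continuousMap_lifts (⟨p, hp.continuous⟩ : C(T, S)) x y h.symm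
    exact ⟨F, hF⟩
  have inv : ∀ (x y : T) (F G : C(T, T)), F x = y → G y = x → p ∘ F = p → p ∘ G = p →
      ∀ a, G (F a) = a := fun x y F G hF hG hpF hpG a => by
    refine congrFun (hp.eq_of_comp_eq (g₁ := G ∘ F) (g₂ := id) (G.continuous.comp F.continuous)
      continuous_id ?_ x (by simp [hF, hG])) a
    rw [← Function.comp_assoc, hpG, hpF]
    rfl
  obtain ⟨F, hF, hpF⟩ := key x y h
  obtain ⟨G, hG, hpG⟩ := key y x h.symm
  exact ⟨⟨⟨F, G, inv x y F G hF hG hpF hpG, inv y x G F hG hF hpG hpF⟩, F.continuous, G.continuous⟩,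
    congrFun hpF, hF⟩

end WebData
end SpectralWeb
end

/-! ### Descent to the spectral surface -/

noncomputable section
namespace SpectralWeb
universe w u
variable {V : Type w} {S T : Type*}

/-- A map is a local homeomorphism along the image of an open section. -/
theorem isLocalHomeomorphOn_range_section {E B : Type*} [TopologicalSpace E] [TopologicalSpace B]
    {f : E → B} (hf : Continuous f) {U : Set B} (hU : IsOpen U) {t : U → E} (ht : Continuous t)
    (hr : IsOpen (range t)) (h : ∀ u, f (t u) = u) : IsLocalHomeomorphOn f (range t) := by
  refine (isLocalHomeomorphOn_iff_isOpenEmbedding_restrict _).2 fun a ha =>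
    ⟨range t, hr.mem_nhds ha, ?_⟩
  refine IsOpenEmbedding.of_continuous_injective_isOpenMap (hf.comp continuous_subtype_val) ?_ ?_
  · rintro ⟨_, u, rfl⟩ ⟨_, u', rfl⟩ he
    obtain rfl : u = u' := Subtype.ext ((h u).symm.trans (Eq.trans he (h u')))
    rfl
  · intro N hN
    have : (range t).domRestrict f '' N =
        Subtype.val '' ((fun u => (⟨t u, u, rfl⟩ : range t)) ⁻¹' N) := by
      ext y
      constructor
      · rintro ⟨⟨_, u, rfl⟩, hn, rfl⟩
        exact ⟨u, hn, (h u).symm⟩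
      · rintro ⟨u, hn, rfl⟩
        exact ⟨_, hn, h u⟩
    rw [this]
    exact hU.isOpenMap_subtype_val _ (hN.preimage (ht.subtype_mk _))

/-- An open embedding of an open subset of the plane is the inverse of a chart. -/
theorem exists_chart_of_isOpenEmbedding {E : Type*} [TopologicalSpace E] {U : Set ℂ}
    (hU : IsOpen U) (hne : U.Nonempty) {ψ : U → E} (h : IsOpenEmbedding ψ) :
    ∃ a : OpenPartialHomeomorph E ℂ, a.source = range ψ ∧ ∀ y, a (ψ y) = y := by
  have : Nonempty U := hne.to_subtype
  refine ⟨(h.toOpenPartialHomeomorph ψ).symm.trans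
    (hU.isOpenEmbedding_subtypeVal.toOpenPartialHomeomorph _), ?_, fun y => ?_⟩
  · simp
  · simp [h.toOpenPartialHomeomorph_left_inv]

namespace WebData
variable [TopologicalSpace S] [TopologicalSpace T] {D : WebData V S} {p : T → S}

namespace Regular

/-- The action on the glued surface is free because it lies over the free action on the universal
cover. -/
theorem eq_of_toSpectral_eq [PreconnectedSpace T] (hD : D.Regular) (hp : IsCoveringMap p)
    {a b : (D.lift p).Glued} (h : D.toSpectral p a = D.toSpectral p b)
    (he : (D.lift p).gluedMap a = (D.lift p).gluedMap b) : a = b := by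
  obtain ⟨g, hg, rfl⟩ := (hD.toSpectral_eq_iff hp).1 h
  rw [hD.gluedMap_deckGlued hp] at he
  exact (hD.deckGlued_refl hp hg (hg.eq_refl hp he.symm) a).symm

theorem isLocalHomeomorph_toSpectral [PreconnectedSpace T] (hD : D.Regular) (hp : IsCoveringMap p) :
    IsLocalHomeomorph (D.toSpectral p) := by
  refine isLocalHomeomorph_iff_isOpenEmbedding_restrict.2 fun a => ?_
  obtain ⟨e, he, hpe⟩ := hp.isLocalHomeomorph ((D.lift p).gluedMap a)
  have ho : IsOpen ((D.lift p).gluedMap ⁻¹' e.source) := e.open_source.preimage continuous_gluedMap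
  refine ⟨_, ho.mem_nhds he, IsOpenEmbedding.of_continuous_injective_isOpenMap
    (continuous_toSpectral.comp continuous_subtype_val) ?_ ?_⟩
  · rintro ⟨b, hb⟩ ⟨b', hb'⟩ h
    refine Subtype.ext (hD.eq_of_toSpectral_eq hp h (e.injOn hb hb' ?_))
    rw [← hpe]
    exact congrArg (D.spectralMap p) h
  · exact (hD.isOpenMap_toSpectral hp).comp ho.isOpenMap_subtype_val

/-- Over p(U) every orbit has exactly one representative above `U`: one exists by transitivity on
fibres, and it is unique because `p` is injective on `U` and the action is free. So the sheets over
`U` map to the sheets over p(U). -/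
theorem hasSheets_spectralMap [SimplyConnectedSpace T] [LocallyPathConnectedSpace T]
    (hD : D.Regular) (hp : IsCoveringMap p) {U : Set T}
    (h : HasSheets.{u} (D.lift p).gluedMap U) (hinj : InjOn p U) :
    HasSheets.{u} (D.spectralMap p) (range (U.domRestrict p)) := by
  obtain ⟨hU, I, s, h1, h2, h3, h4⟩ := h
  have hemb : IsOpenEmbedding (U.domRestrict p) :=
    IsOpenEmbedding.of_continuous_injective_isOpenMap
      (hp.continuous.comp continuous_subtype_val) hinj.injective
      (hp.isOpenMap.comp hU.isOpenMap_subtype_val)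
  let e := hemb.isEmbedding.toHomeomorph
  have hr : ∀ i, range (fun y => D.toSpectral p (s i (e.symm y))) =
      D.toSpectral p '' range (s i) := fun i => by
    rw [← range_comp]
    exact e.symm.surjective.range_comp (D.toSpectral p ∘ s i)
  refine ⟨hemb.isOpen_range, I, fun i y => D.toSpectral p (s i (e.symm y)), fun i => ?_, fun i => ?_,
    fun i y => ?_, fun q hq => ?_⟩
  · exact continuous_toSpectral.comp ((h1 i).comp e.symm.continuous)
  · refine (hr i).symm ▸ ?_
    exact hD.isOpenMap_toSpectral hp _ (h2 i)
  · change p ((D.lift p).gluedMap (s i (e.symm y))) = y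
    rw [h3]
    exact congrArg Subtype.val (e.apply_symm_apply y)
  · obtain ⟨a, rfl⟩ := surjective_toSpectral q
    obtain ⟨u, hu⟩ := hq
    obtain ⟨g, hg, hgu⟩ := exists_deck hp (x := (D.lift p).gluedMap a) (y := u) hu.symm
    set b := hD.deckGlued hp g hg a with hb
    have hab : D.toSpectral p a = D.toSpectral p b :=
      (hD.toSpectral_eq_iff hp).2 ⟨g, hg, rfl⟩
    have hbU : (D.lift p).gluedMap b ∈ U := by
      rw [hb, hD.gluedMap_deckGlued hp, hgu]
      exact u.2
    obtain ⟨i, hi, hi'⟩ := h4 b hbU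
    simp only [hr, hab]
    refine ⟨i, mem_image_of_mem _ hi, ?_⟩
    rintro j ⟨_, ⟨u', rfl⟩, hj⟩
    refine hi' j ⟨u', hD.eq_of_toSpectral_eq hp hj (hinj ?_ hbU (congrArg (D.spectralMap p) hj))⟩
    rw [h3]
    exact u'.2

end Regular

namespace Tame

variable [T2Space S]

theorem spectralMap_isCoveringMapOn [SimplyConnectedSpace T] [LocallyPathConnectedSpace T]
    (hD : D.Tame) (hp : IsCoveringMap p) (hc : D.IsSpectral p) (hs : D.SimpleAtBlack p) :
    IsCoveringMapOn (D.spectralMap p) {x | ∃ v, D.black v ∧ x = D.disk v 0}ᶜ := by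
  have := t2Space_of_covering hp
  intro x₀ hx₀
  by_cases h : ∃ x, p x = x₀
  · obtain ⟨x, rfl⟩ := h
    have hx : ∀ v, (D.lift p).black v → x ≠ (D.lift p).disk v 0 := by
      rintro v hv rfl
      refine hx₀ ⟨v.1, hv, ?_⟩
      rw [lift_disk_zero, v.2.2]
    obtain ⟨U, hxU, hU⟩ := (hD.lift_tame hp).exists_hasSheets hc hs hx
    obtain ⟨e, he, hpe⟩ := hp.isLocalHomeomorph x
    have hinj : InjOn p (U ∩ e.source) := by
      rw [hpe]
      exact e.injOn.mono inter_subset_right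
    exact (hD.toRegular.hasSheets_spectralMap hp
      (hU.mono continuous_gluedMap (hU.1.inter e.open_source) inter_subset_left)
      hinj).isEvenlyCovered (continuous_spectralMap hp) ⟨⟨x, hxU, he⟩, rfl⟩
  -- Outside the image of `p` the fibre is empty. A point over the trivialising neighbourhood would
  -- give a point of the fibre of `p` at `x₀`, so nothing lies over that neighbourhood.
  · obtain ⟨-, U, hxU, hU, -, H, hH⟩ := hp x₀
    refine (IsEvenlyCovered.of_preimage_eq_empty (I := Empty) (hU.mem_nhds hxU)
      (eq_empty_of_forall_notMem fun q hq => ?_)).to_isEvenlyCovered_preimage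
    obtain ⟨a, rfl⟩ := surjective_toSpectral q
    obtain ⟨x, hx⟩ := (H ⟨(D.lift p).gluedMap a, hq⟩).2
    exact h ⟨x, hx⟩

/-- A point over a `•`-vertex that is not itself a vertex of the graph lies in the interior of a
piece, and there the glued map is the inclusion of an open set. Over all other points the covering
property suffices. -/
theorem spectralMap_isLocalHomeomorphOn [SimplyConnectedSpace T] [LocallyPathConnectedSpace T]
    (hD : D.Tame) (hp : IsCoveringMap p) (hc : D.IsSpectral p) (hs : D.SimpleAtBlack p) :
    IsLocalHomeomorphOn (D.spectralMap p)
      {q | ∃ v : D.LiftVertex p, D.black v.1 ∧ q = D.vertexPoint p v}ᶜ := by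
  have := t2Space_of_covering hp
  have hL := hD.lift_tame hp
  have hface : ∀ γ : (D.lift p).Strand, IsLocalHomeomorphOn (D.lift p).gluedMap
      (range fun u : (D.lift p).zigzagDomain γ => (D.lift p).mkFace γ ⟨u, Or.inl u.2⟩) := fun γ =>
    isLocalHomeomorphOn_range_section continuous_gluedMap (hL.isOpen_zigzagDomain' hc γ)
      ((continuous_mkFace γ).comp (continuous_subtype_val.subtype_mk _))
      (hL.isOpen_range_mkFace hc (hL.isOpen_zigzagDomain' hc γ) Subset.rfl) fun _ => rfl
  have hface' : ∀ γ : (D.lift p).Strand, IsLocalHomeomorphOn (D.spectralMap p)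
      (D.toSpectral p '' range fun u : (D.lift p).zigzagDomain γ =>
        (D.lift p).mkFace γ ⟨u, Or.inl u.2⟩) := fun γ =>
    IsLocalHomeomorphOn.of_comp_right (f := D.toSpectral p)
      ((hp.isLocalHomeomorph.isLocalHomeomorphOn (s := univ)).comp (hface γ) (mapsTo_univ _ _))
      (hD.toRegular.isLocalHomeomorph_toSpectral hp).isLocalHomeomorphOn
  intro q hq
  by_cases hb : ∃ v, D.black v ∧ D.spectralMap p q = D.disk v 0
  · obtain ⟨v, hv, hqv⟩ := hb
    obtain ⟨a, rfl⟩ := surjective_toSpectral q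
    obtain ⟨γ, x, rfl⟩ := hL.exists_mkFace a
    have hx : p x.1 = D.disk v 0 := hqv
    obtain ⟨x, hxF⟩ := x
    refine hface' γ _ (mem_image_of_mem _ ⟨⟨x, hxF.resolve_right fun hz => hq ?_⟩, rfl⟩)
    exact ⟨⟨v, x, hx⟩, hv, congrArg (D.toSpectral p) (mkGraph_eq_mkFace rfl hz).symm⟩
  · exact (hD.spectralMap_isCoveringMapOn hp hc hs).isLocalHomeomorphOn q hb

/-- The chart upstairs stays injective in the quotient: if two of its points become equal, the
powers of their parameters agree, so they have the same image in `T`, and freeness applies. The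
chart downstairs is the inverse of the disc parametrisation. -/
theorem hasRamificationIndex_spectralMap [PreconnectedSpace T] (hD : D.Tame)
    (hp : IsCoveringMap p) (hc : D.IsSpectral p) (hs : D.SimpleAtBlack p) {v : D.LiftVertex p}
    (hv : D.black v.1) :
    HasRamificationIndex (D.spectralMap p) (D.vertexPoint p v) (D.val v.1 - 2) := by
  have := t2Space_of_covering hp
  have h0 := Metric.mem_ball_self (x := (0 : ℂ)) one_pos
  have hv0 : (D.lift p).disk v 0 ∈ (D.lift p).graph := ⟨v, Or.inl rfl⟩
  obtain ⟨ψ, h1, h2, h3, h4, h5⟩ := (hD.lift_tame hp).exists_ramified_chart hc hs hv hv0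
  have hn : D.val v.1 - 1 ≠ 0 := by
    have := hD.two_le_val v.1
    omega
  have hpow : ∀ y : Metric.ball (0 : ℂ) 1, y.1 ^ (D.val v.1 - 1) ∈ Metric.ball (0 : ℂ) 1 :=
    fun y => pow_mem_ball y.2 hn
  have hψ : ∀ y, D.spectralMap p (D.toSpectral p (ψ y)) = D.disk v.1 (y.1 ^ (D.val v.1 - 1)) := by
    intro y
    rw [spectralMap_toSpectral, h4]
    exact hD.proj_lift_disk hp v (Metric.ball_subset_closedBall (hpow y))
  have hψ0 : D.vertexPoint p v = D.toSpectral p (ψ ⟨0, h0⟩) := by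
    rw [h5]
    exact congrArg (fun x => D.toSpectral p ((D.lift p).mkGraph x))
      (Subtype.ext (D.lift_disk_zero p v).symm)
  have hψe : IsOpenEmbedding fun y => D.toSpectral p (ψ y) := by
    refine IsOpenEmbedding.of_continuous_injective_isOpenMap (continuous_toSpectral.comp h1)
      (fun y y' h => h2 (hD.eq_of_toSpectral_eq hp h ?_))
      ((hD.toRegular.isOpenMap_toSpectral hp).comp h3)
    rw [h4, h4]
    refine congrArg _ (hD.injOn v.1 (Metric.ball_subset_closedBall (hpow y))
      (Metric.ball_subset_closedBall (hpow y')) ?_)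
    exact (hψ y).symm.trans ((congrArg _ h).trans (hψ y'))
  have hφe : IsOpenEmbedding fun y : Metric.ball (0 : ℂ) 1 => D.disk v.1 y := by
    refine IsOpenEmbedding.of_continuous_injective_isOpenMap
      ((hD.continuousOn v.1).mono Metric.ball_subset_closedBall).domRestrict
      ((hD.injOn v.1).mono Metric.ball_subset_closedBall).injective fun N hN => ?_
    have : IsOpen (D.disk v.1 '' (Subtype.val '' N)) :=
      hD.isOpen_image_disk (Metric.isOpen_ball.isOpenMap_subtype_val N hN)
        (Subtype.coe_image_subset _ _)
    rwa [image_image] at this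
  obtain ⟨a, ha, ha'⟩ := exists_chart_of_isOpenEmbedding Metric.isOpen_ball ⟨0, h0⟩ hψe
  obtain ⟨b, hb, hb'⟩ := exists_chart_of_isOpenEmbedding Metric.isOpen_ball ⟨0, h0⟩ hφe
  have key : ∀ y, D.spectralMap p (D.toSpectral p (ψ y)) ∈ b.source ∧
      b (D.spectralMap p (D.toSpectral p (ψ y))) = y.1 ^ (D.val v.1 - 1) := fun y => by
    rw [hψ, hb]
    exact ⟨⟨⟨_, hpow y⟩, rfl⟩, hb' ⟨_, hpow y⟩⟩
  rw [hψ0]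
  refine ⟨a, b, ha ▸ ⟨_, rfl⟩, (key _).1, ha' _, ?_, fun q hq => ?_⟩
  · rw [(key _).2]
    exact zero_pow hn
  · rw [ha] at hq
    obtain ⟨y, rfl⟩ := hq
    -- Valency at least two keeps the truncated subtraction honest; for valency two the exponent is
    -- 1 and there is no ramification.
    have hn' : D.val v.1 - 2 + 1 = D.val v.1 - 1 := by
      have := hD.two_le_val v.1
      omega
    refine ⟨(key y).1, (key y).2.trans ?_⟩
    rw [ha', hn']

end Tame
end WebData
end SpectralWeb
end

open SpectralWeb in
theorem mainTheorem10 {S T V : Type*} [TopologicalSpace S] [T2Space S]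
    [SecondCountableTopology S] [ConnectedSpace S] [TopologicalSpace T] [SimplyConnectedSpace T]
    (O : OrientedSurface S) (W : WebData V S) (hW : W.IsWeb O)
    (p : T → S) (hp : IsCoveringMap p)
    (hspectral : W.IsSpectral p) (hsimple : W.SimpleAtBlack p) :
    IsCoveringMapOn (W.spectralMap p) {x | ∃ v, W.black v ∧ x = W.disk v 0}ᶜ ∧
    IsLocalHomeomorphOn (W.spectralMap p)
      {q | ∃ v : W.LiftVertex p, W.black v.1 ∧ q = W.vertexPoint p v}ᶜ ∧
    ∀ v : W.LiftVertex p, W.black v.1 →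
      HasRamificationIndex (W.spectralMap p) (W.vertexPoint p v) (W.val v.1 - 2) := by
  have := O.locallyPathConnectedSpace
  have := WebData.locallyPathConnectedSpace_of_covering hp
  exact ⟨hW.tame.spectralMap_isCoveringMapOn hp hspectral hsimple,
    hW.tame.spectralMap_isLocalHomeomorphOn hp hspectral hsimple,
    fun _ => hW.tame.hasRamificationIndex_spectralMap hp hspectral hsimple⟩
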